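/- Let $d\in\mathbb N$ and let $H,F:\mathbb R^d\to\mathbb R$ with $H\in C^4$, $F\in C^2$ be such that $DH$, $DF$, $D^2F$, $D^2H$, $|D^3H(p)|(1+|p|)$ and $D^4H$ are bounded, and consider the separated Hamiltonian $H(p)+F(x)$. (i) There is a constant $c>0$, depending only on $d$ and on a common bound $K$ for the quantities above, such that for every $\lambda>0$ the following holds. The characteristic system $$\dot X=-DH(P),\quad \dot Y=-DH(Q),\quad \dot P=DF(X),\quad \dot Q=DF(Y),\qquad X(0)=x,\ Y(0)=y,\ P(0)=Q(0)=\lambda(x-y),$$ has a solution for all times and all $x,y\in\mathbb R^d$; for every such family of solutions and every $t$ the map $(x,y)\mapsto (X(x,y,t),Y(x,y,t))$ is $C^1$; and, if $J(x,y,t)$ is its Jacobian determinant and $t_\lambda=t_\lambda(x,y)$ is the first time $t>0$ with $J(x,y,t)=\tfrac12$ (if there is one), then $$t_\lambda\ \ge\ c\,\min(1,\lambda^{-1/3}).$$ Moreover, the doubled equation $$U_t=H(D_xU)-H(-D_yU)+F(x)-F(y),\qquad U(x,y,0)=\tfrac{\lambda}{2}|x-y|^2,$$ has a $C^2$ solution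 in $\mathbb R^d\times\mathbb R^d\times(-\tau,\tau)$ with $\tau=c\min(1,\lambda^{-1/3})$. (ii) Let $T>0$, $\beta\ge 2/5$, let $B:[0,\infty)\to\mathbb R$ be $\beta$-Hölder continuous on $[0,R]$ for every $R>0$, and let $u,v$ be bounded and uniformly continuous on $\mathbb R^d\times[0,T]$, respectively a pathwise subsolution and a pathwise supersolution of $$du=\big(H(Du)+F(x)\big)\cdot dB\quad\text{in }\mathbb R^d\times(0,T].$$ Then, for all $t\in[0,T]$, $$\sup_{x\in\mathbb R^d}\big(u(x,t)-v(x,t)\big)\ \le\ \sup_{x\in\mathbb R^d}\big(u(x,0)-v(x,0)\big).$$ Here a smooth solution $\Phi$ of $d\Phi=(H(D\Phi)+F(x))\cdot dB$ in $\mathbb R^d\times(t_0-h,t_0+h)$, with $0<h\le t_0$, is a function of the form $\Phi(x,t)=U(x,B(t)-B(t_0))$, where, for some $\tau>0$ with $|B(t)-B(t_0)|<\tau$ on $(t_0-h,t_0+h)$, $U$ is a $C^2$ solution of $U_t=H(DU)+F(x)$ in $\mathbb R^d\times(-\tau,\tau)$. A bounded uniformly continuous $u$ on $\mathbb R^d\times[0,T]$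 is a pathwise subsolution (resp. supersolution) if, for all such $\Phi$ and all $\psi\in C^1((0,\infty))$, whenever $u-\Phi-\psi$ restricted to times $t\in(t_0-h,t_0+h)$, $t\le T$, has a maximum (resp. minimum) at $(x_0,t_0)$ with $t_0\in(0,T]$, then $\psi'(t_0)\le 0$ (resp. $\psi'(t_0)\ge0$). -/

import Mathlib

open Set
open scoped Gradient NNReal

noncomputable section

/-- The Euclidean space `ℝ^d`. -/
abbrev Rd (d : ℕ) : Type := EuclideanSpace ℝ (Fin d)

/-- The separated Hamiltonian `(p, x) ↦ H p + F x`. -/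
def separatedHamiltonian {d : ℕ} (H F : Rd d → ℝ) : Rd d → Rd d → ℝ :=
  fun p x => H p + F x

/-- `H` is `C⁴`, `F` is `C²`, and `DH`, `DF`, `D²F`, `D²H`, `|D³H| (1 + |p|)`, `D⁴H` are all
bounded by `K`. -/
structure SeparatedBounds {d : ℕ} (K : ℝ) (H F : Rd d → ℝ) : Prop where
  contDiff_H : ContDiff ℝ 4 H
  contDiff_F : ContDiff ℝ 2 F
  bound_DH : ∀ p, ‖iteratedFDeriv ℝ 1 H p‖ ≤ K
  bound_DF : ∀ x, ‖iteratedFDeriv ℝ 1 F x‖ ≤ K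
  bound_D2F : ∀ x, ‖iteratedFDeriv ℝ 2 F x‖ ≤ K
  bound_D2H : ∀ p, ‖iteratedFDeriv ℝ 2 H p‖ ≤ K
  bound_D3H : ∀ p, ‖iteratedFDeriv ℝ 3 H p‖ * (1 + ‖p‖) ≤ K
  bound_D4H : ∀ p, ‖iteratedFDeriv ℝ 4 H p‖ ≤ K

/-! ### The deterministic doubled equation -/

/-- The `(X, Y, P, Q)`-components of the characteristics of the doubled equation
`U_t = H(D_x U, x) - H(-D_y U, y)`, `U(x, y, 0) = (lam / 2) |x - y|²`; `X x y t` is the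
`X`-component at time `t` of the characteristic that starts at `(x, y)`. -/
structure IsDoubledCharacteristicFlow {d : ℕ} (H : Rd d → Rd d → ℝ) (lam : ℝ)
    (X Y P Q : Rd d → Rd d → ℝ → Rd d) : Prop where
  deriv_X : ∀ x y t, HasDerivAt (X x y) (-(∇ (fun p => H p (X x y t)) (P x y t))) t
  deriv_Y : ∀ x y t, HasDerivAt (Y x y) (-(∇ (fun q => H q (Y x y t)) (Q x y t))) t
  deriv_P : ∀ x y t, HasDerivAt (P x y) (∇ (fun ξ => H (P x y t) ξ) (X x y t)) t
  deriv_Q : ∀ x y t, HasDerivAt (Q x y) (∇ (fun η => H (Q x y t) η) (Y x y t)) t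
  init_X : ∀ x y, X x y 0 = x
  init_Y : ∀ x y, Y x y 0 = y
  init_P : ∀ x y, P x y 0 = lam • (x - y)
  init_Q : ∀ x y, Q x y 0 = lam • (x - y)

/-- The map `(x, y) ↦ (X(x, y, t), Y(x, y, t))`. -/
def flowMap {d : ℕ} (X Y : Rd d → Rd d → ℝ → Rd d) (t : ℝ) : Rd d × Rd d → Rd d × Rd d :=
  fun z => (X z.1 z.2 t, Y z.1 z.2 t)

/-- The Jacobian determinant of `(x, y) ↦ (X(x, y, t), Y(x, y, t))`. -/
def flowJacobian {d : ℕ} (X Y : Rd d → Rd d → ℝ → Rd d) (x y : Rd d) (t : ℝ) : ℝ :=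
  (fderiv ℝ (flowMap X Y t) (x, y)).det

/-- `U` is a smooth (that is, `C²`) solution of `U_t = H(D_x U, x) - H(-D_y U, y)` in
`ℝ^d × ℝ^d × (-τ, τ)` with `U(x, y, 0) = (lam / 2) |x - y|²`. -/
structure IsSmoothDoubledSolution {d : ℕ} (H : Rd d → Rd d → ℝ) (lam τ : ℝ)
    (U : Rd d → Rd d → ℝ → ℝ) : Prop where
  contDiffOn : ContDiffOn ℝ 2 (fun z : Rd d × Rd d × ℝ => U z.1 z.2.1 z.2.2)
    (univ ×ˢ (univ ×ˢ Ioo (-τ) τ))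
  equation : ∀ x y, ∀ t ∈ Ioo (-τ) τ,
    HasDerivAt (fun s => U x y s)
      (H (∇ (fun x' => U x' y t) x) x - H (-(∇ (fun y' => U x y' t) y)) y) t
  init : ∀ x y, U x y 0 = lam / 2 * ‖x - y‖ ^ 2

/-! ### Pathwise viscosity sub- and supersolutions of `du = H(Du, x) · dB` -/

/-- `U` is a smooth (that is, `C²`) solution of `U_t = H(DU, x)` in `ℝ^d × (-τ, τ)`. -/
structure IsSmoothSolution {d : ℕ} (H : Rd d → Rd d → ℝ) (τ : ℝ) (U : Rd d → ℝ → ℝ) :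
    Prop where
  contDiffOn : ContDiffOn ℝ 2 (fun z : Rd d × ℝ => U z.1 z.2) (univ ×ˢ Ioo (-τ) τ)
  equation : ∀ x, ∀ t ∈ Ioo (-τ) τ,
    HasDerivAt (fun s => U x s) (H (∇ (fun x' => U x' t) x) x) t

/-- `Φ` is a smooth solution of `dΦ = H(DΦ, x) · dB` in `ℝ^d × (t₀ - h, t₀ + h)`: it is
`U(x, B(t) - B(t₀))` for a smooth solution `U` of `U_t = H(DU, x)` in `ℝ^d × (-τ, τ)`, where `B`
stays at distance less than `τ` from `B(t₀)` on `(t₀ - h, t₀ + h)`. -/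
def IsSmoothPathwiseSolution {d : ℕ} (H : Rd d → Rd d → ℝ) (B : ℝ → ℝ) (t₀ h : ℝ)
    (Φ : Rd d → ℝ → ℝ) : Prop :=
  ∃ (τ : ℝ) (U : Rd d → ℝ → ℝ), 0 < τ ∧ IsSmoothSolution H τ U ∧
    ∀ t ∈ Ioo (t₀ - h) (t₀ + h), |B t - B t₀| < τ ∧ ∀ x, Φ x t = U x (B t - B t₀)

/-- `u ∈ BUC(ℝ^d × [0, T])`. -/
def IsBUC {d : ℕ} (T : ℝ) (u : Rd d → ℝ → ℝ) : Prop :=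
  (∃ M : ℝ, ∀ x, ∀ t ∈ Icc 0 T, |u x t| ≤ M) ∧
    UniformContinuousOn (fun z : Rd d × ℝ => u z.1 z.2) (univ ×ˢ Icc 0 T)

/-- Pathwise subsolutions in `BUC(ℝ^d × [0, T])` of `du = H(Du, x) · dB` in `ℝ^d × (0, T]`. -/
def IsPathwiseSubsolution {d : ℕ} (H : Rd d → Rd d → ℝ) (B : ℝ → ℝ) (T : ℝ)
    (u : Rd d → ℝ → ℝ) : Prop :=
  IsBUC T u ∧
    ∀ (x₀ : Rd d) (t₀ h : ℝ) (Φ : Rd d → ℝ → ℝ) (ψ : ℝ → ℝ),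
      t₀ ∈ Ioc 0 T → 0 < h → h ≤ t₀ → IsSmoothPathwiseSolution H B t₀ h Φ →
      ContDiffOn ℝ 1 ψ (Ioi 0) →
      IsMaxOn (fun z : Rd d × ℝ => u z.1 z.2 - Φ z.1 z.2 - ψ z.2)
        (univ ×ˢ (Ioo (t₀ - h) (t₀ + h) ∩ Iic T)) (x₀, t₀) →
      deriv ψ t₀ ≤ 0

/-- Pathwise supersolutions in `BUC(ℝ^d × [0, T])` of `du = H(Du, x) · dB` in `ℝ^d × (0, T]`. -/
def IsPathwiseSupersolution {d : ℕ} (H : Rd d → Rd d → ℝ) (B : ℝ → ℝ) (T : ℝ)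
    (v : Rd d → ℝ → ℝ) : Prop :=
  IsBUC T v ∧
    ∀ (x₀ : Rd d) (t₀ h : ℝ) (Φ : Rd d → ℝ → ℝ) (ψ : ℝ → ℝ),
      t₀ ∈ Ioc 0 T → 0 < h → h ≤ t₀ → IsSmoothPathwiseSolution H B t₀ h Φ →
      ContDiffOn ℝ 1 ψ (Ioi 0) →
      IsMinOn (fun z : Rd d × ℝ => v z.1 z.2 - Φ z.1 z.2 - ψ z.2)
        (univ ×ˢ (Ioo (t₀ - h) (t₀ + h) ∩ Iic T)) (x₀, t₀) →
      0 ≤ deriv ψ t₀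

end

/-! Both halves of the doubled characteristic system are orbits of one Hamiltonian flow, that of
`hamField`, started at `(x, p)` and `(y, p)` with the same momentum `p = λ(x - y)`. Part (i) needs
the endpoint map `(x, y) ↦ (X, Y)` to stay close to the identity up to times of order `λ^(-1/3)`. A
crude bound on the derivative of the flow gives only times of order `1/λ`. The gain comes from
estimating `X - Y`. Linearize along the two orbits, with variations `(ξ, π)` and `(η, θ)`, and put
`z = ξ(0) - η(0)`. Then `(ξ - η)' = -D²H(P)(π - θ) - (D²H(P) - D²H(Q))θ`. The difference `π - θ`
starts at zero, so it is only of order `τ` plus `λτ²|z|`. In the second term `θ` has size about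
`λ|z|`, but `|P - Q| ≲ τ|x - y|` while `P` and `Q` have size about `λ|x - y|`, so the decay of `D³H`
gives `λ|D²H(P) - D²H(Q)| ≲ τ`. Integration leaves errors `τ²` and `λτ³` in the difference
(`linearized_estimate`, `twoTimeDeriv_estimate`).

The remaining large entry of the derivative, of size `λτ`, is off-diagonal and disappears after
rescaling `x - y` (`exists_twoTimeClose`). Hence the Jacobian stays near `1`, the endpoint map is a
bijection, and the initial datum plus the difference of the two actions is a `C²` solution.

For part (ii) the two characteristics run for different times `a`, `b`, and the datum is tilted by
`ε⟨x⟩` to gain compactness. The resulting function (`twoTimeSol`) solves the equation separately in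
`(x, a)` and, up to sign, in `(y, b)`, so with `a`, `b` replaced by increments of `B` it provides
test functions for `u` and for `v`. Doubling the time variable then shows that the supremum of `u -
v - U` cannot increase as long as `B` moves by less than `τ` (`sub_sub_initialDatum_le`).

Restarting from the datum `(λ/2)|x - y|²` costs at most a multiple of `|ΔB| |x - y|`, and only `|x -
y| ≤ η λ^(-1/2)` matters, with `η` arbitrarily small. Time steps of length `ρ⁵` give `|ΔB| ≲ ρ²`;
with `λ` of order `ρ⁻⁶` they fit into the lifespan `λ^(-1/3)`, and the `ρ⁻⁵` steps cost `ρ² · ηρ³`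
each, a total of order `η` (`sub_le_add_of_holder`). This balance is where the exponent `2/5` comes
from. -/

noncomputable section
open Filter Topology

/-! ### Flows of bounded Lipschitz `C¹` vector fields. -/

variable {E : Type*} [NormedAddCommGroup E] [NormedSpace ℝ E]

/-- Two-sided Grönwall estimate for two approximate solutions of the same ODE. -/
theorem dist_le_gronwallBound_abs {v : ℝ → E → E} {K : ℝ≥0} (hv : ∀ t, LipschitzWith K (v t))
    {a b a' b' : ℝ → E} {T εa εb : ℝ}
    (ha : ∀ t, |t| ≤ T → HasDerivAt a (a' t) t) (hb : ∀ t, |t| ≤ T → HasDerivAt b (b' t) t)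
    (ha' : ∀ t, |t| ≤ T → dist (a' t) (v t (a t)) ≤ εa)
    (hb' : ∀ t, |t| ≤ T → dist (b' t) (v t (b t)) ≤ εb) {t : ℝ} (ht : |t| ≤ T) :
    dist (a t) (b t) ≤ gronwallBound (dist (a 0) (b 0)) K (εa + εb) |t| := by
  rcases le_total 0 t with h0 | h0
  · have hI : ∀ s ∈ Icc 0 t, |s| ≤ T := fun s hs => by
      rw [abs_of_nonneg hs.1]; rw [abs_of_nonneg h0] at ht; exact hs.2.trans ht
    have := dist_le_of_approx_trajectories_ODE (a := 0) (b := t) (f := a) (g := b) (f' := a')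
      (g' := b') (εf := εa) (εg := εb) (δ := dist (a 0) (b 0)) hv
      (fun s hs => (ha s (hI s hs)).continuousAt.continuousWithinAt)
      (fun s hs => (ha s (hI s ⟨hs.1, hs.2.le⟩)).hasDerivWithinAt)
      (fun s hs => ha' s (hI s ⟨hs.1, hs.2.le⟩))
      (fun s hs => (hb s (hI s hs)).continuousAt.continuousWithinAt)
      (fun s hs => (hb s (hI s ⟨hs.1, hs.2.le⟩)).hasDerivWithinAt)
      (fun s hs => hb' s (hI s ⟨hs.1, hs.2.le⟩)) le_rfl t ⟨h0, le_rfl⟩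
    simpa [abs_of_nonneg h0] using this
  · have hI : ∀ s ∈ Icc 0 (-t), |-s| ≤ T := fun s hs => by
      rw [abs_neg, abs_of_nonneg hs.1]; rw [abs_of_nonpos h0] at ht; exact hs.2.trans ht
    have hneg : ∀ (c c' : ℝ → E) (s : ℝ), HasDerivAt c (c' (-s)) (-s) →
        HasDerivAt (fun s => c (-s)) (-(c' (-s))) s := fun c c' s h => by
      simpa [Function.comp_def] using h.scomp s (hasDerivAt_neg s)
    have := dist_le_of_approx_trajectories_ODE (a := 0) (b := -t) (f := fun s => a (-s))
      (g := fun s => b (-s)) (f' := fun s => -(a' (-s))) (g' := fun s => -(b' (-s)))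
      (v := fun s x => -(v (-s) x)) (K := K) (εf := εa) (εg := εb) (δ := dist (a 0) (b 0))
      (fun s => (hv (-s)).neg)
      (fun s hs => (hneg a a' s (ha _ (hI s hs))).continuousAt.continuousWithinAt)
      (fun s hs => (hneg a a' s (ha _ (hI s ⟨hs.1, hs.2.le⟩))).hasDerivWithinAt)
      (fun s hs => by simpa using ha' _ (hI s ⟨hs.1, hs.2.le⟩))
      (fun s hs => (hneg b b' s (hb _ (hI s hs))).continuousAt.continuousWithinAt)
      (fun s hs => (hneg b b' s (hb _ (hI s ⟨hs.1, hs.2.le⟩))).hasDerivWithinAt)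
      (fun s hs => by simpa using hb' _ (hI s ⟨hs.1, hs.2.le⟩)) (by simp) (-t)
      ⟨by linarith, le_rfl⟩
    simpa [abs_of_nonpos h0] using this

/-- A bounded Lipschitz vector field has a global flow. -/
theorem exists_global_flow [CompleteSpace E] {f : E → E} {K L : ℝ≥0} (hf : LipschitzWith K f)
    (hL : ∀ z, ‖f z‖ ≤ L) :
    ∃ φ : E → ℝ → E, ∀ z, φ z 0 = z ∧ ∀ t, HasDerivAt (φ z) (f (φ z t)) t := by
  have hloc : ∀ (z : E) (n : ℕ), ∃ γ : ℝ → E, γ 0 = z ∧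
      ∀ t ∈ Ioo (-(n : ℝ)) n, HasDerivAt γ (f (γ t)) t := by
    intro z n
    -- The field is bounded by `L`, so a curve stays in the ball of radius `L * n` up to time `n`,
    -- and Picard–Lindelöf covers the whole interval at once.
    have hPL : IsPicardLindelof (fun _ => f) (tmin := -(n : ℝ)) (tmax := n)
        ⟨0, by simp, by simp⟩ z (L * n) 0 L K :=
      { lipschitzOnWith := fun t _ => hf.lipschitzOnWith
        continuousOn := fun x _ => continuousOn_const
        norm_le := fun t _ x _ => hL x
        mul_max_le := by simp }
    obtain ⟨γ, h0, hγ⟩ := hPL.exists_eq_forall_mem_Icc_hasDerivWithinAt₀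
    exact ⟨γ, h0, fun t ht => (hγ t ⟨ht.1.le, ht.2.le⟩).hasDerivAt (Icc_mem_nhds ht.1 ht.2)⟩
  choose γ hγ0 hγ using hloc
  have hagree : ∀ z (m n : ℕ) (t : ℝ), |t| < m → |t| < n → γ z m t = γ z n t := by
    intro z m n t hm hn
    rw [abs_lt] at hm hn
    have hpos : (0 : ℝ) < min (m : ℝ) n := lt_min (by linarith) (by linarith)
    refine ODE_solution_unique_of_mem_Ioo (v := fun _ => f) (s := fun _ => univ) (K := K)
      (t₀ := 0) (a := -(min (m : ℝ) n)) (b := min (m : ℝ) n) (fun _ _ => hf.lipschitzOnWith)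
      ⟨by linarith, hpos⟩ (fun s hs => ⟨hγ z m s ⟨?_, ?_⟩, trivial⟩)
      (fun s hs => ⟨hγ z n s ⟨?_, ?_⟩, trivial⟩) (by rw [hγ0, hγ0])
      ⟨?_, lt_min hm.2 hn.2⟩
    · linarith [hs.1, min_le_left (m : ℝ) n]
    · linarith [hs.2, min_le_left (m : ℝ) n]
    · linarith [hs.1, min_le_right (m : ℝ) n]
    · linarith [hs.2, min_le_right (m : ℝ) n]
    · rcases min_choice (m : ℝ) n with h | h <;> rw [h] <;> linarith
  -- The index `⌊|t|⌋₊ + 1` exceeds `|t|`; since the local solutions agree, it may be frozen near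
  -- each time.
  refine ⟨fun z t => γ z (⌊|t|⌋₊ + 1) t, fun z => ⟨hγ0 _ _, fun t => ?_⟩⟩
  have ht : |t| < ((⌊|t|⌋₊ + 1 : ℕ) : ℝ) := by exact_mod_cast Nat.lt_floor_add_one |t|
  refine (hγ z _ t (abs_lt.1 ht)).congr_of_eventuallyEq ?_
  have : ∀ᶠ s : ℝ in 𝓝 t, |s| < ((⌊|t|⌋₊ + 1 : ℕ) : ℝ) := continuous_abs.tendsto t |>.eventually_lt_const ht
  filter_upwards [this] with s hs
  exact hagree z _ _ s (by exact_mod_cast Nat.lt_floor_add_one |s|) hs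

/-- The linear equation `w' = A(t) w`, `w(0) = 1` can be solved for short times. -/
theorem exists_linear_solution [CompleteSpace E] {A : ℝ → E →L[ℝ] E} (hA : Continuous A) {K : ℝ≥0}
    (hK : ∀ t, ‖A t‖ ≤ K) :
    ∃ w : ℝ → E →L[ℝ] E, w 0 = ContinuousLinearMap.id ℝ E ∧
      ∀ t, |t| < (2 * (K + 1) : ℝ)⁻¹ → HasDerivAt w ((A t).comp (w t)) t := by
  -- On the unit ball about the identity the right-hand side has norm at most `2 * K`, so solutions
  -- stay in it up to time `δ`; `K + 1` instead of `K` covers `K = 0`.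
  set δ : ℝ := (2 * (K + 1) : ℝ)⁻¹ with hδ
  have hδ0 : 0 < δ := by positivity
  have hPL : IsPicardLindelof (fun t (w : E →L[ℝ] E) => (A t).comp w) (tmin := -δ) (tmax := δ)
      ⟨0, by simp [hδ0.le], by simp [hδ0.le]⟩ (ContinuousLinearMap.id ℝ E) 1 0 (2 * K) K :=
    { lipschitzOnWith := fun t _ => by
        refine LipschitzWith.lipschitzOnWith (LipschitzWith.of_dist_le_mul fun w w' => ?_)
        rw [dist_eq_norm, dist_eq_norm, ← ContinuousLinearMap.comp_sub]
        exact (ContinuousLinearMap.opNorm_comp_le _ _).trans (by gcongr; exact hK t)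
      continuousOn := fun x _ => by fun_prop
      norm_le := fun t _ w hw => by
        have h1 : ‖w‖ ≤ 2 := by
          have := norm_le_norm_add_norm_sub' w (ContinuousLinearMap.id ℝ E)
          have h2 : ‖w - ContinuousLinearMap.id ℝ E‖ ≤ 1 := by simpa [dist_eq_norm] using hw
          linarith [ContinuousLinearMap.norm_id_le (𝕜 := ℝ) (E := E)]
        calc _ ≤ ‖A t‖ * ‖w‖ := ContinuousLinearMap.opNorm_comp_le _ _
          _ ≤ K * 2 := by gcongr; exact hK t
          _ = _ := by push_cast; ring
      mul_max_le := by
        simp only [sub_zero, zero_sub, neg_neg, max_self, NNReal.coe_mul, NNReal.coe_ofNat,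
          NNReal.coe_one, NNReal.coe_zero]
        rw [hδ, ← div_eq_mul_inv, div_le_one (by positivity)]
        linarith }
  obtain ⟨w, h0, hw⟩ := hPL.exists_eq_forall_mem_Icc_hasDerivWithinAt₀
  refine ⟨w, h0, fun t ht => ?_⟩
  rw [abs_lt] at ht
  exact (hw t ⟨ht.1.le, ht.2.le⟩).hasDerivAt (Icc_mem_nhds ht.1 ht.2)

/-- Isolates the linear dependence on the defect `ε`, so that the defect can be chosen small against
a fixed time factor. -/
theorem gronwallBound_eq_add (δ K ε x : ℝ) :
    gronwallBound δ K ε x = δ * Real.exp (K * x) + ε * gronwallBound 0 K 1 x := by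
  by_cases hK : K = 0
  · subst hK; simp [gronwallBound_K0]
  · simp [gronwallBound_of_K_ne_0 hK]; ring

theorem gronwallBound_zero_one_nonneg {K x : ℝ} (hK : 0 ≤ K) (hx : 0 ≤ x) :
    0 ≤ gronwallBound 0 K 1 x := by
  have := gronwallBound_mono (δ := 0) (ε := 1) le_rfl zero_le_one hK hx
  simpa [gronwallBound_x0] using this

theorem dist_flow_le {f : E → E} {K : ℝ≥0} (hf : LipschitzWith K f) {a b : ℝ → E}
    (ha : ∀ t, HasDerivAt a (f (a t)) t) (hb : ∀ t, HasDerivAt b (f (b t)) t) (t : ℝ) :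
    dist (a t) (b t) ≤ Real.exp (K * |t|) * dist (a 0) (b 0) := by
  have := dist_le_gronwallBound_abs (v := fun _ => f) (fun _ => hf) (T := |t|) (εa := 0) (εb := 0)
    (fun s _ => ha s) (fun s _ => hb s) (by simp) (by simp) le_rfl
  rwa [add_zero, gronwallBound_ε0, mul_comm] at this

/-- A global flow of the vector field `f`, together with its spatial derivative for times
`|t| < δ`. -/
structure C1Flow (f : E → E) (δ : ℝ) where
  /-- the flow -/
  φ : E → ℝ → E
  /-- the spatial derivative of the flow -/
  W : E → ℝ → E →L[ℝ] E
  init : ∀ z, φ z 0 = z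
  deriv : ∀ z t, HasDerivAt (φ z) (f (φ z t)) t
  W_init : ∀ z, W z 0 = ContinuousLinearMap.id ℝ E
  W_deriv : ∀ z t, |t| < δ → HasDerivAt (W z) ((fderiv ℝ f (φ z t)).comp (W z t)) t
  hasFDerivAt : ∀ z t, |t| < δ → HasFDerivAt (fun z => φ z t) (W z t) z
  continuous_φ : Continuous fun q : E × ℝ => φ q.1 q.2
  continuousAt_W : ∀ z t, |t| < δ → ContinuousAt (fun q : E × ℝ => W q.1 q.2) (z, t)

/-- A bounded Lipschitz vector field of class `C¹` has a flow of class `C¹`. -/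
theorem nonempty_C1Flow [CompleteSpace E] {f : E → E} {K L : ℝ≥0} (hf : LipschitzWith K f)
    (hL : ∀ z, ‖f z‖ ≤ L) (hC : ContDiff ℝ 1 f) :
    Nonempty (C1Flow f (2 * (K + 1) : ℝ)⁻¹) := by
  obtain ⟨φ, hφ⟩ := exists_global_flow hf hL
  have hlip : ∀ z z' t, dist (φ z t) (φ z' t) ≤ Real.exp (K * |t|) * dist z z' := fun z z' t => by
    have := dist_flow_le hf (hφ z).2 (hφ z').2 t
    rwa [(hφ z).1, (hφ z').1] at this
  have hcont : Continuous fun q : E × ℝ => φ q.1 q.2 := by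
    refine continuous_iff_continuousAt.2 fun ⟨z, t⟩ => ?_
    have h1 : Tendsto (fun q : E × ℝ => Real.exp (K * |q.2|) * dist q.1 z +
        dist (φ z q.2) (φ z t)) (𝓝 (z, t)) (𝓝 0) := by
      have hc : ContinuousAt (fun q : E × ℝ => φ z q.2) (z, t) :=
        ContinuousAt.comp (f := fun q : E × ℝ => q.2) (g := φ z) ((hφ z).2 t).continuousAt
          continuousAt_snd
      have h2 : ContinuousAt (fun q : E × ℝ => Real.exp (K * |q.2|) * dist q.1 z +
        dist (φ z q.2) (φ z t)) (z, t) :=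
      ((Real.continuous_exp.comp (by fun_prop)).continuousAt.mul
        (continuousAt_fst.dist continuousAt_const)).add (hc.dist continuousAt_const)
      simpa [ContinuousAt] using h2
    refine tendsto_iff_dist_tendsto_zero.2 (squeeze_zero (fun _ => dist_nonneg) (fun q => ?_) h1)
    exact (dist_triangle _ (φ z q.2) _).trans (by gcongr; exact hlip _ _ _)
  have hφc : ∀ z, Continuous (φ z) := fun z =>
    continuous_iff_continuousAt.2 fun t => ((hφ z).2 t).continuousAt
  have hDf : Continuous (fderiv ℝ f) := hC.continuous_fderiv one_ne_zero
  have hDK : ∀ z, ‖fderiv ℝ f z‖ ≤ K := fun z => norm_fderiv_le_of_lipschitz ℝ hf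
  have hdiff : Differentiable ℝ f := hC.differentiable one_ne_zero
  have hW : ∀ z, _ := fun z => exists_linear_solution (A := fun t => fderiv ℝ f (φ z t))
    (hDf.comp (hφc z)) (fun t => hDK _)
  choose W hW0 hW using hW
  have hlin : ∀ z t, LipschitzWith K fun x => fderiv ℝ f (φ z t) x := fun z t =>
    (fderiv ℝ f (φ z t)).lipschitz.weaken (by exact_mod_cast hDK _)
  have hD : ∀ z t, |t| < (2 * (K + 1) : ℝ)⁻¹ → HasFDerivAt (fun z => φ z t) (W z t) z := by
    intro z t ht
    set C := Real.exp (K * |t|) with hCdef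
    set G := gronwallBound 0 K 1 |t| with hG
    have hG0 : 0 ≤ G := gronwallBound_zero_one_nonneg K.2 (abs_nonneg t)
    have hC0 : 0 < C := Real.exp_pos _
    rw [hasFDerivAt_iff_isLittleO_nhds_zero, Asymptotics.isLittleO_iff]
    intro ε hε
    set η := ε / (C * (G + 1)) with hη
    have hη0 : 0 < η := by positivity
    -- Compactness of the time interval alone yields one radius `r` for the whole orbit; no local
    -- compactness of `E` is used.
    have hunif := IsCompact.mem_uniformity_of_prod (k := Icc (-|t|) |t|) (s := univ)
      (f := fun (k : E) (s : ℝ) => fderiv ℝ f (φ z s + k)) (q := 0) isCompact_Icc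
      (Continuous.continuousOn (by
        refine hDf.comp ?_
        exact ((hφc z).comp continuous_snd).add continuous_fst)) (mem_univ _)
      (Metric.dist_mem_uniformity hη0)
    obtain ⟨S, hS, hS'⟩ := hunif
    rw [nhdsWithin_univ] at hS
    obtain ⟨r, hr, hrS⟩ := Metric.mem_nhds_iff.1 hS
    have hsmall : ∀ s, |s| ≤ |t| → ∀ k : E, ‖k‖ < r →
        ‖f (φ z s + k) - f (φ z s) - fderiv ℝ f (φ z s) k‖ ≤ η * ‖k‖ := by
      intro s hs k hk
      have := (convex_ball (φ z s) r).norm_image_sub_le_of_norm_hasFDerivWithin_le' (f := f)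
        (f' := fderiv ℝ f) (φ := fderiv ℝ f (φ z s)) (C := η) (x := φ z s) (y := φ z s + k)
        (fun x _ => (hdiff x).hasFDerivAt.hasFDerivWithinAt) (fun x hx => ?_)
        (Metric.mem_ball_self hr) (by simpa using hk)
      · simpa using this
      · have h1 : x - φ z s ∈ S := hrS (by simpa [dist_eq_norm] using hx)
        have := hS' _ h1 s (abs_le.1 hs)
        simp only [add_sub_cancel, add_zero, mem_ofPred_eq] at this
        rw [dist_eq_norm] at this
        exact this.le
    have hev : ∀ᶠ h in 𝓝 (0 : E), ‖h‖ < r / C :=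
      Metric.eventually_nhds_iff.2 ⟨r / C, by positivity, fun h hh => by simpa using hh⟩
    filter_upwards [hev] with h hh
    have hk : ∀ s, |s| ≤ |t| → ‖φ (z + h) s - φ z s‖ ≤ C * ‖h‖ := fun s hs => by
      have := hlip (z + h) z s
      rw [dist_eq_norm, dist_eq_norm, add_sub_cancel_left] at this
      refine this.trans (mul_le_mul_of_nonneg_right ?_ (norm_nonneg h))
      rw [hCdef]; gcongr
    have hr' : C * ‖h‖ < r := by rwa [mul_comm, ← lt_div_iff₀ hC0]
    -- Both `φ (z + h) - φ z` and `W z · h` start at `h`. The second solves the linearized equation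
    -- exactly, the first up to the defect `η C ‖h‖`, and `η` was chosen so that this defect
    -- contributes at most `ε ‖h‖`.
    have key := dist_le_gronwallBound_abs (v := fun s x => fderiv ℝ f (φ z s) x) (K := K)
      (fun s => hlin z s) (T := |t|) (a := fun s => φ (z + h) s - φ z s) (b := fun s => W z s h)
      (εa := η * (C * ‖h‖)) (εb := 0) (fun s _ => ((hφ (z + h)).2 s).sub ((hφ z).2 s))
      (fun s hs => by
        simpa using! (hW z s (hs.trans_lt ht)).clm_apply (hasDerivAt_const s h))
      (fun s hs => by
        rw [dist_eq_norm]
        have := hsmall s hs _ ((hk s hs).trans_lt hr')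
        rw [add_sub_cancel] at this
        exact this.trans (by gcongr; exact hk s hs))
      (fun s _ => by simp) le_rfl
    rw [gronwallBound_eq_add, (hφ _).1, (hφ _).1, hW0] at key
    simp only [add_sub_cancel_left, ContinuousLinearMap.coe_id', id_eq, dist_self, zero_mul,
      zero_add, add_zero] at key
    rw [dist_eq_norm] at key
    refine key.trans ?_
    calc η * (C * ‖h‖) * G = ε * ‖h‖ * (G / (G + 1)) := by rw [hη]; field_simp
      _ ≤ ε * ‖h‖ * 1 := by
        gcongr
        rw [div_le_one (by positivity)]; linarith
      _ = ε * ‖h‖ := mul_one _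
  have hWbd : ∀ z t, |t| < (2 * (K + 1) : ℝ)⁻¹ → ‖W z t‖ ≤ Real.exp (K * |t|) := fun z t ht => by
    have hl : LipschitzWith ⟨Real.exp (K * |t|), (Real.exp_pos _).le⟩ (fun z => φ z t) :=
      LipschitzWith.of_dist_le_mul fun z z' => hlip z z' t
    exact (hD z t ht).le_of_lipschitz hl
  refine ⟨⟨φ, W, fun z => (hφ z).1, fun z => (hφ z).2, hW0, hW, hD, hcont, fun z t ht => ?_⟩⟩
  obtain ⟨T, hT, hTδ⟩ := exists_between ht
  set C := Real.exp (K * T) with hCdef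
  set G := gronwallBound 0 K 1 T with hG
  have hT0 : 0 ≤ T := (abs_nonneg t).trans hT.le
  have hG0 : 0 ≤ G := gronwallBound_zero_one_nonneg K.2 hT0
  have hC0 : 0 < C := Real.exp_pos _
  rw [Metric.continuousAt_iff']
  intro ε hε
  set η := ε / 2 / (C * (G + 1)) with hη
  have hη0 : 0 < η := by positivity
  obtain ⟨S, hS, hS'⟩ := IsCompact.mem_uniformity_of_prod (k := Icc (-T) T) (s := univ)
      (f := fun (z : E) (s : ℝ) => fderiv ℝ f (φ z s)) (q := z) isCompact_Icc
      (Continuous.continuousOn (hDf.comp hcont)) (mem_univ _)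
      (Metric.dist_mem_uniformity hη0)
  rw [nhdsWithin_univ] at hS
  have h1 : ∀ᶠ q : E × ℝ in 𝓝 (z, t), q.1 ∈ S := continuousAt_fst hS
  have h2 : ∀ᶠ q : E × ℝ in 𝓝 (z, t), |q.2| < T :=
    (continuous_snd.abs.tendsto (z, t)).eventually_lt_const hT
  have h3 : ∀ᶠ q : E × ℝ in 𝓝 (z, t), dist (W z q.2) (W z t) < ε / 2 := by
    have : ContinuousAt (fun q : E × ℝ => W z q.2) (z, t) :=
      ContinuousAt.comp (f := fun q : E × ℝ => q.2) (g := W z) (hW z t ht).continuousAt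
          continuousAt_snd
    exact Metric.continuousAt_iff'.1 this _ (by positivity)
  filter_upwards [h1, h2, h3] with ⟨z', s⟩ hz hs hsW
  -- `W z'` is an approximate solution of the linear equation satisfied by `W z`, with the same
  -- initial value.
  have key := dist_le_gronwallBound_abs (v := fun s (w : E →L[ℝ] E) => (fderiv ℝ f (φ z s)).comp w)
    (K := K) (fun s => LipschitzWith.of_dist_le_mul fun w w' => by
        rw [dist_eq_norm, dist_eq_norm, ← ContinuousLinearMap.comp_sub]
        exact (ContinuousLinearMap.opNorm_comp_le _ _).trans (by gcongr; exact hDK _))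
    (T := T) (a := W z') (b := W z) (εa := η * C) (εb := 0)
    (fun r hr => hW z' r (hr.trans_lt hTδ)) (fun r hr => hW z r (hr.trans_lt hTδ))
    (fun r hr => by
      rw [dist_eq_norm, ← ContinuousLinearMap.sub_comp]
      refine (ContinuousLinearMap.opNorm_comp_le _ _).trans ?_
      have := hS' z' hz r (abs_le.1 hr)
      simp only [mem_ofPred_eq, dist_eq_norm] at this
      refine mul_le_mul this.le ?_ (norm_nonneg _) hη0.le
      exact (hWbd _ _ (hr.trans_lt hTδ)).trans (by rw [hCdef]; gcongr))
    (fun r _ => by simp) hs.le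
  rw [gronwallBound_eq_add, hW0, hW0, dist_self, zero_mul, zero_add, add_zero] at key
  have hmono : gronwallBound 0 K 1 |s| ≤ G := gronwallBound_mono le_rfl zero_le_one K.2 hs.le
  calc dist (W z' s) (W z t) ≤ dist (W z' s) (W z s) + dist (W z s) (W z t) := dist_triangle _ _ _
    _ < η * C * G + ε / 2 := by
      refine add_lt_add_of_le_of_lt (key.trans ?_) hsW
      gcongr
    _ = ε / 2 * (G / (G + 1)) + ε / 2 := by rw [hη]; field_simp
    _ ≤ ε / 2 * 1 + ε / 2 := by
      gcongr
      rw [div_le_one (by positivity)]; linarith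
    _ = ε := by ring

namespace C1Flow

variable {f : E → E} {δ : ℝ}

/-- The derivative of a `C¹` flow in space and time. -/
theorem hasStrictFDerivAt (Z : C1Flow f δ) (hf : Continuous f) {z : E} {t : ℝ} (ht : |t| < δ) :
    HasStrictFDerivAt (fun q : E × ℝ => Z.φ q.1 q.2)
      ((Z.W z t).coprod (ContinuousLinearMap.toSpanSingleton ℝ (f (Z.φ z t)))) (z, t) := by
  have hev : ∀ᶠ q : E × ℝ in 𝓝 (z, t), |q.2| < δ :=
    (continuous_snd.abs.tendsto (z, t)).eventually_lt_const ht
  have := hasStrictFDerivAt_uncurry_coprod (𝕜 := ℝ) (u := (z, t)) (f := fun z t => Z.φ z t)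
    (f₁ := Z.W) (f₂ := fun z t => ContinuousLinearMap.toSpanSingleton ℝ (f (Z.φ z t)))
    (hev.mono fun q hq => Z.hasFDerivAt _ _ hq)
    (Eventually.of_forall fun q => (Z.deriv q.1 q.2).hasFDerivAt)
    (Z.continuousAt_W z t ht) ?_
  · exact this
  · exact ((ContinuousLinearMap.toSpanSingletonCLE (𝕜 := ℝ) (E := E)).continuous.comp
      (hf.comp Z.continuous_φ)).continuousAt

theorem contDiffAt (Z : C1Flow f δ) (hf : Continuous f) {z : E} {t : ℝ} (ht : |t| < δ) :
    ContDiffAt ℝ 1 (fun q : E × ℝ => Z.φ q.1 q.2) (z, t) := by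
  have hopen : IsOpen {q : E × ℝ | |q.2| < δ} := isOpen_lt continuous_snd.abs continuous_const
  refine contDiffAt_one_iff.2 ⟨fun q => (Z.W q.1 q.2).coprod
    (ContinuousLinearMap.toSpanSingleton ℝ (f (Z.φ q.1 q.2))), {q | |q.2| < δ},
    hopen.mem_nhds ht, fun q hq => ContinuousAt.continuousWithinAt ?_,
    fun q hq => (Z.hasStrictFDerivAt hf hq).hasFDerivAt⟩
  have h1 : ContinuousAt (fun q : E × ℝ => Z.W q.1 q.2) q := Z.continuousAt_W q.1 q.2 hq
  have h2 : ContinuousAt (fun q : E × ℝ =>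
      ContinuousLinearMap.toSpanSingleton ℝ (f (Z.φ q.1 q.2))) q :=
    ((ContinuousLinearMap.toSpanSingletonCLE (𝕜 := ℝ) (E := E)).continuous.comp
      (hf.comp Z.continuous_φ)).continuousAt
  exact (ContinuousLinearMap.coprodEquivL (𝕜 := ℝ) (S := ℝ) (E := E) (F := ℝ) (G := E)).continuous.continuousAt.comp
    (f := fun q : E × ℝ => (Z.W q.1 q.2, ContinuousLinearMap.toSpanSingleton ℝ (f (Z.φ q.1 q.2))))
    (h1.prodMk h2)

theorem φ_add (Z : C1Flow f δ) {K : ℝ≥0} (hf : LipschitzWith K f) (z : E) (s t : ℝ) :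
    Z.φ z (s + t) = Z.φ (Z.φ z s) t := by
  have h : (fun t => Z.φ z (s + t)) = Z.φ (Z.φ z s) :=
    ODE_solution_unique_univ (v := fun _ => f) (s := fun _ => univ) (K := K) (t₀ := 0)
      (fun _ => hf.lipschitzOnWith)
      (fun t => ⟨by simpa using! (Z.deriv z (s + t)).comp_const_add s t, trivial⟩)
      (fun t => ⟨Z.deriv _ t, trivial⟩) (by simp [Z.init])
  exact congrFun h t

theorem φ_nat_mul (Z : C1Flow f δ) {K : ℝ≥0} (hf : LipschitzWith K f) (n : ℕ) (s : ℝ) (z : E) :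
    Z.φ z (n * s) = (fun z => Z.φ z s)^[n] z := by
  induction n with
  | zero => simp [Z.init]
  | succ n ih =>
    rw [Function.iterate_succ_apply', ← ih, ← Z.φ_add hf]
    congr 1; push_cast; ring

/-- The time `t` map of a `C¹` flow is of class `C¹`, for every time `t`. -/
theorem contDiff_time (Z : C1Flow f δ) (hδ : 0 < δ) {K : ℝ≥0} (hf : LipschitzWith K f) (t : ℝ) :
    ContDiff ℝ 1 (fun z => Z.φ z t) := by
  -- By the group property the time `t` map is the `n`-th iterate of the time `t / n` map, and the
  -- latter time lies below `δ`.
  obtain ⟨n, hn⟩ := exists_nat_gt (|t| / δ)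
  have hn0 : (0 : ℝ) < n := lt_of_le_of_lt (by positivity) hn
  have hsmall : |t / n| < δ := by
    rw [abs_div, Nat.abs_cast, div_lt_iff₀ hn0]; rwa [div_lt_iff₀ hδ, mul_comm] at hn
  have h1 : ContDiff ℝ 1 (fun z => Z.φ z (t / n)) := contDiff_iff_contDiffAt.2 fun z =>
    (Z.contDiffAt hf.continuous (z := z) hsmall).comp z
      (f := fun z => (z, t / n)) (contDiffAt_id.prodMk contDiffAt_const)
  have h2 : ∀ m : ℕ, ContDiff ℝ 1 ((fun z => Z.φ z (t / n))^[m]) := fun m => by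
    induction m with
    | zero => exact contDiff_id
    | succ m ih => rw [Function.iterate_succ]; exact ih.comp h1
  convert h2 n using 1
  funext z
  rw [← Z.φ_nat_mul hf, mul_div_cancel₀ _ hn0.ne']

end C1Flow
end

/-! ### The Hamiltonian vector field and the action along its orbits. -/

noncomputable section
open Filter Topology

variable {d : ℕ} {H F : Rd d → ℝ} {K : ℝ}

theorem gradient_eq_comp (f : Rd d → ℝ) :
    ∇ f = (InnerProductSpace.toDual ℝ (Rd d)).symm ∘ fderiv ℝ f := rfl

theorem contDiff_gradient {f : Rd d → ℝ} {m n : WithTop ℕ∞} (hf : ContDiff ℝ n f)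
    (hmn : m + 1 ≤ n) : ContDiff ℝ m (∇ f) :=
  (InnerProductSpace.toDual ℝ (Rd d)).symm.contDiff.comp (hf.fderiv_right hmn)

theorem norm_gradient_eq (f : Rd d → ℝ) (x : Rd d) : ‖∇ f x‖ = ‖iteratedFDeriv ℝ 1 f x‖ := by
  rw [gradient_eq_comp, Function.comp_apply, LinearIsometryEquiv.norm_map, norm_iteratedFDeriv_one]

theorem norm_iteratedFDeriv_gradient (f : Rd d → ℝ) (x : Rd d) (n : ℕ) :
    ‖iteratedFDeriv ℝ n (∇ f) x‖ = ‖iteratedFDeriv ℝ (n + 1) f x‖ := by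
  rw [gradient_eq_comp, LinearIsometryEquiv.norm_iteratedFDeriv_comp_left,
    norm_iteratedFDeriv_fderiv]

theorem norm_fderiv_gradient_eq (f : Rd d → ℝ) (x : Rd d) :
    ‖fderiv ℝ (∇ f) x‖ = ‖iteratedFDeriv ℝ 2 f x‖ := by
  rw [← norm_iteratedFDeriv_one, norm_iteratedFDeriv_gradient]

theorem hasGradientAt_of_contDiff {f : Rd d → ℝ} {n : WithTop ℕ∞} (hf : ContDiff ℝ n f)
    (hn : n ≠ 0) (x : Rd d) : HasGradientAt f (∇ f x) x :=
  (hf.differentiable hn x).hasGradientAt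

namespace SeparatedBounds

theorem K_nonneg (h : SeparatedBounds K H F) : 0 ≤ K := (norm_nonneg _).trans (h.bound_DH 0)

theorem contDiff_gradH (h : SeparatedBounds K H F) : ContDiff ℝ 3 (∇ H) :=
  contDiff_gradient h.contDiff_H (by norm_num)

theorem contDiff_gradF (h : SeparatedBounds K H F) : ContDiff ℝ 1 (∇ F) :=
  contDiff_gradient h.contDiff_F (by norm_num)

theorem norm_gradH_le (h : SeparatedBounds K H F) (p : Rd d) : ‖∇ H p‖ ≤ K :=
  (norm_gradient_eq H p).trans_le (h.bound_DH p)

theorem norm_gradF_le (h : SeparatedBounds K H F) (x : Rd d) : ‖∇ F x‖ ≤ K :=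
  (norm_gradient_eq F x).trans_le (h.bound_DF x)

theorem norm_fderiv_gradH_le (h : SeparatedBounds K H F) (p : Rd d) : ‖fderiv ℝ (∇ H) p‖ ≤ K :=
  (norm_fderiv_gradient_eq H p).trans_le (h.bound_D2H p)

theorem norm_fderiv_gradF_le (h : SeparatedBounds K H F) (x : Rd d) : ‖fderiv ℝ (∇ F) x‖ ≤ K :=
  (norm_fderiv_gradient_eq F x).trans_le (h.bound_D2F x)

theorem differentiable_gradH (h : SeparatedBounds K H F) : Differentiable ℝ (∇ H) :=
  h.contDiff_gradH.differentiable (by norm_num)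

theorem differentiable_gradF (h : SeparatedBounds K H F) : Differentiable ℝ (∇ F) :=
  h.contDiff_gradF.differentiable (by norm_num)

theorem norm_gradH_sub_le (h : SeparatedBounds K H F) (p q : Rd d) :
    ‖∇ H p - ∇ H q‖ ≤ K * ‖p - q‖ :=
  convex_univ.norm_image_sub_le_of_norm_fderiv_le (fun x _ => h.differentiable_gradH x)
    (fun x _ => h.norm_fderiv_gradH_le x) (mem_univ _) (mem_univ _)

theorem norm_gradF_sub_le (h : SeparatedBounds K H F) (x y : Rd d) :
    ‖∇ F x - ∇ F y‖ ≤ K * ‖x - y‖ :=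
  convex_univ.norm_image_sub_le_of_norm_fderiv_le (fun x _ => h.differentiable_gradF x)
    (fun x _ => h.norm_fderiv_gradF_le x) (mem_univ _) (mem_univ _)

theorem abs_H_sub_le (h : SeparatedBounds K H F) (p q : Rd d) : |H p - H q| ≤ K * ‖p - q‖ :=
  convex_univ.norm_image_sub_le_of_norm_fderiv_le
    (fun x _ => h.contDiff_H.differentiable (by norm_num) x)
    (fun x _ => by rw [← norm_iteratedFDeriv_one]; exact h.bound_DH x) (mem_univ _) (mem_univ _)

theorem abs_F_sub_le (h : SeparatedBounds K H F) (x y : Rd d) : |F x - F y| ≤ K * ‖x - y‖ :=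
  convex_univ.norm_image_sub_le_of_norm_fderiv_le
    (fun x _ => h.contDiff_F.differentiable (by norm_num) x)
    (fun x _ => by rw [← norm_iteratedFDeriv_one]; exact h.bound_DF x) (mem_univ _) (mem_univ _)

/-- The decay of `D³H` makes `D²H` nearly constant on balls of radius `2` far from the origin. -/
theorem norm_fderiv_gradH_sub_le (h : SeparatedBounds K H F) {p q c : Rd d}
    (hp : ‖p - c‖ ≤ 2) (hq : ‖q - c‖ ≤ 2) :
    (1 + ‖c‖) * ‖fderiv ℝ (∇ H) p - fderiv ℝ (∇ H) q‖ ≤ 3 * K * ‖p - q‖ := by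
  have hc : 0 < 1 + ‖c‖ := by positivity
  have hdiff : Differentiable ℝ (fderiv ℝ (∇ H)) :=
    (h.contDiff_gradH.fderiv_right (m := 1) (by norm_num)).differentiable (by norm_num)
  have key := (convex_closedBall c 2).norm_image_sub_le_of_norm_fderiv_le (𝕜 := ℝ)
    (f := fderiv ℝ (∇ H)) (C := 3 * K / (1 + ‖c‖)) (x := q) (y := p)
    (fun x _ => hdiff x) (fun x hx => ?_) (by simpa [dist_eq_norm] using hq)
    (by simpa [dist_eq_norm] using hp)
  · calc _ ≤ (1 + ‖c‖) * (3 * K / (1 + ‖c‖) * ‖p - q‖) := by gcongr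
      _ = _ := by field_simp
  · rw [← norm_iteratedFDeriv_one, norm_iteratedFDeriv_fderiv, norm_iteratedFDeriv_gradient,
      le_div_iff₀ hc]
    have h3 := h.bound_D3H x
    -- This gives `1 + ‖c‖ ≤ 3 * (1 + ‖x‖)`, the source of the factor `3`.
    have hx' : ‖c‖ ≤ ‖x‖ + 2 := by
      have h1 : ‖x - c‖ ≤ 2 := by simpa [dist_eq_norm] using hx
      have := norm_sub_norm_le c x
      rw [norm_sub_rev] at this; linarith
    calc ‖iteratedFDeriv ℝ (1 + 1 + 1) H x‖ * (1 + ‖c‖)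
        ≤ ‖iteratedFDeriv ℝ (1 + 1 + 1) H x‖ * (3 * (1 + ‖x‖)) := by
          gcongr; linarith [norm_nonneg x]
      _ = 3 * (‖iteratedFDeriv ℝ 3 H x‖ * (1 + ‖x‖)) := by ring_nf
      _ ≤ 3 * K := by gcongr

end SeparatedBounds

/-- The Hamiltonian vector field `(x, p) ↦ (-DH(p), DF(x))`. -/
def hamField (H F : Rd d → ℝ) (z : Rd d × Rd d) : Rd d × Rd d := (-∇ H z.2, ∇ F z.1)

theorem contDiff_hamField (h : SeparatedBounds K H F) : ContDiff ℝ 1 (hamField H F) :=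
  ((h.contDiff_gradH.of_le (by norm_num)).comp contDiff_snd).neg.prodMk
    (h.contDiff_gradF.comp contDiff_fst)

theorem norm_hamField_le (h : SeparatedBounds K H F) (z : Rd d × Rd d) : ‖hamField H F z‖ ≤ K :=
  max_le (by simpa [hamField] using h.norm_gradH_le z.2) (h.norm_gradF_le z.1)

theorem lipschitzWith_hamField (h : SeparatedBounds K H F) :
    LipschitzWith K.toNNReal (hamField H F) := by
  refine LipschitzWith.of_dist_le_mul fun z w => ?_
  rw [Real.coe_toNNReal _ h.K_nonneg, dist_eq_norm, dist_eq_norm]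
  refine max_le ?_ ?_
  · simp only [hamField, Prod.fst_sub, neg_sub_neg]
    rw [norm_sub_rev]
    exact (h.norm_gradH_sub_le _ _).trans
      (mul_le_mul_of_nonneg_left (norm_snd_le (z - w)) h.K_nonneg)
  · exact (h.norm_gradF_sub_le _ _).trans
      (mul_le_mul_of_nonneg_left (norm_fst_le (z - w)) h.K_nonneg)

theorem fderiv_hamField (h : SeparatedBounds K H F) (z ζ : Rd d × Rd d) :
    fderiv ℝ (hamField H F) z ζ = (-(fderiv ℝ (∇ H) z.2 ζ.2), fderiv ℝ (∇ F) z.1 ζ.1) := by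
  have h1 : HasFDerivAt (fun z : Rd d × Rd d => -∇ H z.2)
      (-((fderiv ℝ (∇ H) z.2).comp (ContinuousLinearMap.snd ℝ (Rd d) (Rd d)))) z :=
    ((h.differentiable_gradH z.2).hasFDerivAt.comp z hasFDerivAt_snd).neg
  have h2 : HasFDerivAt (fun z : Rd d × Rd d => ∇ F z.1)
      ((fderiv ℝ (∇ F) z.1).comp (ContinuousLinearMap.fst ℝ (Rd d) (Rd d))) z :=
    (h.differentiable_gradF z.1).hasFDerivAt.comp z hasFDerivAt_fst
  have h3 : HasFDerivAt (hamField H F) _ z := h1.prodMk h2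
  rw [h3.fderiv]; simp

/-- The Lagrangian `H(p) + F(x) - p · DH(p)`. -/
def lagrangian (H F : Rd d → ℝ) (z : Rd d × Rd d) : ℝ := H z.2 + F z.1 - inner ℝ z.2 (∇ H z.2)

theorem contDiff_lagrangian (h : SeparatedBounds K H F) : ContDiff ℝ 1 (lagrangian H F) :=
  (((h.contDiff_H.of_le (by norm_num)).comp contDiff_snd).add
    ((h.contDiff_F.of_le (by norm_num)).comp contDiff_fst)).sub
      (contDiff_snd.inner ℝ ((h.contDiff_gradH.of_le (by norm_num)).comp contDiff_snd))

theorem fderiv_lagrangian (h : SeparatedBounds K H F) (z ζ : Rd d × Rd d) :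
    fderiv ℝ (lagrangian H F) z ζ =
      inner ℝ (∇ F z.1) ζ.1 - inner ℝ z.2 (fderiv ℝ (∇ H) z.2 ζ.2) := by
  have h1 : HasFDerivAt (fun z : Rd d × Rd d => H z.2) _ z :=
    (hasGradientAt_of_contDiff h.contDiff_H (by norm_num) z.2).hasFDerivAt.comp z hasFDerivAt_snd
  have h2 : HasFDerivAt (fun z : Rd d × Rd d => F z.1) _ z :=
    (hasGradientAt_of_contDiff h.contDiff_F (by norm_num) z.1).hasFDerivAt.comp z hasFDerivAt_fst
  have h3 : HasFDerivAt (fun z : Rd d × Rd d => ∇ H z.2) _ z :=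
    (h.differentiable_gradH z.2).hasFDerivAt.comp z hasFDerivAt_snd
  have h4 : HasFDerivAt (fun z : Rd d × Rd d => z.2) (ContinuousLinearMap.snd ℝ (Rd d) (Rd d)) z :=
    hasFDerivAt_snd
  have h5 : HasFDerivAt (lagrangian H F) _ z := (h1.add h2).sub (h4.inner ℝ h3)
  rw [h5.fderiv]
  simp
  ring


section Action

variable {δ : ℝ}

/-- The action `∫₀ᵗ (H(P) + F(X) - P · DH(P))` along the characteristics. -/
def action (Z : C1Flow (hamField H F) δ) (z : Rd d × Rd d) (t : ℝ) : ℝ :=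
  ∫ s in (0 : ℝ)..t, lagrangian H F (Z.φ z s)

variable (Z : C1Flow (hamField H F) δ)

theorem hasDerivAt_flow_fst (z : Rd d × Rd d) (t : ℝ) :
    HasDerivAt (fun t => (Z.φ z t).1) (-∇ H (Z.φ z t).2) t := (Z.deriv z t).fst

theorem hasDerivAt_flow_snd (z : Rd d × Rd d) (t : ℝ) :
    HasDerivAt (fun t => (Z.φ z t).2) (∇ F (Z.φ z t).1) t := (Z.deriv z t).snd

theorem action_zero (z : Rd d × Rd d) : action Z z 0 = 0 := by simp [action]

theorem hasDerivAt_action (h : SeparatedBounds K H F) (z : Rd d × Rd d) (t : ℝ) :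
    HasDerivAt (action Z z) (lagrangian H F (Z.φ z t)) t := by
  have hc : Continuous fun s => lagrangian H F (Z.φ z s) :=
    (contDiff_lagrangian h).continuous.comp (Z.continuous_φ.comp (by fun_prop : Continuous fun s : ℝ => (z, s)))
  exact intervalIntegral.integral_hasDerivAt_right (hc.intervalIntegrable _ _)
    (hc.stronglyMeasurableAtFilter _ _) hc.continuousAt

/-- The spatial derivative `P · DX - p · dx` of the action. -/
def actionDeriv (z : Rd d × Rd d) (t : ℝ) : (Rd d × Rd d) →L[ℝ] ℝ :=
  (innerSL ℝ (Z.φ z t).2).comp ((ContinuousLinearMap.fst ℝ (Rd d) (Rd d)).comp (Z.W z t)) -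
    (innerSL ℝ z.2).comp (ContinuousLinearMap.fst ℝ (Rd d) (Rd d))

/-- In the differential of `H + F - p · DH` the terms `DH · dp` cancel. What remains, `DF · dX - P ·
D²H dP`, is the time derivative of `P · dX` by Hamilton's equations. -/
theorem hasDerivAt_actionDeriv (h : SeparatedBounds K H F) (z : Rd d × Rd d) {t : ℝ}
    (ht : |t| < δ) :
    HasDerivAt (actionDeriv Z z)
      ((fderiv ℝ (lagrangian H F) (Z.φ z t)).comp (Z.W z t)) t := by
  have h1 : HasDerivAt (fun t => innerSL ℝ (Z.φ z t).2) (innerSL ℝ (∇ F (Z.φ z t).1)) t := by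
    exact (innerSL ℝ (E := Rd d)).hasFDerivAt.comp_hasDerivAt t (hasDerivAt_flow_snd Z z t)
  have h2 : HasDerivAt (fun t => (ContinuousLinearMap.fst ℝ (Rd d) (Rd d)).comp (Z.W z t))
      ((ContinuousLinearMap.fst ℝ (Rd d) (Rd d)).comp
        ((fderiv ℝ (hamField H F) (Z.φ z t)).comp (Z.W z t))) t := by
    simpa using! (hasDerivAt_const t (ContinuousLinearMap.fst ℝ (Rd d) (Rd d))).clm_comp
      (Z.W_deriv z t ht)
  have h3 := (h1.clm_comp h2).sub_const
    ((innerSL ℝ z.2).comp (ContinuousLinearMap.fst ℝ (Rd d) (Rd d)))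
  refine h3.congr_deriv ?_
  refine ContinuousLinearMap.ext fun ζ => ?_
  simp only [add_apply, ContinuousLinearMap.comp_apply,
    ContinuousLinearMap.coe_fst', fderiv_hamField h, fderiv_lagrangian h, innerSL_apply_apply,
    inner_neg_right, sub_eq_add_neg]

theorem actionDeriv_zero (z : Rd d × Rd d) : actionDeriv Z z 0 = 0 := by
  ext v <;> simp [actionDeriv, Z.init, Z.W_init]

theorem continuousAt_actionDeriv (z : Rd d × Rd d) {t : ℝ} (ht : |t| < δ) :
    ContinuousAt (fun q : (Rd d × Rd d) × ℝ => actionDeriv Z q.1 q.2) (z, t) := by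
  have h1 := Z.continuousAt_W z t ht
  have h2 : ContinuousAt (fun q : (Rd d × Rd d) × ℝ => innerSL ℝ (Z.φ q.1 q.2).2) (z, t) :=
    ((innerSL ℝ (E := Rd d)).continuous.comp (continuous_snd.comp Z.continuous_φ)).continuousAt
  have h3 : ContinuousAt (fun q : (Rd d × Rd d) × ℝ => innerSL ℝ q.1.2) (z, t) :=
    ((innerSL ℝ (E := Rd d)).continuous.comp (continuous_snd.comp continuous_fst)).continuousAt
  exact (h2.clm_comp (continuousAt_const.clm_comp h1)).sub (h3.clm_comp continuousAt_const)

/-- Differentiation under the integral produces an integrand that is an exact time derivative, that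
of `actionDeriv`, so the fundamental theorem of calculus evaluates it. -/
theorem hasFDerivAt_action_space (h : SeparatedBounds K H F) (z : Rd d × Rd d) {t : ℝ}
    (ht : |t| < δ) : HasFDerivAt (fun z => action Z z t) (actionDeriv Z z t) z := by
  have hφ : ∀ z, Continuous (Z.φ z) := fun z =>
    Z.continuous_φ.comp (by fun_prop : Continuous fun s : ℝ => (z, s))
  have hL := contDiff_lagrangian h
  have hlc : ∀ z, Continuous fun s => lagrangian H F (Z.φ z s) := fun z =>
    hL.continuous.comp (hφ z)
  have hI : ∀ s ∈ uIcc 0 t, |s| < δ := fun s hs => by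
    have := abs_sub_left_of_mem_uIcc hs
    simp only [sub_zero] at this
    exact this.trans_lt ht
  have hcont : ∀ z s, |s| < δ → ContinuousAt (fun q : (Rd d × Rd d) × ℝ =>
      (fderiv ℝ (lagrangian H F) (Z.φ q.1 q.2)).comp (Z.W q.1 q.2)) (z, s) := fun z s hs =>
    (((hL.continuous_fderiv one_ne_zero).comp Z.continuous_φ).continuousAt).clm_comp
      (Z.continuousAt_W z s hs)
  have hcontz : ContinuousOn (fun s => (fderiv ℝ (lagrangian H F) (Z.φ z s)).comp (Z.W z s))
      (uIcc 0 t) := fun s hs =>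
    ((hcont z s (hI s hs)).comp (f := fun s : ℝ => (z, s))
      (continuousAt_const.prodMk continuousAt_id)).continuousWithinAt
  obtain ⟨C, hC⟩ := ((isCompact_closedBall z 1).prod (isCompact_uIcc (a := 0) (b := t))).exists_bound_of_continuousOn
    (f := fun q : (Rd d × Rd d) × ℝ =>
      (fderiv ℝ (lagrangian H F) (Z.φ q.1 q.2)).comp (Z.W q.1 q.2))
    (fun q hq => (hcont q.1 q.2 (hI _ hq.2)).continuousWithinAt)
  have key := intervalIntegral.hasFDerivAt_integral_of_dominated_of_fderiv_le (𝕜 := ℝ)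
    (μ := MeasureTheory.volume) (a := 0) (b := t) (F := fun z s => lagrangian H F (Z.φ z s))
    (F' := fun z s => (fderiv ℝ (lagrangian H F) (Z.φ z s)).comp (Z.W z s)) (x₀ := z)
    (s := Metric.closedBall z 1) (bound := fun _ => C)
    (Metric.closedBall_mem_nhds z one_pos)
    (Eventually.of_forall fun z => (hlc z).aestronglyMeasurable)
    ((hlc z).intervalIntegrable _ _)
    ((hcontz.mono uIoc_subset_uIcc).aestronglyMeasurable measurableSet_uIoc)
    (Eventually.of_forall fun s hs x hx => hC (x, s) ⟨hx, uIoc_subset_uIcc hs⟩)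
    intervalIntegrable_const
    (Eventually.of_forall fun s hs x hx =>
      ((hL.differentiable one_ne_zero _).hasFDerivAt.comp x
        (Z.hasFDerivAt x s (hI s (uIoc_subset_uIcc hs)))))
  rw [intervalIntegral.integral_eq_sub_of_hasDerivAt
    (fun s hs => hasDerivAt_actionDeriv Z h z (hI s hs)) hcontz.intervalIntegrable,
    actionDeriv_zero, sub_zero] at key
  exact key

/-- The differential of the action in space and time. -/
theorem hasFDerivAt_action (h : SeparatedBounds K H F) (z : Rd d × Rd d) {t : ℝ} (ht : |t| < δ) :
    HasFDerivAt (fun q : (Rd d × Rd d) × ℝ => action Z q.1 q.2)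
      ((actionDeriv Z z t).coprod
        (ContinuousLinearMap.toSpanSingleton ℝ (lagrangian H F (Z.φ z t)))) (z, t) := by
  have hev : ∀ᶠ q : (Rd d × Rd d) × ℝ in 𝓝 (z, t), |q.2| < δ :=
    (continuous_snd.abs.tendsto (z, t)).eventually_lt_const ht
  refine (hasStrictFDerivAt_uncurry_coprod (𝕜 := ℝ) (u := (z, t)) (f := fun z t => action Z z t)
    (f₁ := actionDeriv Z)
    (f₂ := fun z t => ContinuousLinearMap.toSpanSingleton ℝ (lagrangian H F (Z.φ z t)))
    (hev.mono fun q hq => hasFDerivAt_action_space Z h _ hq)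
    (Eventually.of_forall fun q => (hasDerivAt_action Z h q.1 q.2).hasFDerivAt)
    (continuousAt_actionDeriv Z z ht) ?_).hasFDerivAt
  exact ((ContinuousLinearMap.toSpanSingletonCLE (𝕜 := ℝ) (E := ℝ)).continuous.comp
      ((contDiff_lagrangian h).continuous.comp Z.continuous_φ)).continuousAt

end Action
end

/-! ### The linearized estimate behind the time scale `λ^(-1/3)`. -/

noncomputable section
open Filter Topology

theorem norm_sub_le_of_hasDerivAt_abs_le {E : Type*} [NormedAddCommGroup E] [NormedSpace ℝ E]
    {f f' : ℝ → E} {T C : ℝ} (hf : ∀ t, |t| ≤ T → HasDerivAt f (f' t) t)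
    (hC : ∀ t, |t| ≤ T → ‖f' t‖ ≤ C) {s t : ℝ} (hs : |s| ≤ T) (ht : |t| ≤ T) :
    ‖f t - f s‖ ≤ C * |t - s| :=
  (convex_Icc (-T) T).norm_image_sub_le_of_norm_hasDerivWithin_le
    (fun r hr => (hf r (abs_le.2 hr)).hasDerivWithinAt) (fun r hr => hC r (abs_le.2 hr))
    (abs_le.1 hs) (abs_le.1 ht)

section LinearEstimate

variable {V : Type*} [NormedAddCommGroup V] [NormedSpace ℝ V]

/-- Estimates for a pair of linearized characteristics `(ξ, π)`, `(η, θ)` whose coefficients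
`A`, `A'` nearly agree. -/
theorem linearized_estimate {ξ π η θ : ℝ → V} {A A' B B' : ℝ → V →L[ℝ] V} {K lam ε τ : ℝ}
    {x y z : V} (hz : z = x - y) (hK : 1 ≤ K) (hlam : 0 < lam) (hτ0 : 0 < τ) (hτ : 4 * K * τ ≤ 1)
    (hε0 : 0 ≤ ε) (hε : ε ≤ τ ^ 2)
    (dξ : ∀ t, |t| ≤ τ → HasDerivAt ξ (-(A t (π t))) t)
    (dπ : ∀ t, |t| ≤ τ → HasDerivAt π (B t (ξ t)) t)
    (dη : ∀ t, |t| ≤ τ → HasDerivAt η (-(A' t (θ t))) t)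
    (dθ : ∀ t, |t| ≤ τ → HasDerivAt θ (B' t (η t)) t)
    (hA : ∀ t, ‖A t‖ ≤ K) (hA' : ∀ t, ‖A' t‖ ≤ K) (hB : ∀ t, ‖B t‖ ≤ K) (hB' : ∀ t, ‖B' t‖ ≤ K)
    (hAA' : ∀ t, |t| ≤ τ → lam * ‖A t - A' t‖ ≤ 6 * K ^ 2 * (lam * τ ^ 2 + τ))
    (ξ0 : ξ 0 = x) (η0 : η 0 = y) (θ0 : θ 0 = lam • z) (π0 : ‖π 0 - lam • z‖ ≤ 2 * ε * ‖x‖)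
    (hπ : ∀ t, |t| ≤ τ → ‖π t‖ ≤ 4 * (‖z‖ + ‖y‖ + lam * ‖z‖))
    (hθ : ∀ t, |t| ≤ τ → ‖θ t‖ ≤ 4 * (‖z‖ + ‖y‖ + lam * ‖z‖)) {a b : ℝ} (ha : |a| ≤ τ)
    (hb : |b| ≤ τ) (hab : (1 + lam) * |a - b| ≤ τ ^ 2) :
    ‖ξ a - η b - z‖ ≤ 26 * K ^ 3 * (τ ^ 2 * ‖y‖ + (τ ^ 2 + lam * τ ^ 3) * ‖z‖) ∧
      ‖η b - y‖ ≤ 26 * K ^ 3 * (τ * (‖y‖ + (1 + lam) * ‖z‖)) := by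
  have h00 : |(0 : ℝ)| ≤ τ := by simpa using hτ0.le
  have hτ1 : τ ≤ 1 := by nlinarith
  have hK0 : 0 ≤ K := by linarith
  have hK2 : K ≤ K ^ 2 := by nlinarith
  have hK3 : K ^ 2 ≤ K ^ 3 := by nlinarith [sq_nonneg K]
  set N := ‖z‖ + ‖y‖ with hN
  set D := lam * ‖z‖ with hD
  have hD0 : 0 ≤ D := by positivity
  have hN0 : 0 ≤ N := by positivity
  have hx : ‖x‖ ≤ N := by
    have : x = z + y := by rw [hz]; abel
    rw [this]; exact norm_add_le _ _
  have hy : ‖y‖ ≤ N := by rw [hN]; linarith [norm_nonneg z]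
  have hzD : ‖lam • z‖ = D := by rw [norm_smul, Real.norm_of_nonneg hlam.le]
  have dξ' : ∀ t, |t| ≤ τ → ‖-(A t (π t))‖ ≤ K * (4 * (N + D)) := fun t ht => by
    rw [norm_neg]
    exact (A t).le_of_opNorm_le_of_le (hA t) (hπ t ht)
  have dη' : ∀ t, |t| ≤ τ → ‖-(A' t (θ t))‖ ≤ K * (4 * (N + D)) := fun t ht => by
    rw [norm_neg]
    exact (A' t).le_of_opNorm_le_of_le (hA' t) (hθ t ht)
  have bη : ∀ t, |t| ≤ τ → ‖η t - y‖ ≤ 4 * K * τ * (N + D) := fun t ht => by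
    have := norm_sub_le_of_hasDerivAt_abs_le dη dη' h00 ht
    rw [η0, sub_zero] at this
    calc _ ≤ _ := this
      _ ≤ K * (4 * (N + D)) * τ := by gcongr
      _ = _ := by ring
  have bξ : ∀ t, |t| ≤ τ → ‖ξ t - x‖ ≤ 4 * K * τ * (N + D) := fun t ht => by
    have := norm_sub_le_of_hasDerivAt_abs_le dξ dξ' h00 ht
    rw [ξ0, sub_zero] at this
    calc _ ≤ _ := this
      _ ≤ K * (4 * (N + D)) * τ := by gcongr
      _ = _ := by ring
  have hKτN : 4 * K * τ * N ≤ N := by nlinarith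
  have nη : ∀ t, |t| ≤ τ → ‖η t‖ ≤ 2 * N + 4 * K * τ * D := fun t ht => by
    have h1 := norm_le_norm_add_norm_sub' (η t) y
    have h2 := bη t ht
    linarith
  have nξ : ∀ t, |t| ≤ τ → ‖ξ t‖ ≤ 2 * N + 4 * K * τ * D := fun t ht => by
    have h1 := norm_le_norm_add_norm_sub' (ξ t) x
    have h2 := bξ t ht
    linarith
  have bθ : ∀ t, |t| ≤ τ → ‖θ t - lam • z‖ ≤ K * (2 * N + 4 * K * τ * D) * τ := fun t ht => by
    have := norm_sub_le_of_hasDerivAt_abs_le dθ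
      (fun t ht => (B' t).le_of_opNorm_le_of_le (hB' t) (nη t ht)) h00 ht
    rw [θ0, sub_zero] at this
    exact this.trans (by gcongr)
  have bπ : ∀ t, |t| ≤ τ → ‖π t - π 0‖ ≤ K * (2 * N + 4 * K * τ * D) * τ := fun t ht => by
    have := norm_sub_le_of_hasDerivAt_abs_le dπ
      (fun t ht => (B t).le_of_opNorm_le_of_le (hB t) (nξ t ht)) h00 ht
    rw [sub_zero] at this
    exact this.trans (by gcongr)
  -- Both momenta stay near `λ z`, so this large common part cancels. The drifts are controlled by
  -- `ξ` and `η`, where `λ‖z‖` appears only with a factor `τ`.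
  have bπθ : ∀ t, |t| ≤ τ → ‖π t - θ t‖ ≤ 2 * ε * N + 2 * (K * (2 * N + 4 * K * τ * D) * τ) :=
    fun t ht => by
      have h1 : π t - θ t = (π t - π 0) + (π 0 - lam • z) - (θ t - lam • z) := by abel
      rw [h1]
      have h2 : 2 * ε * ‖x‖ ≤ 2 * ε * N := by gcongr
      have h3 := norm_sub_le ((π t - π 0) + (π 0 - lam • z)) (θ t - lam • z)
      have h4 := norm_add_le (π t - π 0) (π 0 - lam • z)
      linarith [bπ t ht, bθ t ht]
  have nθ : ∀ t, |t| ≤ τ → ‖θ t‖ ≤ 2 * D + 2 * K * τ * N := fun t ht => by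
    have h1 := norm_le_norm_add_norm_sub' (θ t) (lam • z)
    have h2 := bθ t ht
    have h3 : 4 * K * τ * (K * τ * D) ≤ 1 * (K * τ * D) := by gcongr
    have h4 : 4 * K * τ * D ≤ D := by nlinarith
    nlinarith [mul_nonneg (mul_nonneg hK0 hτ0.le) hD0]
  have dd : ∀ t, |t| ≤ τ → HasDerivAt (fun t => ξ t - η t) (-(A t (π t)) - -(A' t (θ t))) t :=
    fun t ht => (dξ t ht).sub (dη t ht)
  -- Split `A π - A' θ = A (π - θ) + (A - A') θ`. The part of `θ` of size `λ‖z‖` is paid for by the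
  -- smallness of `λ‖A - A'‖`; for the rest of `θ`, which is `O(τ N)`, the bound `‖A - A'‖ ≤ 2K`
  -- suffices.
  have bdd : ∀ t, |t| ≤ τ → ‖-(A t (π t)) - -(A' t (θ t))‖ ≤
      22 * K ^ 3 * (τ * N + lam * τ ^ 2 * ‖z‖) := fun t ht => by
    have h1 : -(A t (π t)) - -(A' t (θ t)) = -(A t (π t - θ t)) - (A t - A' t) (θ t) := by
      simp only [map_sub, sub_apply]; abel
    rw [h1]
    have h2 : ‖-(A t (π t - θ t))‖ ≤
        K * (2 * ε * N + 2 * (K * (2 * N + 4 * K * τ * D) * τ)) := by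
      rw [norm_neg]; exact (A t).le_of_opNorm_le_of_le (hA t) (bπθ t ht)
    have h3 : ‖(A t - A' t) (θ t)‖ ≤ 2 * (6 * K ^ 2 * (lam * τ ^ 2 + τ)) * ‖z‖ +
        4 * K ^ 2 * τ * N := by
      have hAA : ‖A t - A' t‖ ≤ 2 * K := (norm_sub_le _ _).trans (by linarith [hA t, hA' t])
      calc _ ≤ ‖A t - A' t‖ * (2 * D + 2 * K * τ * N) :=
            (A t - A' t).le_of_opNorm_le_of_le le_rfl (nθ t ht)
        _ = 2 * (lam * ‖A t - A' t‖) * ‖z‖ + ‖A t - A' t‖ * (2 * K * τ * N) := by rw [hD]; ring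
        _ ≤ 2 * (6 * K ^ 2 * (lam * τ ^ 2 + τ)) * ‖z‖ + 2 * K * (2 * K * τ * N) := by
            refine add_le_add ?_ (by gcongr)
            exact mul_le_mul_of_nonneg_right
              (mul_le_mul_of_nonneg_left (hAA' t ht) zero_le_two) (norm_nonneg z)
        _ = _ := by ring
    have h4 : K * (2 * ε * N) ≤ 2 * K ^ 3 * (τ * N) := by
      have : ε ≤ τ := hε.trans (by nlinarith)
      calc K * (2 * ε * N) ≤ K ^ 3 * (2 * τ * N) := by gcongr; linarith
        _ = _ := by ring
    have h5 : K ^ 2 * (τ * N) ≤ K ^ 3 * (τ * N) := by gcongr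
    have h6 : K ^ 2 * (τ * ‖z‖) ≤ K ^ 3 * (τ * N) := by
      gcongr; rw [hN]; linarith [norm_nonneg y]
    have h7 : K ^ 2 * (lam * τ ^ 2 * ‖z‖) ≤ K ^ 3 * (lam * τ ^ 2 * ‖z‖) := by gcongr
    have h10 : 0 ≤ K ^ 3 * (lam * τ ^ 2 * ‖z‖) := by positivity
    have h8 := norm_sub_le (-(A t (π t - θ t))) ((A t - A' t) (θ t))
    have h9 : K * (2 * (K * (2 * N + 4 * K * τ * D) * τ)) =
        4 * (K ^ 2 * (τ * N)) + 8 * (K ^ 3 * (lam * τ ^ 2 * ‖z‖)) := by rw [hD]; ring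
    linarith
  have hzz : ‖ξ b - η b - z‖ ≤ 22 * K ^ 3 * (τ * N + lam * τ ^ 2 * ‖z‖) * τ := by
    have := norm_sub_le_of_hasDerivAt_abs_le dd bdd h00 hb
    rw [ξ0, η0, sub_zero, ← hz] at this
    exact this.trans (by gcongr)
  -- The velocity of `ξ` may be of size `λN`; closeness of the two times, `(1 + λ)|a - b| ≤ τ²`,
  -- keeps the cost of unequal times at order `τ²`. This adds `4` to the constant `22`.
  have hab' : ‖ξ a - ξ b‖ ≤ 4 * K ^ 3 * (τ ^ 2 * N) := by
    have := norm_sub_le_of_hasDerivAt_abs_le dξ dξ' hb ha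
    have hD' : D ≤ lam * N := by
      rw [hD]; gcongr; rw [hN]; linarith [norm_nonneg y]
    calc _ ≤ _ := this
      _ ≤ K * (4 * (N + lam * N)) * |a - b| := by gcongr
      _ = 4 * K * N * ((1 + lam) * |a - b|) := by ring
      _ ≤ 4 * K ^ 3 * N * τ ^ 2 := by gcongr; linarith
      _ = _ := by ring
  constructor
  · have h1 : ξ a - η b - z = (ξ a - ξ b) + (ξ b - η b - z) := by abel
    rw [h1]
    refine (norm_add_le _ _).trans ?_
    have h2 : 0 ≤ K ^ 3 * (lam * τ ^ 3 * ‖z‖) := by positivity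
    have h3 : 26 * K ^ 3 * (τ ^ 2 * ‖y‖ + (τ ^ 2 + lam * τ ^ 3) * ‖z‖) =
      26 * (K ^ 3 * (τ ^ 2 * N)) + 26 * (K ^ 3 * (lam * τ ^ 3 * ‖z‖)) := by rw [hN]; ring
    have h4 : 22 * K ^ 3 * (τ * N + lam * τ ^ 2 * ‖z‖) * τ =
      22 * (K ^ 3 * (τ ^ 2 * N)) + 22 * (K ^ 3 * (lam * τ ^ 3 * ‖z‖)) := by ring
    linarith
  · refine (bη b hb).trans ?_
    have h1 : N + D = ‖y‖ + (1 + lam) * ‖z‖ := by rw [hN, hD]; ring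
    rw [h1]
    calc _ = 4 * K * (τ * (‖y‖ + (1 + lam) * ‖z‖)) := by ring
      _ ≤ _ := by gcongr <;> linarith

end LinearEstimate
end

/-! ### The tilted initial datum, its characteristics and their derivatives. -/

noncomputable section
open Filter Topology

variable {d : ℕ}

section Bracket

/-- The Japanese bracket `(1 + |x|²)^{1/2}`. -/
def bracket (x : Rd d) : ℝ := √(1 + ‖x‖ ^ 2)

theorem one_add_sq_pos (x : Rd d) : 0 < 1 + ‖x‖ ^ 2 := by positivity

theorem bracket_pos (x : Rd d) : 0 < bracket x := Real.sqrt_pos.2 (one_add_sq_pos x)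

theorem norm_le_bracket (x : Rd d) : ‖x‖ ≤ bracket x := Real.le_sqrt_of_sq_le (by linarith)

theorem one_le_bracket (x : Rd d) : 1 ≤ bracket x :=
  Real.le_sqrt_of_sq_le (by nlinarith [sq_nonneg ‖x‖])

theorem contDiff_bracket : ContDiff ℝ 2 (bracket (d := d)) :=
  ContDiff.sqrt (contDiff_const.add (contDiff_norm_sq ℝ)) fun x => (one_add_sq_pos x).ne'

theorem hasGradientAt_bracket (x : Rd d) : HasGradientAt bracket ((bracket x)⁻¹ • x) x := by
  have h := ((hasStrictFDerivAt_norm_sq x).hasFDerivAt.const_add 1).sqrt (one_add_sq_pos x).ne'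
  rw [hasGradientAt_iff_hasFDerivAt]
  refine h.congr_fderiv ?_
  ext v
  have := (bracket_pos x).ne'
  simp only [bracket] at this ⊢
  simp
  field_simp

theorem gradient_bracket (x : Rd d) : ∇ bracket x = (bracket x)⁻¹ • x :=
  (hasGradientAt_bracket x).gradient

theorem norm_gradient_bracket_le (x : Rd d) : ‖∇ bracket x‖ ≤ 1 := by
  rw [gradient_bracket, norm_smul, norm_inv, Real.norm_of_nonneg (bracket_pos x).le,
    inv_mul_le_iff₀ (bracket_pos x), mul_one]
  exact norm_le_bracket x

theorem abs_bracket_sub_le (x y : Rd d) : |bracket x - bracket y| ≤ ‖x - y‖ := by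
  have := convex_univ.norm_image_sub_le_of_norm_fderiv_le (𝕜 := ℝ) (f := bracket (d := d)) (C := 1)
    (x := y) (y := x) (fun x _ => contDiff_bracket.differentiable (by norm_num) x)
    (fun x _ => by
      rw [← norm_iteratedFDeriv_one, ← norm_gradient_eq]; exact norm_gradient_bracket_le x)
    (mem_univ _) (mem_univ _)
  simpa using this

theorem norm_fderiv_gradient_bracket_le (x : Rd d) : ‖fderiv ℝ (∇ bracket) x‖ ≤ 2 := by
  have hl : LipschitzWith 2 (∇ (bracket (d := d))) := by
    refine LipschitzWith.of_dist_le_mul fun x y => ?_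
    rw [dist_eq_norm, dist_eq_norm, gradient_bracket, gradient_bracket]
    have hx := bracket_pos x
    have hy := bracket_pos y
    have h1 : (bracket x)⁻¹ • x - (bracket y)⁻¹ • y =
        (bracket x)⁻¹ • (x - y) + ((bracket x)⁻¹ * (bracket y)⁻¹ * (bracket y - bracket x)) • y := by
      have : (bracket x)⁻¹ * (bracket y)⁻¹ * (bracket y - bracket x) =
        (bracket x)⁻¹ - (bracket y)⁻¹ := by field_simp
      rw [this, smul_sub, sub_smul]; abel
    rw [h1]
    have hxi : (bracket x)⁻¹ ≤ 1 := inv_le_one_of_one_le₀ (one_le_bracket x)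
    have h2 : ‖(bracket x)⁻¹ • (x - y)‖ ≤ ‖x - y‖ := by
      rw [norm_smul, norm_inv, Real.norm_of_nonneg hx.le]
      exact mul_le_of_le_one_left (norm_nonneg _) hxi
    have h3 : ‖((bracket x)⁻¹ * (bracket y)⁻¹ * (bracket y - bracket x)) • y‖ ≤ ‖x - y‖ := by
      rw [norm_smul, norm_mul, norm_mul, norm_inv, norm_inv, Real.norm_of_nonneg hx.le,
        Real.norm_of_nonneg hy.le, Real.norm_eq_abs, abs_sub_comm]
      have h4 : (bracket y)⁻¹ * ‖y‖ ≤ 1 := by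
        rw [inv_mul_le_iff₀ hy, mul_one]; exact norm_le_bracket y
      calc (bracket x)⁻¹ * (bracket y)⁻¹ * |bracket x - bracket y| * ‖y‖
          = (bracket x)⁻¹ * ((bracket y)⁻¹ * ‖y‖) * |bracket x - bracket y| := by ring
        _ ≤ 1 * 1 * ‖x - y‖ := by
          gcongr
          exact abs_bracket_sub_le x y
        _ = _ := by ring
    refine (norm_add_le _ _).trans ?_
    push_cast; linarith
  simpa using norm_fderiv_le_of_lipschitz ℝ (x₀ := x) hl

theorem contDiff_gradient_bracket : ContDiff ℝ 1 (∇ (bracket (d := d))) :=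
  contDiff_gradient contDiff_bracket (by norm_num)

end Bracket

section Start

/-- The initial datum `(lam / 2) |x - y|² + ε ⟨x⟩`. -/
def initialDatum (lam ε : ℝ) (q : Rd d × Rd d) : ℝ := lam / 2 * ‖q.1 - q.2‖ ^ 2 + ε * bracket q.1

/-- The initial position and momentum of the first characteristic. -/
def startX (lam ε : ℝ) (q : Rd d × Rd d) : Rd d × Rd d :=
  (q.1, lam • (q.1 - q.2) + ε • ∇ bracket q.1)

/-- The initial position and momentum of the second characteristic. -/
def startY (lam : ℝ) (q : Rd d × Rd d) : Rd d × Rd d := (q.2, lam • (q.1 - q.2))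

/-- The derivative of `startX`. -/
def startXDeriv (lam ε : ℝ) (q : Rd d × Rd d) : Rd d × Rd d →L[ℝ] Rd d × Rd d :=
  (ContinuousLinearMap.fst ℝ (Rd d) (Rd d)).prod
    (lam • (ContinuousLinearMap.fst ℝ (Rd d) (Rd d) - ContinuousLinearMap.snd ℝ (Rd d) (Rd d)) +
      ε • (fderiv ℝ (∇ bracket) q.1).comp (ContinuousLinearMap.fst ℝ (Rd d) (Rd d)))

/-- The derivative of `startY`. -/
def startYDeriv (lam : ℝ) : Rd d × Rd d →L[ℝ] Rd d × Rd d :=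
  (ContinuousLinearMap.snd ℝ (Rd d) (Rd d)).prod
    (lam • (ContinuousLinearMap.fst ℝ (Rd d) (Rd d) - ContinuousLinearMap.snd ℝ (Rd d) (Rd d)))

variable (lam ε : ℝ) (q : Rd d × Rd d)

theorem hasFDerivAt_startX : HasFDerivAt (startX lam ε) (startXDeriv lam ε q) q := by
  have h1 : HasFDerivAt (fun q : Rd d × Rd d => ∇ bracket q.1)
      ((fderiv ℝ (∇ bracket) q.1).comp (ContinuousLinearMap.fst ℝ (Rd d) (Rd d))) q :=
    (contDiff_gradient_bracket.differentiable one_ne_zero q.1).hasFDerivAt.comp q hasFDerivAt_fst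
  exact hasFDerivAt_fst.prodMk
    (((hasFDerivAt_fst.sub hasFDerivAt_snd).const_smul lam).add (h1.const_smul ε))

theorem hasFDerivAt_startY : HasFDerivAt (startY lam) (startYDeriv lam) q :=
  hasFDerivAt_snd.prodMk ((hasFDerivAt_fst.sub hasFDerivAt_snd).const_smul lam)

theorem contDiff_startX : ContDiff ℝ 1 (startX (d := d) lam ε) :=
  contDiff_fst.prodMk (((contDiff_fst.sub contDiff_snd).const_smul lam).add
    ((contDiff_gradient_bracket.comp contDiff_fst).const_smul ε))

theorem contDiff_startY : ContDiff ℝ 1 (startY (d := d) lam) :=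
  contDiff_snd.prodMk ((contDiff_fst.sub contDiff_snd).const_smul lam)

/-- The momenta `startX` and `startY` are the partial gradients of the initial datum. -/
theorem hasFDerivAt_initialDatum : HasFDerivAt (initialDatum lam ε)
    ((innerSL ℝ (startX lam ε q).2).comp (ContinuousLinearMap.fst ℝ (Rd d) (Rd d)) -
      (innerSL ℝ (startY lam q).2).comp (ContinuousLinearMap.snd ℝ (Rd d) (Rd d))) q := by
  have h1 := (((hasStrictFDerivAt_norm_sq (q.1 - q.2)).hasFDerivAt.comp q
    (hasFDerivAt_fst.sub hasFDerivAt_snd)).const_mul (lam / 2))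
  have h2 : HasFDerivAt (fun q : Rd d × Rd d => bracket q.1) _ q :=
    (hasGradientAt_of_contDiff contDiff_bracket (by norm_num) q.1).hasFDerivAt.comp q
      hasFDerivAt_fst
  refine (h1.add (h2.const_mul ε)).congr_fderiv ?_
  refine ContinuousLinearMap.ext fun v => ?_
  simp [startX, startY, ← inner_gradient_left]
  ring

end Start

theorem SeparatedBounds.mono {H F : Rd d → ℝ} {K K' : ℝ} (h : SeparatedBounds K H F)
    (hK : K ≤ K') : SeparatedBounds K' H F :=
  ⟨h.contDiff_H, h.contDiff_F, fun p => (h.bound_DH p).trans hK, fun p => (h.bound_DF p).trans hK,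
    fun p => (h.bound_D2F p).trans hK, fun p => (h.bound_D2H p).trans hK,
    fun p => (h.bound_D3H p).trans hK, fun p => (h.bound_D4H p).trans hK⟩

/-- The smallness conditions on the time `τ` and the tilt `ε`. -/
structure ShortTime (K lam ε τ δ : ℝ) : Prop where
  one_le_K : 1 ≤ K
  lam_pos : 0 < lam
  τ_pos : 0 < τ
  K_mul_τ : 8 * K * τ ≤ 1
  ε_nonneg : 0 ≤ ε
  ε_le : ε ≤ τ ^ 2
  τ_lt : τ < δ

section Characteristics

variable {H F : Rd d → ℝ} {K lam ε τ δ : ℝ} (Z : C1Flow (hamField H F) δ)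

theorem ShortTime.τ_le_one (s : ShortTime K lam ε τ δ) : τ ≤ 1 := by
  nlinarith [s.K_mul_τ, s.one_le_K, s.τ_pos]

theorem ShortTime.ε_le_one (s : ShortTime K lam ε τ δ) : ε ≤ 1 := by
  nlinarith [s.ε_le, s.τ_le_one, s.τ_pos]

theorem ShortTime.exp_le (s : ShortTime K lam ε τ δ) {t : ℝ} (ht : |t| ≤ τ) :
    Real.exp (K * |t|) ≤ 2 := by
  have h1 : K * |t| ≤ 1 / 2 := by nlinarith [s.K_mul_τ, s.one_le_K]
  have h2 := Real.exp_bound_div_one_sub_of_interval (x := 1 / 2) (by norm_num) (by norm_num)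
  calc _ ≤ Real.exp (1 / 2) := Real.exp_le_exp.2 h1
    _ ≤ _ := by norm_num at h2 ⊢; linarith

theorem norm_flow_sub_le_time (h : SeparatedBounds K H F) (z : Rd d × Rd d) (s t : ℝ) :
    ‖Z.φ z t - Z.φ z s‖ ≤ K * |t - s| :=
  convex_univ.norm_image_sub_le_of_norm_hasDerivWithin_le
    (fun _ _ => (Z.deriv z _).hasDerivWithinAt) (fun _ _ => norm_hamField_le h _)
    (mem_univ _) (mem_univ _)

theorem norm_flow_sub_le (h : SeparatedBounds K H F) (s : ShortTime K lam ε τ δ)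
    (z w : Rd d × Rd d) {t : ℝ} (ht : |t| ≤ τ) : ‖Z.φ z t - Z.φ w t‖ ≤ 2 * ‖z - w‖ := by
  have := dist_flow_le (lipschitzWith_hamField h) (Z.deriv z) (Z.deriv w) t
  rw [Z.init, Z.init, dist_eq_norm, dist_eq_norm, Real.coe_toNNReal _ h.K_nonneg] at this
  exact this.trans (by gcongr; exact s.exp_le ht)

theorem norm_W_le (h : SeparatedBounds K H F) (s : ShortTime K lam ε τ δ)
    (z : Rd d × Rd d) {t : ℝ} (ht : |t| ≤ τ) : ‖Z.W z t‖ ≤ 2 :=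
  (Z.hasFDerivAt z t (ht.trans_lt s.τ_lt)).le_of_lipschitz (C := 2) <|
    LipschitzWith.of_dist_le_mul fun z w => by
      simpa [dist_eq_norm] using norm_flow_sub_le Z h s z w ht

variable (lam ε) in
theorem norm_startX_sub_startY_le (hε : 0 ≤ ε) (q : Rd d × Rd d) :
    ‖startX lam ε q - startY lam q‖ ≤ ‖q.1 - q.2‖ + ε := by
  have h1 : ‖ε • ∇ bracket q.1‖ ≤ ε := by
    rw [norm_smul, Real.norm_of_nonneg hε]
    exact mul_le_of_le_one_right hε (norm_gradient_bracket_le _)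
  refine max_le ?_ ?_
  · simp only [startX, startY, Prod.fst_sub]; linarith
  · simp only [startX, startY, Prod.snd_sub, add_sub_cancel_left]
    linarith [norm_nonneg (q.1 - q.2)]

theorem norm_X_sub_Y_le (h : SeparatedBounds K H F) (s : ShortTime K lam ε τ δ)
    (q : Rd d × Rd d) {t : ℝ} (ht : |t| ≤ τ) :
    ‖Z.φ (startX lam ε q) t - Z.φ (startY lam q) t‖ ≤ 2 * (‖q.1 - q.2‖ + ε) :=
  (norm_flow_sub_le Z h s _ _ ht).trans
    (by gcongr; exact norm_startX_sub_startY_le lam ε s.ε_nonneg q)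

/-- The initial momenta differ only by the tilt, of size at most `ε`, and afterwards separate at the
rate `DF(X) - DF(Y)`. This yields a factor `τ` in front of `|x - y|`, uniformly in `λ`. -/
theorem norm_P_sub_Q_le (h : SeparatedBounds K H F) (s : ShortTime K lam ε τ δ)
    (q : Rd d × Rd d) {t : ℝ} (ht : |t| ≤ τ) :
    ‖(Z.φ (startX lam ε q) t).2 - (Z.φ (startY lam q) t).2‖ ≤
      2 * ε + 2 * K * τ * ‖q.1 - q.2‖ := by
  have key := norm_sub_le_of_hasDerivAt_abs_le (T := τ) (s := 0) (t := t)
    (C := K * (2 * (‖q.1 - q.2‖ + ε)))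
    (f := fun t => (Z.φ (startX lam ε q) t).2 - (Z.φ (startY lam q) t).2)
    (fun t _ => (hasDerivAt_flow_snd Z (startX lam ε q) t).sub
      (hasDerivAt_flow_snd Z (startY lam q) t))
    (fun t ht => (h.norm_gradF_sub_le _ _).trans
      (mul_le_mul_of_nonneg_left ((norm_fst_le _).trans (norm_X_sub_Y_le Z h s q ht))
        h.K_nonneg)) (by simpa using s.τ_pos.le) ht
  have h1 : ‖ε • ∇ bracket q.1‖ ≤ ε := by
    rw [norm_smul, Real.norm_of_nonneg s.ε_nonneg]
    exact mul_le_of_le_one_right s.ε_nonneg (norm_gradient_bracket_le _)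
  simp only [Z.init, sub_zero] at key
  have h2 : (startX lam ε q).2 - (startY lam q).2 = ε • ∇ bracket q.1 := by
    simp [startX, startY]
  rw [h2] at key
  have h3 := norm_le_norm_add_norm_sub' ((Z.φ (startX lam ε q) t).2 - (Z.φ (startY lam q) t).2)
    (ε • ∇ bracket q.1)
  have h4 : K * (2 * (‖q.1 - q.2‖ + ε)) * |t| ≤ K * (2 * (‖q.1 - q.2‖ + ε)) * τ := by
    have := h.K_nonneg
    have := s.ε_nonneg
    gcongr
  nlinarith [s.K_mul_τ, s.ε_nonneg]

/-- Together with the same bound for `Q`, it allows the decay of `D³H` to be used on a ball centred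
at `λ(x - y)`. -/
theorem norm_P_sub_le (h : SeparatedBounds K H F) (s : ShortTime K lam ε τ δ)
    (q : Rd d × Rd d) {t : ℝ} (ht : |t| ≤ τ) :
    ‖(Z.φ (startX lam ε q) t).2 - lam • (q.1 - q.2)‖ ≤ 2 := by
  have h1 := (norm_snd_le _).trans (norm_flow_sub_le_time Z h (startX lam ε q) 0 t)
  rw [Z.init, sub_zero] at h1
  have h2 : ‖ε • ∇ bracket q.1‖ ≤ ε := by
    rw [norm_smul, Real.norm_of_nonneg s.ε_nonneg]
    exact mul_le_of_le_one_right s.ε_nonneg (norm_gradient_bracket_le _)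
  have h3 : (Z.φ (startX lam ε q) t).2 - lam • (q.1 - q.2) =
      (Z.φ (startX lam ε q) t - startX lam ε q).2 + ε • ∇ bracket q.1 := by
    simp only [startX, Prod.snd_sub]; abel
  rw [h3]
  have h4 : K * |t| ≤ 1 := by nlinarith [s.K_mul_τ, s.one_le_K]
  linarith [norm_add_le (Z.φ (startX lam ε q) t - startX lam ε q).2 (ε • ∇ bracket q.1), s.ε_le_one]

theorem norm_Q_sub_le (h : SeparatedBounds K H F) (s : ShortTime K lam ε τ δ)
    (q : Rd d × Rd d) {t : ℝ} (ht : |t| ≤ τ) :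
    ‖(Z.φ (startY lam q) t).2 - lam • (q.1 - q.2)‖ ≤ 2 := by
  have h1 := (norm_snd_le _).trans (norm_flow_sub_le_time Z h (startY lam q) 0 t)
  rw [Z.init, sub_zero] at h1
  have h4 : K * |t| ≤ 1 := by nlinarith [s.K_mul_τ, s.one_le_K]
  have h5 : (Z.φ (startY lam q) t - startY lam q).2 =
    (Z.φ (startY lam q) t).2 - lam • (q.1 - q.2) := rfl
  rw [h5] at h1
  linarith

/-- The map `(x, y) ↦ (X(x, y, a), Y(x, y, b))`. -/
def twoTimeMap (lam ε a b : ℝ) (q : Rd d × Rd d) : Rd d × Rd d :=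
  ((Z.φ (startX lam ε q) a).1, (Z.φ (startY lam q) b).1)

/-- The derivative of `twoTimeMap`. -/
def twoTimeDeriv (lam ε a b : ℝ) (q : Rd d × Rd d) : Rd d × Rd d →L[ℝ] Rd d × Rd d :=
  ((ContinuousLinearMap.fst ℝ (Rd d) (Rd d)).comp
      ((Z.W (startX lam ε q) a).comp (startXDeriv lam ε q))).prod
    ((ContinuousLinearMap.fst ℝ (Rd d) (Rd d)).comp
      ((Z.W (startY lam q) b).comp (startYDeriv lam)))

theorem hasFDerivAt_twoTimeMap (lam ε : ℝ) {a b : ℝ} (ha : |a| < δ) (hb : |b| < δ)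
    (q : Rd d × Rd d) :
    HasFDerivAt (twoTimeMap Z lam ε a b) (twoTimeDeriv Z lam ε a b q) q :=
  HasFDerivAt.prodMk
    (((Z.hasFDerivAt _ a ha).comp q (hasFDerivAt_startX lam ε q)).fst)
    (((Z.hasFDerivAt _ b hb).comp q (hasFDerivAt_startY lam q)).fst)

/-- The two components of the derivative are the positions of the linearized characteristics, with
`D²H` and `D²F` along the orbits as coefficients. The point to verify for `linearized_estimate` is
the near equality of the two `D²H` coefficients. -/
theorem twoTimeDeriv_estimate (h : SeparatedBounds K H F) (s : ShortTime K lam ε τ δ) {a b : ℝ}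
    (ha : |a| ≤ τ) (hb : |b| ≤ τ) (hab : (1 + lam) * |a - b| ≤ τ ^ 2) (q v : Rd d × Rd d) :
    ‖(twoTimeDeriv Z lam ε a b q v).1 - (twoTimeDeriv Z lam ε a b q v).2 - (v.1 - v.2)‖ ≤
        26 * K ^ 3 * (τ ^ 2 * ‖v.2‖ + (τ ^ 2 + lam * τ ^ 3) * ‖v.1 - v.2‖) ∧
      ‖(twoTimeDeriv Z lam ε a b q v).2 - v.2‖ ≤
        26 * K ^ 3 * (τ * (‖v.2‖ + (1 + lam) * ‖v.1 - v.2‖)) := by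
  have hK := s.one_le_K
  have hε := s.ε_nonneg
  have hlam := s.lam_pos
  have hτ := s.τ_pos
  have hε2 : 2 * ε ≤ 1 := by
    have := s.ε_le; have := s.K_mul_τ
    nlinarith [mul_nonneg hτ.le (by linarith : (0 : ℝ) ≤ K - 1)]
  set zX := startX lam ε q with hzX
  set zY := startY lam q with hzY
  set vX := startXDeriv lam ε q v with hvX
  set vY := startYDeriv lam v with hvY
  have hW : ∀ z w t, |t| ≤ τ → HasDerivAt (fun t => Z.W z t w)
      (-(fderiv ℝ (∇ H) (Z.φ z t).2 (Z.W z t w).2),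
        fderiv ℝ (∇ F) (Z.φ z t).1 (Z.W z t w).1) t := fun z w t ht => by
    have := (Z.W_deriv z t (ht.trans_lt s.τ_lt)).clm_apply (hasDerivAt_const t w)
    simpa [fderiv_hamField h] using! this
  have hvX1 : vX.1 = v.1 := rfl
  have hvY1 : vY.1 = v.2 := rfl
  have hvY2 : vY.2 = lam • (v.1 - v.2) := rfl
  have hvX2 : vX.2 = lam • (v.1 - v.2) + ε • fderiv ℝ (∇ bracket) q.1 v.1 := rfl
  have hv1 : ‖v.1‖ ≤ ‖v.1 - v.2‖ + ‖v.2‖ := by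
    simpa using norm_add_le (v.1 - v.2) v.2
  have hbr : ‖ε • fderiv ℝ (∇ bracket) q.1 v.1‖ ≤ 2 * ε * ‖v.1‖ := by
    rw [norm_smul, Real.norm_of_nonneg hε]
    have := (fderiv ℝ (∇ bracket) q.1).le_of_opNorm_le (norm_fderiv_gradient_bracket_le q.1) v.1
    nlinarith
  have hlv : ‖lam • (v.1 - v.2)‖ = lam * ‖v.1 - v.2‖ := by
    rw [norm_smul, Real.norm_of_nonneg hlam.le]
  have hlv0 : 0 ≤ lam * ‖v.1 - v.2‖ := by positivity
  have nvX : ‖vX‖ ≤ 2 * (‖v.1 - v.2‖ + ‖v.2‖ + lam * ‖v.1 - v.2‖) := by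
    refine max_le ?_ ?_
    · rw [hvX1]; linarith [norm_nonneg v.1]
    · rw [hvX2]
      refine (norm_add_le _ _).trans ?_
      rw [hlv]
      have : 2 * ε * ‖v.1‖ ≤ 1 * ‖v.1‖ := by gcongr
      linarith [norm_nonneg v.1]
  have nvY : ‖vY‖ ≤ 2 * (‖v.1 - v.2‖ + ‖v.2‖ + lam * ‖v.1 - v.2‖) := by
    refine max_le ?_ ?_
    · rw [hvY1]; linarith [norm_nonneg v.2, norm_nonneg (v.1 - v.2)]
    · rw [hvY2, hlv]; linarith [norm_nonneg v.2, norm_nonneg (v.1 - v.2)]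
  refine linearized_estimate (ξ := fun t => (Z.W zX t vX).1) (π := fun t => (Z.W zX t vX).2)
    (η := fun t => (Z.W zY t vY).1) (θ := fun t => (Z.W zY t vY).2)
    (A := fun t => fderiv ℝ (∇ H) (Z.φ zX t).2) (A' := fun t => fderiv ℝ (∇ H) (Z.φ zY t).2)
    (B := fun t => fderiv ℝ (∇ F) (Z.φ zX t).1) (B' := fun t => fderiv ℝ (∇ F) (Z.φ zY t).1)
    (ε := ε) (x := v.1) rfl hK hlam hτ (by linarith [s.K_mul_τ, mul_nonneg (by linarith : (0 : ℝ) ≤ K) hτ.le]) hε s.ε_le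
    (fun t ht => (hW zX vX t ht).fst) (fun t ht => (hW zX vX t ht).snd)
    (fun t ht => (hW zY vY t ht).fst) (fun t ht => (hW zY vY t ht).snd)
    (fun t => h.norm_fderiv_gradH_le _) (fun t => h.norm_fderiv_gradH_le _)
    (fun t => h.norm_fderiv_gradF_le _) (fun t => h.norm_fderiv_gradF_le _)
    (fun t ht => ?_) (by simp [Z.W_init, hvX1]) (by simp [Z.W_init, hvY1])
    (by simp [Z.W_init, hvY2]) (by simpa [Z.W_init, hvX2] using hbr)
    (fun t ht => ?_) (fun t ht => ?_) ha hb hab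
  -- With `r = |x - y|`, the momenta differ by at most `2τ² + 2Kτr`, and `D²H` has Lipschitz
  -- constant `3K / (1 + λr)` there. After multiplication by `λ`, the ratio `λr / (1 + λr) ≤ 1`
  -- makes the bound uniform in `r`.
  · have h1 := h.norm_fderiv_gradH_sub_le (norm_P_sub_le Z h s q ht) (norm_Q_sub_le Z h s q ht)
    have h2 := norm_P_sub_Q_le Z h s q ht
    rw [norm_smul, Real.norm_of_nonneg hlam.le] at h1
    set r := ‖q.1 - q.2‖
    have hr : 0 ≤ r := norm_nonneg _
    have h0 : 0 < 1 + lam * r := by positivity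
    refine le_of_mul_le_mul_left ?_ h0
    calc (1 + lam * r) * (lam * ‖fderiv ℝ (∇ H) (Z.φ zX t).2 - fderiv ℝ (∇ H) (Z.φ zY t).2‖)
        = lam * ((1 + lam * r) *
            ‖fderiv ℝ (∇ H) (Z.φ zX t).2 - fderiv ℝ (∇ H) (Z.φ zY t).2‖) := by ring
      _ ≤ lam * (3 * K * (2 * τ ^ 2 + 2 * K * τ * r)) := by
        refine mul_le_mul_of_nonneg_left (h1.trans ?_) hlam.le
        refine mul_le_mul_of_nonneg_left (h2.trans ?_) (by linarith)
        linarith [s.ε_le]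
      _ = 6 * K * (lam * τ ^ 2) + 6 * K ^ 2 * (τ * (lam * r)) := by ring
      _ ≤ 6 * K ^ 2 * (lam * τ ^ 2) + 6 * K ^ 2 * (τ * (lam * r)) := by
        gcongr; nlinarith
      _ ≤ (1 + lam * r) * (6 * K ^ 2 * (lam * τ ^ 2 + τ)) := by
        have : 0 ≤ 6 * K ^ 2 * τ + lam * r * (6 * K ^ 2 * (lam * τ ^ 2)) := by positivity
        nlinarith
  · calc _ ≤ ‖Z.W zX t vX‖ := norm_snd_le _
      _ ≤ 2 * (2 * (‖v.1 - v.2‖ + ‖v.2‖ + lam * ‖v.1 - v.2‖)) :=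
        (Z.W zX t).le_of_opNorm_le_of_le (norm_W_le Z h s zX ht) nvX
      _ = _ := by ring
  · calc _ ≤ ‖Z.W zY t vY‖ := norm_snd_le _
      _ ≤ 2 * (2 * (‖v.1 - v.2‖ + ‖v.2‖ + lam * ‖v.1 - v.2‖)) :=
        (Z.W zY t).le_of_opNorm_le_of_le (norm_W_le Z h s zY ht) nvY
      _ = _ := by ring

end Characteristics
end

/-! ### Inverting the endpoint map with two separate times. -/

noncomputable section
open Filter Topology

variable {d : ℕ}

/-- The linear change of coordinates `(x, y) ↦ (α (x - y), y)`. -/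
def scaleDiff {α : ℝ} (hα : α ≠ 0) : (Rd d × Rd d) ≃L[ℝ] (Rd d × Rd d) :=
  ContinuousLinearEquiv.equivOfInverse
    ((α • (ContinuousLinearMap.fst ℝ (Rd d) (Rd d) - ContinuousLinearMap.snd ℝ (Rd d) (Rd d))).prod
      (ContinuousLinearMap.snd ℝ (Rd d) (Rd d)))
    ((α⁻¹ • ContinuousLinearMap.fst ℝ (Rd d) (Rd d) + ContinuousLinearMap.snd ℝ (Rd d) (Rd d)).prod
      (ContinuousLinearMap.snd ℝ (Rd d) (Rd d)))
    (fun v => by ext1 <;> simp [smul_smul, hα]) (fun v => by ext1 <;> simp [smul_smul, hα])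

theorem scaleDiff_apply {α : ℝ} (hα : α ≠ 0) (v : Rd d × Rd d) :
    scaleDiff hα v = (α • (v.1 - v.2), v.2) := rfl

theorem injective_of_norm_conj_sub_id_le {E : Type*} [NormedAddCommGroup E] [NormedSpace ℝ E]
    {M : E →L[ℝ] E} {L : E ≃L[ℝ] E} {θ : ℝ} (hθ : θ < 1)
    (h : ‖(L : E →L[ℝ] E).comp (M.comp (L.symm : E →L[ℝ] E)) - ContinuousLinearMap.id ℝ E‖ ≤ θ) :
    Function.Injective M := by
  rw [injective_iff_map_eq_zero]
  intro v hv
  have h1 := ContinuousLinearMap.le_of_opNorm_le _ h (L v)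
  simp only [sub_apply, ContinuousLinearMap.comp_apply, ContinuousLinearEquiv.coe_coe,
    ContinuousLinearEquiv.symm_apply_apply, hv, map_zero, ContinuousLinearMap.coe_id', id_eq,
    zero_sub, norm_neg] at h1
  have h2 : ‖L v‖ = 0 := by nlinarith [norm_nonneg (L v)]
  simpa using h2

/-- A differentiable map whose derivative is uniformly close to the identity in some linear
coordinates is bijective. -/
theorem bijective_of_norm_conj_fderiv_sub_id_le {E : Type*} [NormedAddCommGroup E]
    [NormedSpace ℝ E] [CompleteSpace E] {f : E → E} {M : E → E →L[ℝ] E} {L : E ≃L[ℝ] E}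
    {θ : ℝ≥0} (hθ : θ < 1) (hf : ∀ q, HasFDerivAt f (M q) q)
    (h : ∀ q, ‖(L : E →L[ℝ] E).comp ((M q).comp (L.symm : E →L[ℝ] E)) -
      ContinuousLinearMap.id ℝ E‖ ≤ θ) :
    Function.Bijective f := by
  have hg : ∀ p, HasFDerivAt (fun p => L (f (L.symm p)))
      ((L : E →L[ℝ] E).comp ((M (L.symm p)).comp (L.symm : E →L[ℝ] E))) p := fun p =>
    L.hasFDerivAt.comp p ((hf (L.symm p)).comp p L.symm.hasFDerivAt)
  have happ : ApproximatesLinearOn (fun p => L (f (L.symm p)))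
      ((ContinuousLinearEquiv.refl ℝ E : E ≃L[ℝ] E) : E →L[ℝ] E) univ θ := fun x _ y _ =>
    convex_univ.norm_image_sub_le_of_norm_hasFDerivWithin_le'
      (fun p _ => (hg p).hasFDerivWithinAt) (fun p _ => h (L.symm p)) (mem_univ y) (mem_univ x)
  have hc : Subsingleton E ∨ θ < ‖((ContinuousLinearEquiv.refl ℝ E).symm : E →L[ℝ] E)‖₊⁻¹ := by
    rcases subsingleton_or_nontrivial E with hE | hE
    · exact Or.inl hE
    · right
      have : ‖((ContinuousLinearEquiv.refl ℝ E).symm : E →L[ℝ] E)‖₊ = 1 :=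
        NNReal.eq (ContinuousLinearMap.norm_id (𝕜 := ℝ) (E := E))
      rw [this]; simpa using hθ
  have hb : Function.Bijective (fun p => L (f (L.symm p))) :=
    (happ.toHomeomorph _ hc).bijective
  have : f = L.symm ∘ (fun p => L (f (L.symm p))) ∘ L := by funext q; simp
  rw [this]
  exact L.symm.bijective.comp (hb.comp L.bijective)

section TwoTime

variable {H F : Rd d → ℝ} {K lam ε τ δ θ : ℝ} (Z : C1Flow (hamField H F) δ)

/-- In the coordinates `L`, the derivative of the two-time map is `θ`-close to the identity. -/
def TwoTimeClose (lam ε τ θ : ℝ) (L : (Rd d × Rd d) ≃L[ℝ] (Rd d × Rd d)) : Prop :=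
  ∀ a b : ℝ, |a| ≤ τ → |b| ≤ τ → (1 + lam) * |a - b| ≤ τ ^ 2 → ∀ q,
    ‖(L : Rd d × Rd d →L[ℝ] Rd d × Rd d).comp ((twoTimeDeriv Z lam ε a b q).comp
      (L.symm : Rd d × Rd d →L[ℝ] Rd d × Rd d)) - ContinuousLinearMap.id ℝ _‖ ≤ θ

/-- In the coordinates `(x - y, y)` the error has off-diagonal entries of order `τ²` and `τ(1 + λ)`;
the second may be large, but their product is at most of order `τ² + λτ³`. Multiplying `x - y` by
`α` turns them into `ατ²` and `τ(1 + λ)/α`, and `α = (1 + λτ)/S` brings both below `S`. Each row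
then has norm at most `2 · 26K³S = θ`. -/
theorem exists_twoTimeClose (h : SeparatedBounds K H F) (s : ShortTime K lam ε τ δ) (hθ : 0 < θ)
    (hθ1 : θ ≤ 1) (hτ : τ ^ 2 + lam * τ ^ 3 ≤ (θ / (52 * K ^ 3)) ^ 2) :
    ∃ L, TwoTimeClose Z lam ε τ θ L := by
  have hK := s.one_le_K
  have hlam := s.lam_pos
  have hτ0 := s.τ_pos
  have hK3 : 1 ≤ K ^ 3 := one_le_pow₀ hK
  have hK0 : 0 < K := by linarith
  set S := θ / (52 * K ^ 3) with hS
  have hS0 : 0 < S := by positivity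
  have hS1 : S ≤ 1 := by
    rw [hS, div_le_one (by positivity)]; linarith
  have hSθ : 52 * K ^ 3 * S = θ := by rw [hS]; field_simp
  have hτS : τ ≤ S := by
    refine (pow_le_pow_iff_left₀ hτ0.le hS0.le two_ne_zero).1 ?_
    have : 0 ≤ lam * τ ^ 3 := by positivity
    linarith
  set α := (1 + lam * τ) / S with hα
  have hα0 : 0 < α := by positivity
  have h1 : α * τ ^ 2 ≤ S := by
    rw [hα, div_mul_eq_mul_div, div_le_iff₀ hS0]; nlinarith
  have h2 : τ ^ 2 + lam * τ ^ 3 ≤ S := hτ.trans (by nlinarith)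
  have h3 : τ * (1 + lam) ≤ S * α := by
    rw [hα, mul_div_cancel₀ _ hS0.ne']; nlinarith
  refine ⟨scaleDiff hα0.ne', fun a b ha hb hab q => ?_⟩
  refine ContinuousLinearMap.opNorm_le_bound _ hθ.le fun ζ => ?_
  set v := (scaleDiff hα0.ne').symm ζ with hv
  have hζ : ζ = scaleDiff hα0.ne' v := by simp [hv]
  obtain ⟨e1, e2⟩ := twoTimeDeriv_estimate Z h s ha hb hab q v
  have hζ1 : α * ‖v.1 - v.2‖ ≤ ‖ζ‖ := by
    have : ‖ζ.1‖ ≤ ‖ζ‖ := norm_fst_le ζ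
    rwa [hζ, scaleDiff_apply, norm_smul, Real.norm_of_nonneg hα0.le, ← scaleDiff_apply hα0.ne',
      ← hζ] at this
  have hζ2 : ‖v.2‖ ≤ ‖ζ‖ := by
    have : ‖ζ.2‖ ≤ ‖ζ‖ := norm_snd_le ζ
    rwa [hζ, scaleDiff_apply, ← scaleDiff_apply hα0.ne', ← hζ] at this
  simp only [sub_apply, ContinuousLinearMap.comp_apply, ContinuousLinearEquiv.coe_coe, ← hv,
    ContinuousLinearMap.coe_id', id_eq]
  rw [hζ, scaleDiff_apply, scaleDiff_apply, ← scaleDiff_apply hα0.ne' v, ← hζ, Prod.norm_def]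
  set M := twoTimeDeriv Z lam ε a b q v
  refine max_le ?_ ?_
  · simp only [Prod.fst_sub]
    rw [hζ, scaleDiff_apply hα0.ne' v, ← scaleDiff_apply hα0.ne' v, ← hζ]
    have h4 : α • (M.1 - M.2) - α • (v.1 - v.2) = α • (M.1 - M.2 - (v.1 - v.2)) := by
      rw [smul_sub α (M.1 - M.2)]
    have h5 : ζ.1 = α • (v.1 - v.2) := by rw [hζ, scaleDiff_apply]
    rw [h5, h4, norm_smul, Real.norm_of_nonneg hα0.le]
    calc α * ‖M.1 - M.2 - (v.1 - v.2)‖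
        ≤ α * (26 * K ^ 3 * (τ ^ 2 * ‖v.2‖ + (τ ^ 2 + lam * τ ^ 3) * ‖v.1 - v.2‖)) := by gcongr
      _ = 26 * K ^ 3 * (α * τ ^ 2 * ‖v.2‖ + (τ ^ 2 + lam * τ ^ 3) * (α * ‖v.1 - v.2‖)) := by ring
      _ ≤ 26 * K ^ 3 * (S * ‖ζ‖ + S * ‖ζ‖) := by gcongr
      _ = 52 * K ^ 3 * S * ‖ζ‖ := by ring
      _ = θ * ‖ζ‖ := by rw [hSθ]
  · simp only [Prod.snd_sub]
    have h5 : ζ.2 = v.2 := by rw [hζ, scaleDiff_apply]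
    rw [h5]
    calc ‖M.2 - v.2‖ ≤ 26 * K ^ 3 * (τ * (‖v.2‖ + (1 + lam) * ‖v.1 - v.2‖)) := e2
      _ = 26 * K ^ 3 * (τ * ‖v.2‖ + τ * (1 + lam) * ‖v.1 - v.2‖) := by ring
      _ ≤ 26 * K ^ 3 * (S * ‖ζ‖ + S * α * ‖v.1 - v.2‖) := by gcongr
      _ = 26 * K ^ 3 * (S * ‖ζ‖ + S * (α * ‖v.1 - v.2‖)) := by ring
      _ ≤ 26 * K ^ 3 * (S * ‖ζ‖ + S * ‖ζ‖) := by gcongr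
      _ = 52 * K ^ 3 * S * ‖ζ‖ := by ring
      _ = θ * ‖ζ‖ := by rw [hSθ]

/-- The times at which the two-time solution is defined. -/
def timeDomain (lam τ : ℝ) : Set (ℝ × ℝ) :=
  {p | |p.1| < τ ∧ |p.2| < τ ∧ (1 + lam) * |p.1 - p.2| < τ ^ 2}

theorem isOpen_timeDomain (lam τ : ℝ) : IsOpen (timeDomain lam τ) :=
  (isOpen_lt continuous_fst.abs continuous_const).inter
    ((isOpen_lt continuous_snd.abs continuous_const).inter
      (isOpen_lt (continuous_const.mul (continuous_fst.sub continuous_snd).abs) continuous_const))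

variable {L : (Rd d × Rd d) ≃L[ℝ] (Rd d × Rd d)}

theorem bijective_twoTimeMap (s : ShortTime K lam ε τ δ) (hL : TwoTimeClose Z lam ε τ (1 / 2) L)
    {p : ℝ × ℝ} (hp : p ∈ timeDomain lam τ) :
    Function.Bijective (twoTimeMap Z lam ε p.1 p.2) := by
  refine bijective_of_norm_conj_fderiv_sub_id_le (L := L) (θ := 1 / 2) (by norm_num)
    (hasFDerivAt_twoTimeMap Z lam ε (hp.1.trans s.τ_lt) (hp.2.1.trans s.τ_lt)) fun q => ?_
  simpa using hL p.1 p.2 hp.1.le hp.2.1.le hp.2.2.le q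

/-- The inverse of the two-time map. -/
def twoTimeInv (lam ε : ℝ) (w : (Rd d × Rd d) × (ℝ × ℝ)) : Rd d × Rd d :=
  Function.invFun (twoTimeMap Z lam ε w.2.1 w.2.2) w.1

theorem twoTimeMap_twoTimeInv (s : ShortTime K lam ε τ δ)
    (hL : TwoTimeClose Z lam ε τ (1 / 2) L) {w : (Rd d × Rd d) × (ℝ × ℝ)}
    (hw : w.2 ∈ timeDomain lam τ) :
    twoTimeMap Z lam ε w.2.1 w.2.2 (twoTimeInv Z lam ε w) = w.1 :=
  Function.rightInverse_invFun (bijective_twoTimeMap Z s hL hw).2 w.1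

theorem contDiffAt_twoTimeMap (h : SeparatedBounds K H F) (lam ε : ℝ) (q : Rd d × Rd d)
    {p : ℝ × ℝ} (h1 : |p.1| < δ) (h2 : |p.2| < δ) :
    ContDiffAt ℝ 1 (fun u : (Rd d × Rd d) × (ℝ × ℝ) => twoTimeMap Z lam ε u.2.1 u.2.2 u.1)
      (q, p) := by
  have hf := (contDiff_hamField h).continuous
  have hX : ContDiffAt ℝ 1 (fun u : (Rd d × Rd d) × (ℝ × ℝ) => (startX lam ε u.1, u.2.1)) (q, p) :=
    (((contDiff_startX lam ε).comp contDiff_fst).prodMk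
      (contDiff_fst.comp contDiff_snd)).contDiffAt
  have hY : ContDiffAt ℝ 1 (fun u : (Rd d × Rd d) × (ℝ × ℝ) => (startY lam u.1, u.2.2)) (q, p) :=
    (((contDiff_startY lam).comp contDiff_fst).prodMk
      (contDiff_snd.comp contDiff_snd)).contDiffAt
  exact (((Z.contDiffAt hf (z := startX lam ε q) h1).comp (q, p) hX).fst).prodMk
    (((Z.contDiffAt hf (z := startY lam q) h2).comp (q, p) hY).fst)

/-- The inverse function theorem is applied to the map carrying the times along as parameters, which
gives regularity jointly in endpoints and times. Global injectivity identifies the local inverse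
with `twoTimeInv`. -/
theorem contDiffAt_twoTimeInv (h : SeparatedBounds K H F) (s : ShortTime K lam ε τ δ)
    (hL : TwoTimeClose Z lam ε τ (1 / 2) L) {w : (Rd d × Rd d) × (ℝ × ℝ)}
    (hw : w.2 ∈ timeDomain lam τ) : ContDiffAt ℝ 1 (twoTimeInv Z lam ε) w := by
  set q := twoTimeInv Z lam ε w with hq
  have hqw := twoTimeMap_twoTimeInv Z s hL hw
  rw [← hq] at hqw
  have h1 : |w.2.1| < δ := hw.1.trans s.τ_lt
  have h2 : |w.2.2| < δ := hw.2.1.trans s.τ_lt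
  set T : (Rd d × Rd d) × (ℝ × ℝ) → (Rd d × Rd d) × (ℝ × ℝ) :=
    fun u => (twoTimeMap Z lam ε u.2.1 u.2.2 u.1, u.2) with hT
  have hTq : T (q, w.2) = w := by simp only [hT, hqw]
  have hTc : ContDiffAt ℝ 1 T (q, w.2) :=
    (contDiffAt_twoTimeMap Z h lam ε q h1 h2).prodMk contDiffAt_snd
  have hTd := (hTc.differentiableAt one_ne_zero).hasFDerivAt
  set T' := fderiv ℝ T (q, w.2) with hT'
  have hT2 : ∀ u, (T' u).2 = u.2 := fun u => by
    have h3 : HasFDerivAt (fun u : (Rd d × Rd d) × (ℝ × ℝ) => u.2)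
      (ContinuousLinearMap.snd ℝ (Rd d × Rd d) (ℝ × ℝ)) (q, w.2) := hasFDerivAt_snd
    have h4 := hTd.snd.unique h3
    exact congrArg (fun A => A u) h4
  have hT1 : ∀ v, (T' (v, 0)).1 = twoTimeDeriv Z lam ε w.2.1 w.2.2 q v := fun v => by
    have h3 : HasFDerivAt (fun q' : Rd d × Rd d => (q', w.2))
      (ContinuousLinearMap.inl ℝ (Rd d × Rd d) (ℝ × ℝ)) q := hasFDerivAt_prodMk_left q w.2
    have h4 := (hTd.comp q h3).fst
    have h5 := h4.unique (hasFDerivAt_twoTimeMap Z lam ε h1 h2 q)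
    rw [← h5]; simp
  have hinj : Function.Injective T' := by
    rw [injective_iff_map_eq_zero]
    rintro ⟨v, r⟩ hu
    have hr : r = 0 := by simpa [hu] using (hT2 (v, r)).symm
    subst hr
    have hv := hT1 v
    rw [hu] at hv
    have := injective_of_norm_conj_sub_id_le (by norm_num)
      (hL w.2.1 w.2.2 hw.1.le hw.2.1.le hw.2.2.le q)
    rw [injective_iff_map_eq_zero] at this
    rw [this v hv.symm]; rfl
  set e : ((Rd d × Rd d) × (ℝ × ℝ)) ≃L[ℝ] ((Rd d × Rd d) × (ℝ × ℝ)) :=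
    (LinearEquiv.ofInjectiveEndo (T' : _ →ₗ[ℝ] _) hinj).toContinuousLinearEquiv with he
  have heT : HasFDerivAt T (e : _ →L[ℝ] _) (q, w.2) := hTd.congr_fderiv (by
    ext1 <;> rfl)
  have hloc := hTc.to_localInverse heT one_ne_zero
  have hright := (hTc.hasStrictFDerivAt' heT one_ne_zero).eventually_right_inverse
  have happ := hTc.localInverse_apply_image heT one_ne_zero
  rw [hTq] at hloc hright happ
  refine (contDiffAt_fst.comp w hloc).congr_of_eventuallyEq ?_
  have hdom : ∀ᶠ u : (Rd d × Rd d) × (ℝ × ℝ) in 𝓝 w, u.2 ∈ timeDomain lam τ :=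
    continuousAt_snd ((isOpen_timeDomain lam τ).mem_nhds hw)
  filter_upwards [hright, hdom] with u hu hu'
  set ℓ := (hTc.hasStrictFDerivAt' heT one_ne_zero).localInverse T e (q, w.2) u with hℓ
  have hu0 : T ℓ = u := hu
  have hu1 : (T ℓ).2 = u.2 := by rw [hu0]
  have hu2 : (T ℓ).1 = u.1 := by rw [hu0]
  simp only [hT] at hu1 hu2
  rw [hu1] at hu2
  exact (bijective_twoTimeMap Z s hL hu').1
    ((twoTimeMap_twoTimeInv Z s hL hu').trans hu2.symm)

end TwoTime
end

/-! ### The solution of the doubled equation with two separate times. -/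

noncomputable section
open Filter Topology

variable {d : ℕ} {H F : Rd d → ℝ} {K lam ε τ δ : ℝ} (Z : C1Flow (hamField H F) δ)

/-- The differential of the action along a family of characteristics. -/
theorem hasFDerivAt_action_comp (h : SeparatedBounds K H F) {E : Type*} [NormedAddCommGroup E]
    [NormedSpace ℝ E] {ζ : E → Rd d × Rd d} {ζ' : E →L[ℝ] Rd d × Rd d} {t : E → ℝ}
    {t' : E →L[ℝ] ℝ} {A : E →L[ℝ] Rd d} {w : E} (hζ : HasFDerivAt ζ ζ' w)
    (ht : HasFDerivAt t t' w) (hδ : |t w| < δ)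
    (hA : HasFDerivAt (fun w => (Z.φ (ζ w) (t w)).1) A w) :
    HasFDerivAt (fun w => action Z (ζ w) (t w))
      ((innerSL ℝ (Z.φ (ζ w) (t w)).2).comp A +
        (H (Z.φ (ζ w) (t w)).2 + F (Z.φ (ζ w) (t w)).1) • t' -
        (innerSL ℝ (ζ w).2).comp ((ContinuousLinearMap.fst ℝ (Rd d) (Rd d)).comp ζ')) w := by
  have hp := hζ.prodMk ht
  have h1 := (Z.hasStrictFDerivAt (contDiff_hamField h).continuous (z := ζ w) hδ).hasFDerivAt
  have h2 := (HasFDerivAt.comp w (f := fun w => (ζ w, t w)) h1 hp).fst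
  have h3 := HasFDerivAt.comp w (f := fun w => (ζ w, t w)) (hasFDerivAt_action Z h (ζ w) hδ) hp
  rw [← h2.unique hA]
  -- The total differential `A` of the endpoint contains `-DH(P) dt`; pairing it with `P` accounts
  -- for the term `-P · DH(P)` of the Lagrangian and leaves `H + F` as coefficient of `dt`.
  refine h3.congr_fderiv (ContinuousLinearMap.ext fun v => ?_)
  simp [actionDeriv, lagrangian, hamField, inner_add_right, inner_smul_right]
  ring

/-- The momentum of the first characteristic. -/
def momX (lam ε : ℝ) (w : (Rd d × Rd d) × (ℝ × ℝ)) : Rd d :=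
  (Z.φ (startX lam ε (twoTimeInv Z lam ε w)) w.2.1).2

/-- The momentum of the second characteristic. -/
def momY (lam ε : ℝ) (w : (Rd d × Rd d) × (ℝ × ℝ)) : Rd d :=
  (Z.φ (startY lam (twoTimeInv Z lam ε w)) w.2.2).2

/-- The solution of the doubled equation with separate times for the two variables. -/
def twoTimeSol (lam ε : ℝ) (w : (Rd d × Rd d) × (ℝ × ℝ)) : ℝ :=
  initialDatum lam ε (twoTimeInv Z lam ε w) +
    action Z (startX lam ε (twoTimeInv Z lam ε w)) w.2.1 -
    action Z (startY lam (twoTimeInv Z lam ε w)) w.2.2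

/-- The differential of `twoTimeSol`. -/
def twoTimeSolDeriv (lam ε : ℝ) (w : (Rd d × Rd d) × (ℝ × ℝ)) :
    (Rd d × Rd d) × (ℝ × ℝ) →L[ℝ] ℝ :=
  (innerSL ℝ (momX Z lam ε w)).comp ((ContinuousLinearMap.fst ℝ (Rd d) (Rd d)).comp
      (ContinuousLinearMap.fst ℝ (Rd d × Rd d) (ℝ × ℝ))) -
    (innerSL ℝ (momY Z lam ε w)).comp ((ContinuousLinearMap.snd ℝ (Rd d) (Rd d)).comp
      (ContinuousLinearMap.fst ℝ (Rd d × Rd d) (ℝ × ℝ))) +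
    (H (momX Z lam ε w) + F w.1.1) • ((ContinuousLinearMap.fst ℝ ℝ ℝ).comp
      (ContinuousLinearMap.snd ℝ (Rd d × Rd d) (ℝ × ℝ))) -
    (H (momY Z lam ε w) + F w.1.2) • ((ContinuousLinearMap.snd ℝ ℝ ℝ).comp
      (ContinuousLinearMap.snd ℝ (Rd d × Rd d) (ℝ × ℝ)))

theorem twoTimeSolDeriv_apply (w v : (Rd d × Rd d) × (ℝ × ℝ)) :
    twoTimeSolDeriv Z lam ε w v = inner ℝ (momX Z lam ε w) v.1.1 - inner ℝ (momY Z lam ε w) v.1.2 +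
      (H (momX Z lam ε w) + F w.1.1) * v.2.1 - (H (momY Z lam ε w) + F w.1.2) * v.2.2 := rfl

variable {L : (Rd d × Rd d) ≃L[ℝ] (Rd d × Rd d)} {w : (Rd d × Rd d) × (ℝ × ℝ)}

theorem eventually_mem_timeDomain (hw : w.2 ∈ timeDomain lam τ) :
    ∀ᶠ u : (Rd d × Rd d) × (ℝ × ℝ) in 𝓝 w, u.2 ∈ timeDomain lam τ :=
  continuousAt_snd ((isOpen_timeDomain lam τ).mem_nhds hw)

theorem flow_startX_twoTimeInv (s : ShortTime K lam ε τ δ)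
    (hL : TwoTimeClose Z lam ε τ (1 / 2) L) (hw : w.2 ∈ timeDomain lam τ) :
    (Z.φ (startX lam ε (twoTimeInv Z lam ε w)) w.2.1).1 = w.1.1 :=
  (Prod.ext_iff.1 (twoTimeMap_twoTimeInv Z s hL hw)).1

theorem flow_startY_twoTimeInv (s : ShortTime K lam ε τ δ)
    (hL : TwoTimeClose Z lam ε τ (1 / 2) L) (hw : w.2 ∈ timeDomain lam τ) :
    (Z.φ (startY lam (twoTimeInv Z lam ε w)) w.2.2).1 = w.1.2 :=
  (Prod.ext_iff.1 (twoTimeMap_twoTimeInv Z s hL hw)).2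

/-- The differential of the initial datum cancels the boundary terms of the two actions at time
zero, since the starting momenta are its partial gradients. At the final times the positions are the
given `x` and `y`, so the derivative of `twoTimeInv` drops out altogether. -/
theorem hasFDerivAt_twoTimeSol (h : SeparatedBounds K H F) (s : ShortTime K lam ε τ δ)
    (hL : TwoTimeClose Z lam ε τ (1 / 2) L) (hw : w.2 ∈ timeDomain lam τ) :
    HasFDerivAt (twoTimeSol Z lam ε) (twoTimeSolDeriv Z lam ε w) w := by
  have hinv := ((contDiffAt_twoTimeInv Z h s hL hw).differentiableAt one_ne_zero).hasFDerivAt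
  set D := fderiv ℝ (twoTimeInv Z lam ε) w with hD
  have hX1 : (Z.φ (startX lam ε (twoTimeInv Z lam ε w)) w.2.1).1 = w.1.1 := flow_startX_twoTimeInv Z s hL hw
  have hY1 : (Z.φ (startY lam (twoTimeInv Z lam ε w)) w.2.2).1 = w.1.2 := flow_startY_twoTimeInv Z s hL hw
  have hX : HasFDerivAt (fun w => (Z.φ (startX lam ε (twoTimeInv Z lam ε w)) w.2.1).1)
      ((ContinuousLinearMap.fst ℝ (Rd d) (Rd d)).comp
        (ContinuousLinearMap.fst ℝ (Rd d × Rd d) (ℝ × ℝ))) w := by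
    refine HasFDerivAt.congr_of_eventuallyEq (hasFDerivAt_fst.comp w hasFDerivAt_fst) ?_
    filter_upwards [eventually_mem_timeDomain hw] with u hu
    exact flow_startX_twoTimeInv Z s hL hu
  have hY : HasFDerivAt (fun w => (Z.φ (startY lam (twoTimeInv Z lam ε w)) w.2.2).1)
      ((ContinuousLinearMap.snd ℝ (Rd d) (Rd d)).comp
        (ContinuousLinearMap.fst ℝ (Rd d × Rd d) (ℝ × ℝ))) w := by
    refine HasFDerivAt.congr_of_eventuallyEq (hasFDerivAt_snd.comp w hasFDerivAt_fst) ?_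
    filter_upwards [eventually_mem_timeDomain hw] with u hu
    exact flow_startY_twoTimeInv Z s hL hu
  have ht1 : HasFDerivAt (fun w : (Rd d × Rd d) × (ℝ × ℝ) => w.2.1)
      ((ContinuousLinearMap.fst ℝ ℝ ℝ).comp
        (ContinuousLinearMap.snd ℝ (Rd d × Rd d) (ℝ × ℝ))) w :=
    hasFDerivAt_fst.comp w hasFDerivAt_snd
  have ht2 : HasFDerivAt (fun w : (Rd d × Rd d) × (ℝ × ℝ) => w.2.2)
      ((ContinuousLinearMap.snd ℝ ℝ ℝ).comp
        (ContinuousLinearMap.snd ℝ (Rd d × Rd d) (ℝ × ℝ))) w :=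
    hasFDerivAt_snd.comp w hasFDerivAt_snd
  have hsX := (hasFDerivAt_startX lam ε (twoTimeInv Z lam ε w)).comp w hinv
  have hsY := (hasFDerivAt_startY lam (twoTimeInv Z lam ε w)).comp w hinv
  have h1 := hasFDerivAt_action_comp Z h hsX ht1 (hw.1.trans s.τ_lt) hX
  have h2 := hasFDerivAt_action_comp Z h hsY ht2 (hw.2.1.trans s.τ_lt) hY
  have h0 := (hasFDerivAt_initialDatum lam ε (twoTimeInv Z lam ε w)).comp w hinv
  refine ((h0.add h1).sub h2).congr_fderiv (ContinuousLinearMap.ext fun v => ?_)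
  simp only [Function.comp_apply, hX1, hY1]
  rw [twoTimeSolDeriv_apply]
  simp [momX, momY, startXDeriv, startYDeriv]
  ring

theorem contDiffAt_momX (h : SeparatedBounds K H F) (s : ShortTime K lam ε τ δ)
    (hL : TwoTimeClose Z lam ε τ (1 / 2) L) (hw : w.2 ∈ timeDomain lam τ) :
    ContDiffAt ℝ 1 (momX Z lam ε) w :=
  ((Z.contDiffAt (contDiff_hamField h).continuous
    (z := startX lam ε (twoTimeInv Z lam ε w)) (hw.1.trans s.τ_lt)).comp w
    (f := fun w => (startX lam ε (twoTimeInv Z lam ε w), w.2.1))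
    (((contDiff_startX lam ε).contDiffAt.comp w (contDiffAt_twoTimeInv Z h s hL hw)).prodMk
      (contDiff_fst.comp contDiff_snd).contDiffAt)).snd

theorem contDiffAt_momY (h : SeparatedBounds K H F) (s : ShortTime K lam ε τ δ)
    (hL : TwoTimeClose Z lam ε τ (1 / 2) L) (hw : w.2 ∈ timeDomain lam τ) :
    ContDiffAt ℝ 1 (momY Z lam ε) w :=
  ((Z.contDiffAt (contDiff_hamField h).continuous
    (z := startY lam (twoTimeInv Z lam ε w)) (hw.2.1.trans s.τ_lt)).comp w
    (f := fun w => (startY lam (twoTimeInv Z lam ε w), w.2.2))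
    (((contDiff_startY lam).contDiffAt.comp w (contDiffAt_twoTimeInv Z h s hL hw)).prodMk
      (contDiff_snd.comp contDiff_snd).contDiffAt)).snd

/-- The function is built from `C¹` ingredients, but its differential involves only the momenta and
`H`, `F`, which are again `C¹`; hence one derivative is gained. -/
theorem contDiffAt_twoTimeSol (h : SeparatedBounds K H F) (s : ShortTime K lam ε τ δ)
    (hL : TwoTimeClose Z lam ε τ (1 / 2) L) (hw : w.2 ∈ timeDomain lam τ) :
    ContDiffAt ℝ 2 (twoTimeSol Z lam ε) w := by
  have hH : ContDiff ℝ 1 H := h.contDiff_H.of_le (by norm_num)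
  have hF : ContDiff ℝ 1 F := h.contDiff_F.of_le (by norm_num)
  have hX := contDiffAt_momX Z h s hL hw
  have hY := contDiffAt_momY Z h s hL hw
  refine (contDiffAt_succ_iff_hasFDerivAt (n := 1)).2 ⟨twoTimeSolDeriv Z lam ε,
    ⟨{u | u.2 ∈ timeDomain lam τ}, eventually_mem_timeDomain hw,
      fun u hu => hasFDerivAt_twoTimeSol Z h s hL hu⟩, ?_⟩
  have h1 : ContDiffAt ℝ 1 (fun w : (Rd d × Rd d) × (ℝ × ℝ) => F w.1.1) w :=
    (hF.comp (contDiff_fst.comp contDiff_fst)).contDiffAt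
  have h2 : ContDiffAt ℝ 1 (fun w : (Rd d × Rd d) × (ℝ × ℝ) => F w.1.2) w :=
    (hF.comp (contDiff_snd.comp contDiff_fst)).contDiffAt
  exact (((((innerSL ℝ (E := Rd d)).contDiff.contDiffAt.comp w hX).clm_comp contDiffAt_const).sub
    (((innerSL ℝ (E := Rd d)).contDiff.contDiffAt.comp w hY).clm_comp contDiffAt_const)).add
    (((hH.contDiffAt.comp w hX).add h1).smul contDiffAt_const)).sub
    (((hH.contDiffAt.comp w hY).add h2).smul contDiffAt_const)

theorem zero_mem_timeDomain (hτ : 0 < τ) : (0 : ℝ × ℝ) ∈ timeDomain lam τ := by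
  simp [timeDomain, hτ]

theorem diag_mem_timeDomain {t : ℝ} (ht : |t| < τ) : (t, t) ∈ timeDomain lam τ := by
  have : 0 < τ := (abs_nonneg t).trans_lt ht
  simp [timeDomain, ht, this]

theorem twoTimeSol_zero (s : ShortTime K lam ε τ δ) (hL : TwoTimeClose Z lam ε τ (1 / 2) L)
    (q : Rd d × Rd d) : twoTimeSol Z lam ε (q, 0) = initialDatum lam ε q := by
  have h1 := twoTimeMap_twoTimeInv Z s hL (w := (q, 0)) (zero_mem_timeDomain s.τ_pos)
  have h2 : twoTimeInv Z lam ε (q, 0) = q := by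
    have h3 : ∀ q' : Rd d × Rd d, twoTimeMap Z lam ε 0 0 q' = q' := fun q' => by
      simp [twoTimeMap, Z.init, startX, startY]
    exact (h3 _).symm.trans h1
  simp [twoTimeSol, h2, action_zero]

/-- The starting points of two characteristics ending at distance `|x - y|`. -/
theorem norm_twoTimeInv_sub_le (h : SeparatedBounds K H F) (s : ShortTime K lam ε τ δ)
    (hL : TwoTimeClose Z lam ε τ (1 / 2) L) (hw : w.2 ∈ timeDomain lam τ) :
    ‖(twoTimeInv Z lam ε w).1 - (twoTimeInv Z lam ε w).2‖ ≤ ‖w.1.1 - w.1.2‖ + 1 := by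
  set q := twoTimeInv Z lam ε w with hq
  have hX1 : (Z.φ (startX lam ε q) w.2.1).1 = w.1.1 := flow_startX_twoTimeInv Z s hL hw
  have hY1 : (Z.φ (startY lam q) w.2.2).1 = w.1.2 := flow_startY_twoTimeInv Z s hL hw
  have h1 := (norm_fst_le _).trans (norm_flow_sub_le_time Z h (startX lam ε q) 0 w.2.1)
  have h2 := (norm_fst_le _).trans (norm_flow_sub_le_time Z h (startY lam q) 0 w.2.2)
  rw [Z.init, sub_zero, Prod.fst_sub, hX1] at h1
  rw [Z.init, sub_zero, Prod.fst_sub, hY1] at h2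
  simp only [startX] at h1
  simp only [startY] at h2
  have h3 : q.1 - q.2 = (w.1.1 - w.1.2) - (w.1.1 - q.1) + (w.1.2 - q.2) := by abel
  have hK := s.one_le_K
  have h4 : K * |w.2.1| ≤ K * τ := by gcongr; exact hw.1.le
  have h5 : K * |w.2.2| ≤ K * τ := by gcongr; exact hw.2.1.le
  rw [h3]
  linarith [norm_add_le ((w.1.1 - w.1.2) - (w.1.1 - q.1)) (w.1.2 - q.2),
    norm_sub_le (w.1.1 - w.1.2) (w.1.1 - q.1), s.K_mul_τ]

theorem norm_momX_le (h : SeparatedBounds K H F) (s : ShortTime K lam ε τ δ)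
    (hL : TwoTimeClose Z lam ε τ (1 / 2) L) (hw : w.2 ∈ timeDomain lam τ) :
    ‖momX Z lam ε w‖ ≤ lam * (‖w.1.1 - w.1.2‖ + 1) + 2 := by
  have h1 := norm_P_sub_le Z h s (twoTimeInv Z lam ε w) hw.1.le
  have h2 := norm_twoTimeInv_sub_le Z h s hL hw
  have h3 := norm_le_norm_add_norm_sub' (momX Z lam ε w)
    (lam • ((twoTimeInv Z lam ε w).1 - (twoTimeInv Z lam ε w).2))
  rw [norm_smul, Real.norm_of_nonneg s.lam_pos.le] at h3
  have h4 := mul_le_mul_of_nonneg_left h2 s.lam_pos.le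
  exact h3.trans (add_le_add h4 h1)

/-- For these times the distance of the starting points is controlled by that of the endpoints, and
the flow is `2`-Lipschitz. The bound does not involve `λ`, which is what makes the cost of a restart
`λ`-independent. -/
theorem norm_momX_sub_momY_le (h : SeparatedBounds K H F) (s : ShortTime K lam ε τ δ)
    (hL : TwoTimeClose Z lam ε τ (1 / 2) L) (q : Rd d × Rd d) {t : ℝ} (ht : |t| < τ) :
    ‖momX Z lam ε (q, (t, t)) - momY Z lam ε (q, (t, t))‖ ≤ 6 * (‖q.1 - q.2‖ + ε) := by
  have hw : ((q, (t, t)) : (Rd d × Rd d) × (ℝ × ℝ)).2 ∈ timeDomain lam τ := diag_mem_timeDomain ht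
  set q₀ := twoTimeInv Z lam ε (q, (t, t)) with hq
  have hX1 : (Z.φ (startX lam ε q₀) t).1 = q.1 := flow_startX_twoTimeInv Z s hL hw
  have hY1 : (Z.φ (startY lam q₀) t).1 = q.2 := flow_startY_twoTimeInv Z s hL hw
  have key := norm_sub_le_of_hasDerivAt_abs_le (T := τ) (s := 0) (t := t)
    (C := K * (2 * (‖q₀.1 - q₀.2‖ + ε)))
    (f := fun t => (Z.φ (startX lam ε q₀) t).1 - (Z.φ (startY lam q₀) t).1)
    (fun t _ => (hasDerivAt_flow_fst Z (startX lam ε q₀) t).sub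
      (hasDerivAt_flow_fst Z (startY lam q₀) t))
    (fun t ht => by
      rw [neg_sub_neg, norm_sub_rev]
      exact (h.norm_gradH_sub_le _ _).trans
        (mul_le_mul_of_nonneg_left ((norm_snd_le _).trans (norm_X_sub_Y_le Z h s q₀ ht))
        h.K_nonneg)) (by simpa using s.τ_pos.le) ht.le
  simp only [Z.init, sub_zero] at key
  rw [hX1, hY1] at key
  simp only [startX, startY] at key
  have h3 := norm_le_norm_add_norm_sub (q.1 - q.2) (q₀.1 - q₀.2)
  have h4 : K * (2 * (‖q₀.1 - q₀.2‖ + ε)) * |t| ≤ (‖q₀.1 - q₀.2‖ + ε) / 4 := by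
    have := s.K_mul_τ
    have h5 : K * |t| ≤ 1 / 8 := by nlinarith [s.one_le_K]
    have h6 : 0 ≤ ‖q₀.1 - q₀.2‖ + ε := add_nonneg (norm_nonneg _) s.ε_nonneg
    nlinarith
  have h5 := (norm_snd_le _).trans (norm_X_sub_Y_le Z h s q₀ ht.le)
  refine h5.trans ?_
  linarith [s.ε_nonneg, norm_nonneg (q.1 - q.2)]

theorem hasDerivAt_twoTimeSol_fst (h : SeparatedBounds K H F) (s : ShortTime K lam ε τ δ)
    (hL : TwoTimeClose Z lam ε τ (1 / 2) L) (q : Rd d × Rd d) {a b : ℝ}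
    (hab : (a, b) ∈ timeDomain lam τ) :
    HasDerivAt (fun a => twoTimeSol Z lam ε (q, (a, b)))
      (H (momX Z lam ε (q, (a, b))) + F q.1) a := by
  have h1 := hasFDerivAt_twoTimeSol Z h s hL (w := (q, (a, b))) hab
  have h2 : HasDerivAt (fun a : ℝ => (q, (a, b))) ((0 : Rd d × Rd d), ((1 : ℝ), (0 : ℝ))) a :=
    (hasDerivAt_const a q).prodMk ((hasDerivAt_id a).prodMk (hasDerivAt_const a b))
  refine (h1.comp_hasDerivAt a h2).congr_deriv ?_
  rw [twoTimeSolDeriv_apply]; simp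

theorem hasDerivAt_twoTimeSol_snd (h : SeparatedBounds K H F) (s : ShortTime K lam ε τ δ)
    (hL : TwoTimeClose Z lam ε τ (1 / 2) L) (q : Rd d × Rd d) {a b : ℝ}
    (hab : (a, b) ∈ timeDomain lam τ) :
    HasDerivAt (fun b => twoTimeSol Z lam ε (q, (a, b)))
      (-(H (momY Z lam ε (q, (a, b))) + F q.2)) b := by
  have h1 := hasFDerivAt_twoTimeSol Z h s hL (w := (q, (a, b))) hab
  have h2 : HasDerivAt (fun b : ℝ => (q, (a, b))) ((0 : Rd d × Rd d), ((0 : ℝ), (1 : ℝ))) b :=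
    (hasDerivAt_const b q).prodMk ((hasDerivAt_const b a).prodMk (hasDerivAt_id b))
  refine (h1.comp_hasDerivAt b h2).congr_deriv ?_
  rw [twoTimeSolDeriv_apply]; simp

theorem hasDerivAt_twoTimeSol_diag (h : SeparatedBounds K H F) (s : ShortTime K lam ε τ δ)
    (hL : TwoTimeClose Z lam ε τ (1 / 2) L) (q : Rd d × Rd d) {t : ℝ} (ht : |t| < τ) :
    HasDerivAt (fun t => twoTimeSol Z lam ε (q, (t, t)))
      (H (momX Z lam ε (q, (t, t))) + F q.1 - (H (momY Z lam ε (q, (t, t))) + F q.2)) t := by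
  have h1 := hasFDerivAt_twoTimeSol Z h s hL (w := (q, (t, t))) (diag_mem_timeDomain ht)
  have h2 : HasDerivAt (fun t : ℝ => (q, (t, t))) ((0 : Rd d × Rd d), ((1 : ℝ), (1 : ℝ))) t :=
    (hasDerivAt_const t q).prodMk ((hasDerivAt_id t).prodMk (hasDerivAt_id t))
  refine (h1.comp_hasDerivAt t h2).congr_deriv ?_
  rw [twoTimeSolDeriv_apply]; simp

theorem hasGradientAt_twoTimeSol_fst (h : SeparatedBounds K H F) (s : ShortTime K lam ε τ δ)
    (hL : TwoTimeClose Z lam ε τ (1 / 2) L) (x y : Rd d) {p : ℝ × ℝ} (hp : p ∈ timeDomain lam τ) :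
    HasGradientAt (fun x => twoTimeSol Z lam ε ((x, y), p)) (momX Z lam ε ((x, y), p)) x := by
  have h1 := hasFDerivAt_twoTimeSol Z h s hL (w := ((x, y), p)) hp
  have h2 : HasFDerivAt (fun x : Rd d => ((x, y), p))
      (((ContinuousLinearMap.id ℝ (Rd d)).prod 0).prod 0) x :=
    ((hasFDerivAt_id x).prodMk (hasFDerivAt_const y x)).prodMk (hasFDerivAt_const p x)
  rw [hasGradientAt_iff_hasFDerivAt]
  refine (h1.comp x h2).congr_fderiv (ContinuousLinearMap.ext fun v => ?_)
  simp [twoTimeSolDeriv_apply]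

theorem hasGradientAt_twoTimeSol_snd (h : SeparatedBounds K H F) (s : ShortTime K lam ε τ δ)
    (hL : TwoTimeClose Z lam ε τ (1 / 2) L) (x y : Rd d) {p : ℝ × ℝ} (hp : p ∈ timeDomain lam τ) :
    HasGradientAt (fun y => twoTimeSol Z lam ε ((x, y), p)) (-momY Z lam ε ((x, y), p)) y := by
  have h1 := hasFDerivAt_twoTimeSol Z h s hL (w := ((x, y), p)) hp
  have h2 : HasFDerivAt (fun y : Rd d => ((x, y), p))
      (((0 : Rd d →L[ℝ] Rd d).prod (ContinuousLinearMap.id ℝ (Rd d))).prod 0) y :=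
    ((hasFDerivAt_const x y).prodMk (hasFDerivAt_id y)).prodMk (hasFDerivAt_const p y)
  rw [hasGradientAt_iff_hasFDerivAt]
  refine (h1.comp y h2).congr_fderiv (ContinuousLinearMap.ext fun v => ?_)
  simp [twoTimeSolDeriv_apply]

/-- The solution stays close to its initial datum. -/
theorem abs_twoTimeSol_sub_le (h : SeparatedBounds K H F) (s : ShortTime K lam ε τ δ)
    (hL : TwoTimeClose Z lam ε τ (1 / 2) L) (q : Rd d × Rd d) {t : ℝ} (ht : |t| < τ) :
    |twoTimeSol Z lam ε (q, (t, t)) - initialDatum lam ε q| ≤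
      7 * K * (‖q.1 - q.2‖ + ε) * |t| := by
  have key := norm_sub_le_of_hasDerivAt_abs_le (T := |t|) (s := 0) (t := t)
    (C := 7 * K * (‖q.1 - q.2‖ + ε))
    (fun r hr => hasDerivAt_twoTimeSol_diag Z h s hL q (hr.trans_lt ht)) (fun r hr => ?_)
    (by simp) le_rfl
  · rw [sub_zero, show ((0 : ℝ), (0 : ℝ)) = 0 from rfl, twoTimeSol_zero Z s hL] at key
    exact key
  -- The `7` is `6` from the `H` difference plus `1` from the `F` difference.
  · have h1 := norm_momX_sub_momY_le Z h s hL q (hr.trans_lt ht)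
    have h2 := h.abs_H_sub_le (momX Z lam ε (q, (r, r))) (momY Z lam ε (q, (r, r)))
    have h3 := h.abs_F_sub_le q.1 q.2
    rw [Real.norm_eq_abs, add_sub_add_comm]
    have hK := h.K_nonneg
    have h4 := mul_le_mul_of_nonneg_left h1 hK
    have h5 := mul_nonneg hK s.ε_nonneg
    refine (abs_add_le _ _).trans ?_
    linarith

/-- The two-time solution is coercive for nearby times. -/
theorem exists_le_twoTimeSol (h : SeparatedBounds K H F) (s : ShortTime K lam ε τ δ)
    (hL : TwoTimeClose Z lam ε τ (1 / 2) L) :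
    ∃ C : ℝ, ∀ w : (Rd d × Rd d) × (ℝ × ℝ), w.2 ∈ timeDomain lam τ →
      2 * K * |w.2.1 - w.2.2| ≤ ε →
      lam / 4 * ‖w.1.1 - w.1.2‖ ^ 2 + ε / 2 * ‖w.1.1‖ - C ≤ twoTimeSol Z lam ε w := by
  have hlam := s.lam_pos
  have hK := s.one_le_K
  set A := |H 0| + |F 0| + K * (lam + 2) with hA
  set B := 7 * K + K * lam with hB
  refine ⟨A + 7 * K + B ^ 2 / lam, ?_⟩
  rintro ⟨⟨x, y⟩, ⟨a, b⟩⟩ hab hε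
  simp only at hab hε ⊢
  set r := ‖x - y‖ with hr
  have hr0 : 0 ≤ r := norm_nonneg _
  have hab1 : |a - b| ≤ 1 := by
    have h1 := hab.2.2
    simp only at h1
    have h2 : |a - b| ≤ (1 + lam) * |a - b| := by
      have := mul_nonneg hlam.le (abs_nonneg (a - b)); linarith
    nlinarith [s.τ_le_one, s.τ_pos]
  -- At equal times `(b, b)` the solution is close to its datum. Moving the first time from `b` to
  -- `a` costs up to `K‖x‖ |a - b|`, because `F` may grow linearly; half of the tilt `ε‖x‖` absorbs
  -- this when `2K|a - b| ≤ ε`. Terms linear in `r` are absorbed by a quarter of `λr²`.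
  have h1 := abs_twoTimeSol_sub_le Z h s hL (x, y) hab.2.1
  simp only at h1
  have hcb : ∀ c ∈ uIcc b a, |c - b| ≤ |a - b| ∧ (c, b) ∈ timeDomain lam τ := fun c hc => by
    have h2 := abs_sub_left_of_mem_uIcc hc
    refine ⟨h2, ?_, hab.2.1, ?_⟩
    · have h3 := hab.1
      have h4 := hab.2.1
      simp only [abs_lt] at h3 h4 ⊢
      rcases le_total a b with h5 | h5
      · rw [uIcc_of_ge h5] at hc; constructor <;> linarith [hc.1, hc.2]
      · rw [uIcc_of_le h5] at hc; constructor <;> linarith [hc.1, hc.2]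
    · refine lt_of_le_of_lt ?_ hab.2.2
      simp only
      gcongr
  have h2 : |twoTimeSol Z lam ε ((x, y), (a, b)) - twoTimeSol Z lam ε ((x, y), (b, b))| ≤
      (A + K * lam * r + K * ‖x‖) * |a - b| := by
    refine (convex_uIcc b a).norm_image_sub_le_of_norm_hasDerivWithin_le
      (f := fun a => twoTimeSol Z lam ε ((x, y), (a, b)))
      (fun c hc => (hasDerivAt_twoTimeSol_fst Z h s hL (x, y) (hcb c hc).2).hasDerivWithinAt)
      (fun c hc => ?_) left_mem_uIcc right_mem_uIcc
    have h3 := norm_momX_le Z h s hL (w := ((x, y), (c, b))) (hcb c hc).2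
    have h4 := h.abs_H_sub_le (momX Z lam ε ((x, y), (c, b))) 0
    have h5 := h.abs_F_sub_le x 0
    rw [sub_zero] at h4 h5
    have h6 := abs_sub_abs_le_abs_sub (H (momX Z lam ε ((x, y), (c, b)))) (H 0)
    have h7 := abs_sub_abs_le_abs_sub (F x) (F 0)
    have h8 := mul_le_mul_of_nonneg_left h3 (by linarith : (0 : ℝ) ≤ K)
    simp only [← hr] at h8
    rw [Real.norm_eq_abs]
    refine (abs_add_le _ _).trans ?_
    simp only
    linarith
  have h3 : (A + K * lam * r + K * ‖x‖) * |a - b| ≤ A + K * lam * r + ε / 2 * ‖x‖ := by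
    have h4 : (A + K * lam * r) * |a - b| ≤ (A + K * lam * r) * 1 := by
      gcongr
    have h5 : K * |a - b| * ‖x‖ ≤ ε / 2 * ‖x‖ := by gcongr; linarith
    linarith
  have h4 : 7 * K * (r + ε) * |b| ≤ 7 * K * r + 7 * K := by
    have hb : |b| ≤ 1 := hab.2.1.le.trans s.τ_le_one
    have := s.ε_nonneg
    have hεb : ε * |b| ≤ 1 * 1 := by gcongr; exact s.ε_le_one
    have hrb : r * |b| ≤ r * 1 := by gcongr
    nlinarith
  have h5 : initialDatum lam ε (x, y) ≥ lam / 2 * r ^ 2 + ε * ‖x‖ := by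
    have := mul_le_mul_of_nonneg_left (norm_le_bracket x) s.ε_nonneg
    simp only [initialDatum, ← hr]; linarith
  have h6 : B * r ≤ lam / 4 * r ^ 2 + B ^ 2 / lam := by
    have h7 : 0 ≤ (lam * r / 2 - B) ^ 2 / lam := by positivity
    have h8 : (lam * r / 2 - B) ^ 2 / lam = lam / 4 * r ^ 2 - B * r + B ^ 2 / lam := by
      field_simp; ring
    linarith
  have h7 := (abs_le.1 h1).1
  have h8 := (abs_le.1 h2).1
  linarith
end

/-! ### Existence time and Jacobian for the doubled equation. -/

noncomputable section
open Filter Topology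

variable {d : ℕ} {H F : Rd d → ℝ} {K lam ε τ δ θ : ℝ}

/-- Continuity of the determinant at the identity; the radius `θ` is the only source of the
dependence of the final constant on `d`. -/
theorem exists_abs_det_sub_one_lt (E : Type*) [NormedAddCommGroup E] [NormedSpace ℝ E]
    [FiniteDimensional ℝ E] : ∃ θ : ℝ, 0 < θ ∧ θ ≤ 1 / 2 ∧
      ∀ A : E →L[ℝ] E, ‖A - ContinuousLinearMap.id ℝ E‖ ≤ θ → |A.det - 1| < 1 / 2 := by
  have hc : Continuous (fun A : E →L[ℝ] E => A.det) := ContinuousLinearMap.continuous_det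
  obtain ⟨η, hη, hball⟩ := Metric.continuousAt_iff.1
    (hc.continuousAt (x := ContinuousLinearMap.id ℝ E)) (1 / 2) (by norm_num)
  refine ⟨min (η / 2) (1 / 2), by positivity, min_le_right _ _, fun A hA => ?_⟩
  have h1 : dist A (ContinuousLinearMap.id ℝ E) < η := by
    rw [dist_eq_norm]
    exact (hA.trans (min_le_left _ _)).trans_lt (by linarith)
  have h2 := hball h1
  have h3 : (ContinuousLinearMap.id ℝ E).det = 1 := by
    simp [ContinuousLinearMap.det]
  rwa [h3, Real.dist_eq] at h2

theorem det_conj_continuousLinearEquiv {E : Type*} [NormedAddCommGroup E] [NormedSpace ℝ E]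
    (M : E →L[ℝ] E) (L : E ≃L[ℝ] E) :
    ((L : E →L[ℝ] E).comp (M.comp (L.symm : E →L[ℝ] E))).det = M.det := by
  exact LinearMap.det_conj (M : E →ₗ[ℝ] E) L.toLinearEquiv

theorem SeparatedBounds.nonempty_C1Flow (h : SeparatedBounds K H F) :
    Nonempty (C1Flow (hamField H F) (2 * (K + 1))⁻¹) := by
  have h1 := _root_.nonempty_C1Flow (lipschitzWith_hamField h) (L := K.toNNReal)
    (fun z => (norm_hamField_le h z).trans (Real.le_coe_toNNReal K)) (contDiff_hamField h)
  rwa [Real.coe_toNNReal K h.K_nonneg] at h1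

/-- With `c = θ / (104K³)` the target is `(2c)²`, while `τ ≤ c` and `λτ³ ≤ c³` give `τ² + λτ³ ≤ c² +
c³ ≤ 2c²`; hence `104` in place of `52`. -/
theorem shortTime_of_le (hK : 1 ≤ K) (hθ : 0 < θ) (hθ1 : θ ≤ 1 / 2) (hτ : 0 < τ)
    (hτc : τ ≤ θ / (104 * K ^ 3)) (hlam : 0 < lam) (hlamτ : lam * τ ^ 3 ≤ (θ / (104 * K ^ 3)) ^ 3)
    (hε : 0 ≤ ε) (hετ : ε ≤ τ ^ 2) :
    ShortTime K lam ε τ (2 * (K + 1))⁻¹ ∧ τ ^ 2 + lam * τ ^ 3 ≤ (θ / (52 * K ^ 3)) ^ 2 := by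
  have hK0 : 0 < K := by linarith
  set c := θ / (104 * K ^ 3) with hc
  have hc2 : θ / (52 * K ^ 3) = 2 * c := by rw [hc]; field_simp; norm_num
  have hK3 : K ≤ K ^ 3 := le_self_pow₀ hK (by norm_num)
  have hKc : 208 * K * c ≤ 1 := by
    have h1 : 104 * K ^ 3 * c = θ := by rw [hc]; field_simp
    have hc0 : 0 < c := by positivity
    nlinarith
  have hc0 : 0 < c := by positivity
  have hc1 : c ≤ 1 := by nlinarith
  have hKτ : K * τ ≤ K * c := by gcongr
  refine ⟨⟨hK, hlam, hτ, by linarith, hε, hετ, ?_⟩, ?_⟩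
  · rw [lt_inv_comm₀ hτ (by positivity), ← one_div, lt_div_iff₀ hτ]
    nlinarith
  · rw [hc2]
    have h1 : τ ^ 2 ≤ c ^ 2 := by gcongr
    have h2 : c ^ 3 ≤ c ^ 2 := pow_le_pow_of_le_one hc0.le hc1 (by norm_num)
    nlinarith

theorem mul_min_one_rpow_cube_le (hlam : 0 < lam) : lam * (min 1 (lam ^ (-(1 / 3) : ℝ))) ^ 3 ≤ 1 := by
  have h1 : (lam ^ (-(1 / 3) : ℝ)) ^ 3 = lam⁻¹ := by
    rw [← Real.rpow_natCast, ← Real.rpow_mul hlam.le, ← Real.rpow_neg_one]; norm_num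
  have h2 : (min 1 (lam ^ (-(1 / 3) : ℝ))) ^ 3 ≤ (lam ^ (-(1 / 3) : ℝ)) ^ 3 := by
    gcongr; exact min_le_right _ _
  calc _ ≤ lam * (lam ^ (-(1 / 3) : ℝ)) ^ 3 := by gcongr
    _ = 1 := by rw [h1, mul_inv_cancel₀ hlam.ne']

theorem gradient_separatedHamiltonian_left (p x : Rd d) :
    ∇ (fun p => separatedHamiltonian H F p x) p = ∇ H p := by
  simp [gradient, separatedHamiltonian]

theorem gradient_separatedHamiltonian_right (p x : Rd d) :
    ∇ (fun x => separatedHamiltonian H F p x) x = ∇ F x := by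
  simp [gradient, separatedHamiltonian]

theorem exists_isDoubledCharacteristicFlow (Z : C1Flow (hamField H F) δ) (lam : ℝ) :
    ∃ X Y P Q : Rd d → Rd d → ℝ → Rd d,
      IsDoubledCharacteristicFlow (separatedHamiltonian H F) lam X Y P Q := by
  refine ⟨fun x y t => (Z.φ (startX lam 0 (x, y)) t).1, fun x y t => (Z.φ (startY lam (x, y)) t).1,
    fun x y t => (Z.φ (startX lam 0 (x, y)) t).2, fun x y t => (Z.φ (startY lam (x, y)) t).2,
    fun x y t => ?_, fun x y t => ?_, fun x y t => ?_, fun x y t => ?_, fun x y => ?_, fun x y => ?_,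
    fun x y => ?_, fun x y => ?_⟩
  · rw [gradient_separatedHamiltonian_left]; exact hasDerivAt_flow_fst Z _ t
  · rw [gradient_separatedHamiltonian_left]; exact hasDerivAt_flow_fst Z _ t
  · rw [gradient_separatedHamiltonian_right]; exact hasDerivAt_flow_snd Z _ t
  · rw [gradient_separatedHamiltonian_right]; exact hasDerivAt_flow_snd Z _ t
  all_goals simp [Z.init, startX, startY]

/-- The characteristics are unique. -/
theorem IsDoubledCharacteristicFlow.flowMap_eq {X Y P Q : Rd d → Rd d → ℝ → Rd d}
    (hX : IsDoubledCharacteristicFlow (separatedHamiltonian H F) lam X Y P Q)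
    (h : SeparatedBounds K H F) (Z : C1Flow (hamField H F) δ) (t : ℝ) :
    flowMap X Y t = twoTimeMap Z lam 0 t t := by
  funext z
  have uniq : ∀ (ζ : ℝ → Rd d × Rd d) (z₀ : Rd d × Rd d),
      (∀ t, HasDerivAt ζ (hamField H F (ζ t)) t) → ζ 0 = z₀ → ζ = Z.φ z₀ := fun ζ z₀ h1 h2 =>
    ODE_solution_unique_univ (v := fun _ => hamField H F) (s := fun _ => univ) (t₀ := 0)
      (fun _ => (lipschitzWith_hamField h).lipschitzOnWith) (fun t => ⟨h1 t, trivial⟩)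
      (fun t => ⟨Z.deriv _ t, trivial⟩) (by rw [h2, Z.init])
  have h1 := uniq (fun t => (X z.1 z.2 t, P z.1 z.2 t)) (startX lam 0 z) (fun t => by
      have e1 := hX.deriv_X z.1 z.2 t
      have e2 := hX.deriv_P z.1 z.2 t
      rw [gradient_separatedHamiltonian_left] at e1
      rw [gradient_separatedHamiltonian_right] at e2
      exact e1.prodMk e2) (by simp [hX.init_X, hX.init_P, startX])
  have h2 := uniq (fun t => (Y z.1 z.2 t, Q z.1 z.2 t)) (startY lam z) (fun t => by
      have e1 := hX.deriv_Y z.1 z.2 t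
      have e2 := hX.deriv_Q z.1 z.2 t
      rw [gradient_separatedHamiltonian_left] at e1
      rw [gradient_separatedHamiltonian_right] at e2
      exact e1.prodMk e2) (by simp [hX.init_Y, hX.init_Q, startY])
  have e1 := congrFun h1 t
  have e2 := congrFun h2 t
  rw [twoTimeMap, ← e1, ← e2]; rfl

theorem contDiff_twoTimeMap (h : SeparatedBounds K H F) (Z : C1Flow (hamField H F) δ) (hδ : 0 < δ)
    (lam ε t : ℝ) : ContDiff ℝ 1 (twoTimeMap Z lam ε t t) :=
  (contDiff_fst.comp ((Z.contDiff_time hδ (lipschitzWith_hamField h) t).comp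
    (contDiff_startX lam ε))).prodMk
  (contDiff_fst.comp ((Z.contDiff_time hδ (lipschitzWith_hamField h) t).comp
    (contDiff_startY lam)))

theorem abs_det_twoTimeDeriv_sub_one_lt {Z : C1Flow (hamField H F) δ}
    {L : (Rd d × Rd d) ≃L[ℝ] (Rd d × Rd d)} (hL : TwoTimeClose Z lam ε τ θ L)
    (hθ : ∀ A : (Rd d × Rd d) →L[ℝ] (Rd d × Rd d),
      ‖A - ContinuousLinearMap.id ℝ _‖ ≤ θ → |A.det - 1| < 1 / 2)
    {t : ℝ} (ht : |t| ≤ τ) (q : Rd d × Rd d) : |(twoTimeDeriv Z lam ε t t q).det - 1| < 1 / 2 := by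
  rw [← det_conj_continuousLinearEquiv _ L]
  exact hθ _ (hL t t ht ht (by simpa using sq_nonneg τ) q)

theorem isSmoothDoubledSolution_twoTimeSol (Z : C1Flow (hamField H F) δ)
    (h : SeparatedBounds K H F) (s : ShortTime K lam 0 τ δ)
    {L : (Rd d × Rd d) ≃L[ℝ] (Rd d × Rd d)} (hL : TwoTimeClose Z lam 0 τ (1 / 2) L) :
    IsSmoothDoubledSolution (separatedHamiltonian H F) lam τ
      (fun x y t => twoTimeSol Z lam 0 ((x, y), (t, t))) where
  contDiffOn := by
    rintro ⟨x, y, t⟩ ⟨-, -, ht⟩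
    have h1 := contDiffAt_twoTimeSol Z h s hL (w := ((x, y), (t, t)))
      (diag_mem_timeDomain (abs_lt.2 ht))
    refine ContDiffAt.contDiffWithinAt ?_
    refine h1.comp (x, y, t) (f := fun z : Rd d × Rd d × ℝ => ((z.1, z.2.1), (z.2.2, z.2.2))) ?_
    exact ((contDiff_fst.prodMk (contDiff_fst.comp contDiff_snd)).prodMk
      ((contDiff_snd.comp contDiff_snd).prodMk (contDiff_snd.comp contDiff_snd))).contDiffAt
  equation x y t ht := by
    have hd := diag_mem_timeDomain (lam := lam) (abs_lt.2 ht)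
    rw [(hasGradientAt_twoTimeSol_fst Z h s hL x y hd).gradient,
      (hasGradientAt_twoTimeSol_snd Z h s hL x y hd).gradient, neg_neg]
    exact hasDerivAt_twoTimeSol_diag Z h s hL (x, y) (abs_lt.2 ht)
  init x y := by
    have := twoTimeSol_zero Z s hL (x, y)
    simpa [initialDatum] using! this

/-- The lower bound for the time of existence in the doubled equation. -/
theorem exists_doubled_time (d : ℕ) (K : ℝ) :
    ∃ c : ℝ, 0 < c ∧ ∀ H F : Rd d → ℝ, SeparatedBounds K H F → ∀ lam : ℝ, 0 < lam →
      (∃ X Y P Q : Rd d → Rd d → ℝ → Rd d,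
        IsDoubledCharacteristicFlow (separatedHamiltonian H F) lam X Y P Q) ∧
      (∀ X Y P Q : Rd d → Rd d → ℝ → Rd d,
        IsDoubledCharacteristicFlow (separatedHamiltonian H F) lam X Y P Q →
        (∀ t : ℝ, ContDiff ℝ 1 (flowMap X Y t)) ∧
        ∀ (x y : Rd d) (tlam : ℝ),
          IsLeast {t : ℝ | 0 < t ∧ flowJacobian X Y x y t = 1 / 2} tlam →
          c * min 1 (lam ^ (-(1 / 3) : ℝ)) ≤ tlam) ∧
      ∃ U : Rd d → Rd d → ℝ → ℝ,
        IsSmoothDoubledSolution (separatedHamiltonian H F) lam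
          (c * min 1 (lam ^ (-(1 / 3) : ℝ))) U := by
  obtain ⟨θ, hθ0, hθ1, hθ⟩ := exists_abs_det_sub_one_lt (Rd d × Rd d)
  set K' := max K 1 with hK'
  have hK1 : 1 ≤ K' := le_max_right _ _
  set c := θ / (104 * K' ^ 3) with hc
  have hc0 : 0 < c := by positivity
  refine ⟨c, hc0, fun H F h₀ lam hlam => ?_⟩
  have h := h₀.mono (le_max_left K 1)
  obtain ⟨Z⟩ := h.nonempty_C1Flow
  set m := min 1 (lam ^ (-(1 / 3) : ℝ)) with hm
  have hm0 : 0 < m := lt_min one_pos (Real.rpow_pos_of_pos hlam _)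
  have hmτ : lam * (c * m) ^ 3 ≤ c ^ 3 := by
    have := mul_le_mul_of_nonneg_left (mul_min_one_rpow_cube_le hlam) (pow_pos hc0 3).le
    rw [mul_pow]; linarith
  have hτ0 : 0 < c * m := mul_pos hc0 hm0
  obtain ⟨s, hs⟩ := shortTime_of_le (ε := 0) hK1 hθ0 hθ1 hτ0
    (mul_le_of_le_one_right hc0.le (min_le_left _ _)) hlam hmτ le_rfl (sq_nonneg _)
  obtain ⟨L, hL⟩ := exists_twoTimeClose Z h s hθ0 (by linarith) hs
  -- The same coordinates serve twice: `θ`-closeness controls the determinant, `1/2`-closeness the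
  -- bijectivity.
  have hL2 : TwoTimeClose Z lam 0 (c * m) (1 / 2) L := fun a b ha hb hab q =>
    (hL a b ha hb hab q).trans hθ1
  refine ⟨exists_isDoubledCharacteristicFlow Z lam, fun X Y P Q hX => ⟨fun t => ?_,
    fun x y t ht => ?_⟩, _, isSmoothDoubledSolution_twoTimeSol Z h s hL2⟩
  · rw [hX.flowMap_eq h Z]
    exact contDiff_twoTimeMap h Z (by positivity) _ _ _
  -- Up to time `c * m` the determinant differs from `1` by strictly less than `1/2`, so it cannot
  -- equal `1/2`.
  · by_contra! hlt
    obtain ⟨ht0, htJ⟩ := ht.1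
    have htabs : |t| ≤ c * m := by rw [abs_of_pos ht0]; exact hlt.le
    have htδ : |t| < (2 * (K' + 1))⁻¹ := htabs.trans_lt s.τ_lt
    rw [flowJacobian, hX.flowMap_eq h Z,
      (hasFDerivAt_twoTimeMap Z lam 0 htδ htδ (x, y)).fderiv] at htJ
    have := abs_det_twoTimeDeriv_sub_one_lt hL hθ htabs (x, y)
    rw [htJ] at this
    norm_num [abs_lt] at this
end

/-! ### Doubling the time variable, and two-time solutions as test functions. -/

noncomputable section
open Filter Topology

/-- Maximum points of a function with doubled time variable, penalized off the diagonal and by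
an increasing function of time, lie in the interior of the time interval. -/
theorem exists_max_doubled_time {E : Type*} [NormedAddCommGroup E] [ProperSpace E]
    {W : E × (ℝ × ℝ) → ℝ} {t₀ t₁ t₂ ρ m M : ℝ} {D : Set (ℝ × ℝ)}
    (hD : D = {p | (p.1 ∈ Icc t₀ t₂ ∧ p.2 ∈ Icc t₀ t₂) ∧ |p.1 - p.2| ≤ ρ})
    (h01 : t₀ < t₁) (h12 : t₁ ≤ t₂) (hρ : 0 < ρ) (hW : ContinuousOn W (univ ×ˢ D))
    (hM : ∀ q, ∀ p ∈ D, W (q, p) ≤ M)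
    (hcoer : ∀ c, ∃ R, ∀ q, ∀ p ∈ D, c ≤ W (q, p) → ‖q‖ ≤ R)
    (h0 : ∀ q, W (q, (t₀, t₀)) ≤ m) {q₁ : E} (h1 : m < W (q₁, (t₁, t₁))) :
    ∃ (ψ : ℝ → ℝ) (n : ℝ) (q : E) (t s : ℝ), ContDiff ℝ 1 ψ ∧ (∀ t, 0 < deriv ψ t) ∧
      t ∈ Ioc t₀ t₂ ∧ s ∈ Ioc t₀ t₂ ∧ |t - s| < ρ ∧ (t₁ < t₂ → t < t₂ ∧ s < t₂) ∧
      ∀ q', ∀ p ∈ D, W (q', p) - ψ p.1 - n * (p.1 - p.2) ^ 2 ≤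
        W (q, (t, s)) - ψ t - n * (t - s) ^ 2 := by
  have hdiag : ∀ t ∈ Icc t₀ t₂, (t, t) ∈ D := fun t ht => by
    rw [hD]; exact ⟨⟨ht, ht⟩, by simpa using hρ.le⟩
  set δ := (W (q₁, (t₁, t₁)) - m) / 2 with hδ
  have hδ0 : 0 < δ := by simp only [hδ]; linarith
  have hMm : 0 < M - m + 1 := by linarith [hM q₁ _ (hdiag t₁ ⟨h01.le, h12⟩)]
  obtain ⟨R, hR⟩ := hcoer (m + δ)
  have hDc : IsCompact D := by
    rw [hD]
    exact (isCompact_Icc.prod isCompact_Icc).inter_right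
      (isClosed_le (continuous_fst.sub continuous_snd).abs continuous_const)
  have hKc : IsCompact (Metric.closedBall (0 : E) R ×ˢ D) := (isCompact_closedBall 0 R).prod hDc
  have hWK : ContinuousOn W (Metric.closedBall (0 : E) R ×ˢ D) :=
    hW.mono (prod_mono_left (subset_univ _))
  obtain ⟨ρ', hρ', hunif⟩ := Metric.uniformContinuousOn_iff.1
    (hKc.uniformContinuousOn_of_continuous hWK) δ hδ0
  -- If there is room beyond `t₁`, the penalty `δ exp(A(t - t₁))` is made larger than `M - m` near
  -- `t₂`, which excludes maxima there, while at `t₁` it costs only `δ`. If `t₁ = t₂`, maxima at the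
  -- final time are allowed.
  obtain ⟨A, ρ₁, hA, hρ₁, hρ₁ρ, hρ₁ρ', hend⟩ : ∃ A ρ₁ : ℝ, 0 < A ∧ 0 < ρ₁ ∧ ρ₁ ≤ ρ ∧ ρ₁ ≤ ρ' ∧
      (t₁ < t₂ → ∀ t, t₂ - ρ₁ ≤ t → M - m + 1 ≤ δ * Real.exp (A * (t - t₁))) := by
    rcases h12.lt_or_eq with hlt | heq
    · have h2 : 0 < t₂ - t₁ := by linarith
      refine ⟨2 * (M - m + 1) / (δ * (t₂ - t₁)), min (min ρ ρ') ((t₂ - t₁) / 2), by positivity,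
        by positivity, (min_le_left _ _).trans (min_le_left _ _),
        (min_le_left _ _).trans (min_le_right _ _), fun _ t ht => ?_⟩
      have h3 : (t₂ - t₁) / 2 ≤ t - t₁ := by
        linarith [min_le_right (min ρ ρ') ((t₂ - t₁) / 2)]
      calc M - m + 1 = δ * (2 * (M - m + 1) / (δ * (t₂ - t₁)) * ((t₂ - t₁) / 2)) := by
            field_simp
        _ ≤ δ * (2 * (M - m + 1) / (δ * (t₂ - t₁)) * (t - t₁)) := by gcongr
        _ ≤ _ := by
          gcongr
          linarith [Real.add_one_le_exp (2 * (M - m + 1) / (δ * (t₂ - t₁)) * (t - t₁))]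
    · exact ⟨1, min ρ ρ', one_pos, lt_min hρ hρ', min_le_left _ _, min_le_right _ _,
        fun h => absurd heq h.ne⟩
  set ψ : ℝ → ℝ := fun t => δ * Real.exp (A * (t - t₁)) with hψ
  have hψ0 : ∀ t, 0 < ψ t := fun t => by positivity
  have hψd : ∀ t, HasDerivAt ψ (δ * (Real.exp (A * (t - t₁)) * (A * 1))) t := fun t =>
    ((((hasDerivAt_id t).sub_const t₁).const_mul A).exp).const_mul δ
  have hψc : ContDiff ℝ 1 ψ := by fun_prop
  -- At time distance `ρ₁` or more the penalty alone exceeds `M - m`, which forces `|t - s| < ρ₁` at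
  -- the maximum.
  set n := (M - m + 1) / ρ₁ ^ 2 with hn
  have hn0 : 0 < n := by positivity
  set G : E × (ℝ × ℝ) → ℝ := fun z => W z - ψ z.2.1 - n * (z.2.1 - z.2.2) ^ 2 with hG
  have hG1 : G (q₁, (t₁, t₁)) = m + δ := by
    simp only [hG, hψ, sub_self, mul_zero, Real.exp_zero]; rw [hδ]; ring
  have hGW : ∀ z, G z ≤ W z := fun z => by
    have := hψ0 z.2.1
    have := mul_nonneg hn0.le (sq_nonneg (z.2.1 - z.2.2))
    simp only [hG]; linarith
  have hq₁ : (q₁, (t₁, t₁)) ∈ Metric.closedBall (0 : E) R ×ˢ D :=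
    ⟨mem_closedBall_zero_iff.2 (hR _ _ (hdiag t₁ ⟨h01.le, h12⟩) (hG1.ge.trans (hGW _))),
      hdiag t₁ ⟨h01.le, h12⟩⟩
  have hGc : ContinuousOn G (Metric.closedBall (0 : E) R ×ˢ D) := by
    refine (hWK.sub ?_).sub ?_
    · exact (hψc.continuous.comp (continuous_fst.comp continuous_snd)).continuousOn
    · fun_prop
  obtain ⟨⟨q, t, s⟩, hmem, hmax⟩ := hKc.exists_isMaxOn ⟨_, hq₁⟩ hGc
  have hGmax : m + δ ≤ G (q, (t, s)) := hG1 ▸ hmax hq₁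
  have hmemD := hmem.2
  simp only at hmemD
  have hts : (t ∈ Icc t₀ t₂ ∧ s ∈ Icc t₀ t₂) ∧ |t - s| ≤ ρ := by rw [hD] at hmemD; exact hmemD
  obtain ⟨⟨ht, hs⟩, -⟩ := hts
  have hWM := hM q (t, s) hmemD
  have hψt := hψ0 t
  simp only [hG] at hGmax
  have hclose : |t - s| < ρ₁ := by
    by_contra! hcon
    have h2 : ρ₁ ^ 2 ≤ (t - s) ^ 2 := by rw [← sq_abs (t - s)]; gcongr
    have h3 : n * ρ₁ ^ 2 = M - m + 1 := by rw [hn]; field_simp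
    nlinarith
  have hpen := mul_nonneg hn0.le (sq_nonneg (t - s))
  -- If `t` or `s` equalled `t₀`, then `(t₀, t₀)` would be within `ρ'` of `(t, s)`, and this would
  -- contradict the bound `m` at the initial time.
  have hfar : ∀ p ∈ D, dist (t, s) p < ρ' → m < W (q, p) := fun p hp hd => by
    have := hunif (q, (t, s)) hmem (q, p) ⟨hmem.1, hp⟩ (by
      rw [Prod.dist_eq]; simpa using hd)
    rw [Real.dist_eq, abs_lt] at this
    linarith
  have ht₀ : (t₀, t₀) ∈ D := hdiag t₀ ⟨le_rfl, by linarith⟩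
  refine ⟨ψ, n, q, t, s, hψc, fun t => ?_, ⟨ht.1.lt_of_ne ?_, ht.2⟩, ⟨hs.1.lt_of_ne ?_, hs.2⟩,
    hclose.trans_le hρ₁ρ, fun hlt => ⟨ht.2.lt_of_ne ?_, hs.2.lt_of_ne ?_⟩, fun q' p hp => ?_⟩
  · rw [(hψd t).deriv]; positivity
  · rintro rfl
    refine (hfar _ ht₀ ?_).not_ge (h0 q)
    rw [Prod.dist_eq]
    simpa [Real.dist_eq, abs_sub_comm s, hρ'] using hclose.trans_le hρ₁ρ'
  · rintro rfl
    refine (hfar _ ht₀ ?_).not_ge (h0 q)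
    rw [Prod.dist_eq]
    simpa [Real.dist_eq, hρ'] using hclose.trans_le hρ₁ρ'
  · rintro rfl
    have := hend hlt t (by linarith)
    simp only [hψ] at hGmax
    linarith
  · rintro rfl
    have := hend hlt t (by linarith [(abs_lt.1 hclose).1])
    simp only [hψ] at hGmax
    linarith
  · by_cases hq' : ‖q'‖ ≤ R
    · exact hmax (show (q', p) ∈ _ from ⟨mem_closedBall_zero_iff.2 hq', hp⟩)
    · have h2 : W (q', p) < m + δ := by
        by_contra! hcon
        exact hq' (hR q' p hp hcon)
      exact ((hGW (q', p)).trans h2.le).trans hGmax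

variable {d : ℕ} {H F : Rd d → ℝ} {K lam ε τ δ : ℝ} {Z : C1Flow (hamField H F) δ}
  {L : (Rd d × Rd d) ≃L[ℝ] (Rd d × Rd d)}

theorem exists_shift_mem {s : Set (ℝ × ℝ)} (hs : IsOpen s) {a b : ℝ} (h : (a, b) ∈ s) :
    ∃ τ' > 0, ∀ σ, |σ| < τ' → (a + σ, b) ∈ s ∧ (a, b + σ) ∈ s := by
  have h1 : ∀ᶠ σ : ℝ in 𝓝 0, (a + σ, b) ∈ s :=
    (Continuous.tendsto' (f := fun σ : ℝ => (a + σ, b)) (by fun_prop) 0 (a, b) (by simp)).eventually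
      (hs.mem_nhds h)
  have h2 : ∀ᶠ σ : ℝ in 𝓝 0, (a, b + σ) ∈ s :=
    (Continuous.tendsto' (f := fun σ : ℝ => (a, b + σ)) (by fun_prop) 0 (a, b) (by simp)).eventually
      (hs.mem_nhds h)
  obtain ⟨τ', hτ', h3⟩ := Metric.eventually_nhds_iff.1 (h1.and h2)
  exact ⟨τ', hτ', fun σ hσ => h3 (by simpa using hσ)⟩

/-- With `y` and the second time frozen, the function of `(x, a)` solves the single equation. The
separate times serve exactly this purpose. -/
theorem isSmoothSolution_twoTimeSol_fst (h : SeparatedBounds K H F) (s : ShortTime K lam ε τ δ)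
    (hL : TwoTimeClose Z lam ε τ (1 / 2) L) (y : Rd d) {a b τ' : ℝ}
    (hσ : ∀ σ, |σ| < τ' → (a + σ, b) ∈ timeDomain lam τ) :
    IsSmoothSolution (separatedHamiltonian H F) τ'
      (fun x σ => twoTimeSol Z lam ε ((x, y), (a + σ, b))) where
  contDiffOn := by
    rintro ⟨x, σ⟩ ⟨-, hσ'⟩
    have h1 := contDiffAt_twoTimeSol Z h s hL (w := ((x, y), (a + σ, b))) (hσ σ (abs_lt.2 hσ'))
    refine (h1.comp (x, σ) (f := fun z : Rd d × ℝ => ((z.1, y), (a + z.2, b))) ?_).contDiffWithinAt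
    exact ((contDiff_fst.prodMk contDiff_const).prodMk
      ((contDiff_const.add contDiff_snd).prodMk contDiff_const)).contDiffAt
  equation x σ hσ' := by
    have hd := hσ σ (abs_lt.2 hσ')
    rw [(hasGradientAt_twoTimeSol_fst Z h s hL x y hd).gradient]
    exact (hasDerivAt_twoTimeSol_fst Z h s hL (x, y) hd).comp_const_add a σ

theorem isSmoothSolution_neg_twoTimeSol_snd (h : SeparatedBounds K H F)
    (s : ShortTime K lam ε τ δ) (hL : TwoTimeClose Z lam ε τ (1 / 2) L) (x : Rd d) {a b τ' : ℝ}
    (hσ : ∀ σ, |σ| < τ' → (a, b + σ) ∈ timeDomain lam τ) :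
    IsSmoothSolution (separatedHamiltonian H F) τ'
      (fun y σ => -twoTimeSol Z lam ε ((x, y), (a, b + σ))) where
  contDiffOn := by
    rintro ⟨y, σ⟩ ⟨-, hσ'⟩
    have h1 := contDiffAt_twoTimeSol Z h s hL (w := ((x, y), (a, b + σ))) (hσ σ (abs_lt.2 hσ'))
    refine (h1.comp (y, σ) (f := fun z : Rd d × ℝ => ((x, z.1), (a, b + z.2))) ?_).neg.contDiffWithinAt
    exact ((contDiff_const.prodMk contDiff_fst).prodMk
      (contDiff_const.prodMk (contDiff_const.add contDiff_snd))).contDiffAt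
  equation y σ hσ' := by
    have hd := hσ σ (abs_lt.2 hσ')
    have hg : HasGradientAt (fun y => -twoTimeSol Z lam ε ((x, y), (a, b + σ)))
        (momY Z lam ε ((x, y), (a, b + σ))) y := by
      have := (hasGradientAt_twoTimeSol_snd Z h s hL x y hd).hasFDerivAt.neg
      rw [hasGradientAt_iff_hasFDerivAt]
      exact this.congr_fderiv (by simp)
    rw [hg.gradient]
    simpa [separatedHamiltonian] using!
      ((hasDerivAt_twoTimeSol_snd Z h s hL (x, y) hd).comp_const_add b σ).neg

/-- Properties that hold near a positive time hold in a symmetric interval, inside which a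
continuous path has small oscillation. -/
theorem exists_symm_interval {B : ℝ → ℝ} (hB : ContinuousOn B (Ici 0)) {t τ' : ℝ} (ht : 0 < t)
    (hτ' : 0 < τ') {p : ℝ → Prop} (hp : ∀ᶠ r in 𝓝 t, p r) :
    ∃ η, 0 < η ∧ η ≤ t ∧ ∀ r ∈ Ioo (t - η) (t + η), |B r - B t| < τ' ∧ p r := by
  have h1 : ∀ᶠ r in 𝓝 t, |B r - B t| < τ' :=
    Metric.continuousAt_iff'.1 (hB.continuousAt (Ici_mem_nhds ht)) τ' hτ'
  obtain ⟨η, hη, h2⟩ := Metric.eventually_nhds_iff.1 (h1.and hp)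
  refine ⟨min η t, lt_min hη ht, min_le_right _ _, fun r hr => h2 ?_⟩
  rw [Real.dist_eq, abs_lt]
  constructor <;> linarith [hr.1, hr.2, min_le_left η t]

/-- Two-time solutions as test functions for subsolutions. -/
theorem IsPathwiseSubsolution.deriv_nonpos {B : ℝ → ℝ} {T : ℝ} {u : Rd d → ℝ → ℝ}
    (hu : IsPathwiseSubsolution (separatedHamiltonian H F) B T u) (hB : ContinuousOn B (Ici 0))
    (h : SeparatedBounds K H F) (s : ShortTime K lam ε τ δ)
    (hL : TwoTimeClose Z lam ε τ (1 / 2) L) {x y : Rd d} {t b c : ℝ} (ht : t ∈ Ioc 0 T)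
    (hd : (B t - c, b) ∈ timeDomain lam τ) {ψ : ℝ → ℝ} (hψ : ContDiff ℝ 1 ψ)
    (hmax : ∀ᶠ r in 𝓝 t, r ≤ T → ∀ x', u x' r - twoTimeSol Z lam ε ((x', y), (B r - c, b)) - ψ r ≤
      u x t - twoTimeSol Z lam ε ((x, y), (B t - c, b)) - ψ t) : deriv ψ t ≤ 0 := by
  obtain ⟨τ', hτ', hσ⟩ := exists_shift_mem (isOpen_timeDomain lam τ) hd
  obtain ⟨η, hη, hηt, hI⟩ := exists_symm_interval hB ht.1 hτ' hmax
  refine hu.2 x t η (fun x r => twoTimeSol Z lam ε ((x, y), (B t - c + (B r - B t), b))) ψ ht hη hηt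
    ⟨τ', _, hτ', isSmoothSolution_twoTimeSol_fst h s hL y fun σ h' => (hσ σ h').1,
      fun r hr => ⟨(hI r hr).1, fun x => rfl⟩⟩ hψ.contDiffOn ?_
  rintro ⟨x', r⟩ ⟨-, hr, hrT⟩
  have h1 := (hI r hr).2 hrT x'
  have h2 : B t - c + (B r - B t) = B r - c := by ring
  simpa [h2] using! h1

/-- Two-time solutions as test functions for supersolutions. -/
theorem IsPathwiseSupersolution.deriv_nonneg {B : ℝ → ℝ} {T : ℝ} {v : Rd d → ℝ → ℝ}
    (hv : IsPathwiseSupersolution (separatedHamiltonian H F) B T v) (hB : ContinuousOn B (Ici 0))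
    (h : SeparatedBounds K H F) (s : ShortTime K lam ε τ δ)
    (hL : TwoTimeClose Z lam ε τ (1 / 2) L) {x y : Rd d} {t a c : ℝ} (ht : t ∈ Ioc 0 T)
    (hd : (a, B t - c) ∈ timeDomain lam τ) {ψ : ℝ → ℝ} (hψ : ContDiff ℝ 1 ψ)
    (hmin : ∀ᶠ r in 𝓝 t, r ≤ T → ∀ y', v y t + twoTimeSol Z lam ε ((x, y), (a, B t - c)) - ψ t ≤
      v y' r + twoTimeSol Z lam ε ((x, y'), (a, B r - c)) - ψ r) : 0 ≤ deriv ψ t := by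
  obtain ⟨τ', hτ', hσ⟩ := exists_shift_mem (isOpen_timeDomain lam τ) hd
  obtain ⟨η, hη, hηt, hI⟩ := exists_symm_interval hB ht.1 hτ' hmin
  refine hv.2 y t η (fun y r => -twoTimeSol Z lam ε ((x, y), (a, B t - c + (B r - B t)))) ψ ht hη hηt
    ⟨τ', _, hτ', isSmoothSolution_neg_twoTimeSol_snd h s hL x fun σ h' => (hσ σ h').2,
      fun r hr => ⟨(hI r hr).1, fun x => rfl⟩⟩ hψ.contDiffOn ?_
  rintro ⟨y', r⟩ ⟨-, hr, hrT⟩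
  have h1 := (hI r hr).2 hrT y'
  have h2 : B t - c + (B r - B t) = B r - c := by ring
  simpa [h2] using! h1
end

/-! ### Comparison over one time step. -/

noncomputable section
open Filter Topology

variable {d : ℕ} {H F : Rd d → ℝ} {K lam ε τ δ : ℝ} {Z : C1Flow (hamField H F) δ}
  {L : (Rd d × Rd d) ≃L[ℝ] (Rd d × Rd d)}

/-- Close times lie in the domain of the two-time solution. -/
theorem exists_forall_mem_timeDomain {B : ℝ → ℝ} {c t₀ t₂ : ℝ} (hB : ContinuousOn B (Icc t₀ t₂))
    (hBτ : ∀ r ∈ Icc t₀ t₂, |B r - c| < τ) (hlam : 0 < lam) (hK : 0 < K) (hτ : 0 < τ) (hε : 0 < ε) :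
    ∃ ρ > 0, ∀ r ∈ Icc t₀ t₂, ∀ r' ∈ Icc t₀ t₂, |r - r'| ≤ ρ →
      (B r - c, B r' - c) ∈ timeDomain lam τ ∧ 2 * K * |(B r - c) - (B r' - c)| ≤ ε := by
  set η := min (τ ^ 2 / (1 + lam)) (ε / (2 * K)) with hη
  have hη0 : 0 < η := by positivity
  obtain ⟨ρ, hρ, hunif⟩ := Metric.uniformContinuousOn_iff.1
    (isCompact_Icc.uniformContinuousOn_of_continuous hB) η hη0
  refine ⟨ρ / 2, half_pos hρ, fun r hr r' hr' hrr => ?_⟩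
  have h1 := hunif r hr r' hr' (by rw [Real.dist_eq]; linarith)
  rw [Real.dist_eq] at h1
  have h2 := (lt_div_iff₀' (by linarith)).1 (h1.trans_le (min_le_left _ _))
  have h3 := (lt_div_iff₀' (by linarith)).1 (h1.trans_le (min_le_right _ _))
  have h4 : (B r - c) - (B r' - c) = B r - B r' := by ring
  exact ⟨⟨hBτ r hr, hBτ r' hr', by simpa only [h4] using h2⟩, by rw [h4]; exact h3.le⟩

/-- A time interval beyond `t₁` in which the path stays close to its value at `t₁`. -/
theorem exists_end_time {B : ℝ → ℝ} (hB : ContinuousOn B (Ici 0)) {t₀ t₁ T : ℝ} (h0 : 0 ≤ t₀)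
    (h01 : t₀ < t₁) (h1T : t₁ ≤ T) (hτ : 0 < τ) (hBτ : ∀ r ∈ Icc t₀ t₁, |B r - B t₁| < τ) :
    ∃ t₂, t₁ ≤ t₂ ∧ t₂ ≤ T ∧ (t₂ < T → t₁ < t₂) ∧ ∀ r ∈ Icc t₀ t₂, |B r - B t₁| < τ := by
  obtain ⟨η, hη, -, hI⟩ := exists_symm_interval hB (h0.trans_lt h01) hτ
    (p := fun _ => True) (Eventually.of_forall fun _ => trivial)
  refine ⟨min T (t₁ + η / 2), le_min h1T (by linarith), min_le_left _ _, fun h => ?_,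
    fun r hr => ?_⟩
  · rcases min_lt_iff.1 h with h2 | h2
    · exact absurd h2 (lt_irrefl _)
    · rw [min_eq_right h2.le]; linarith
  · rcases le_total r t₁ with h2 | h2
    · exact hBτ r ⟨hr.1, h2⟩
    · exact (hI r ⟨by linarith, by linarith [hr.2.trans (min_le_right _ _)]⟩).1

theorem IsBUC.continuousOn {T : ℝ} {u : Rd d → ℝ → ℝ} (hu : IsBUC T u) :
    ContinuousOn (fun z : Rd d × ℝ => u z.1 z.2) (univ ×ˢ Icc 0 T) := hu.2.continuousOn

/-- Subtracting a solution of the doubled equation preserves upper bounds. -/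
theorem sub_sub_initialDatum_le {B : ℝ → ℝ} {T : ℝ} {u v : Rd d → ℝ → ℝ}
    (hu : IsPathwiseSubsolution (separatedHamiltonian H F) B T u)
    (hv : IsPathwiseSupersolution (separatedHamiltonian H F) B T v) (hB : ContinuousOn B (Ici 0))
    (h : SeparatedBounds K H F) (s : ShortTime K lam ε τ δ)
    (hL : TwoTimeClose Z lam ε τ (1 / 2) L) (hε : 0 < ε) {t₀ t₁ m : ℝ} (h0 : 0 ≤ t₀)
    (h01 : t₀ < t₁) (h1T : t₁ ≤ T) (hBτ : ∀ r ∈ Icc t₀ t₁, |B r - B t₁| < τ)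
    (hm : ∀ q : Rd d × Rd d, u q.1 t₀ - v q.2 t₀ -
      twoTimeSol Z lam ε (q, (B t₀ - B t₁, B t₀ - B t₁)) ≤ m) (q : Rd d × Rd d) :
    u q.1 t₁ - v q.2 t₁ - initialDatum lam ε q ≤ m := by
  by_contra! hcon
  obtain ⟨t₂, h12, h2T, hend, hBτ2⟩ := exists_end_time hB h0 h01 h1T s.τ_pos hBτ
  have hlam := s.lam_pos
  obtain ⟨ρ, hρ, hdom⟩ := exists_forall_mem_timeDomain (K := K)
    (hB.mono fun r hr => h0.trans hr.1) hBτ2 hlam (by linarith [s.one_le_K]) s.τ_pos hε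
  obtain ⟨C, hC⟩ := exists_le_twoTimeSol Z h s hL
  obtain ⟨Mu, hMu⟩ := hu.1.1
  obtain ⟨Mv, hMv⟩ := hv.1.1
  -- The clock of the two-time solution is set to zero at `t₁`, so that the explicit datum appears
  -- at the end of the step and the evolved function at its beginning.
  set W : (Rd d × Rd d) × (ℝ × ℝ) → ℝ := fun z => u z.1.1 z.2.1 - v z.1.2 z.2.2 -
    twoTimeSol Z lam ε (z.1, (B z.2.1 - B t₁, B z.2.2 - B t₁)) with hW
  set D : Set (ℝ × ℝ) := {p | (p.1 ∈ Icc t₀ t₂ ∧ p.2 ∈ Icc t₀ t₂) ∧ |p.1 - p.2| ≤ ρ} with hD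
  have hsub : ∀ r ∈ Icc t₀ t₂, r ∈ Icc 0 T := fun r hr => ⟨h0.trans hr.1, hr.2.trans h2T⟩
  have hbound : ∀ q, ∀ p ∈ D, W (q, p) ≤
      Mu + Mv + C - lam / 4 * ‖q.1 - q.2‖ ^ 2 - ε / 2 * ‖q.1‖ := fun q p hp => by
    have h1 := hdom p.1 hp.1.1 p.2 hp.1.2 hp.2
    have h2 := hC (q, (B p.1 - B t₁, B p.2 - B t₁)) h1.1 h1.2
    have h3 := (abs_le.1 (hMu q.1 p.1 (hsub _ hp.1.1))).2
    have h4 := (abs_le.1 (hMv q.2 p.2 (hsub _ hp.1.2))).1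
    simp only [hW] at h2 ⊢
    linarith
  have hWc : ContinuousOn W (univ ×ˢ D) := by
    refine ContinuousOn.sub (ContinuousOn.sub ?_ ?_) ?_
    · exact hu.1.continuousOn.comp (f := fun z : (Rd d × Rd d) × (ℝ × ℝ) => (z.1.1, z.2.1))
        (by fun_prop) fun z hz => ⟨trivial, hsub _ hz.2.1.1⟩
    · exact hv.1.continuousOn.comp (f := fun z : (Rd d × Rd d) × (ℝ × ℝ) => (z.1.2, z.2.2))
        (by fun_prop) fun z hz => ⟨trivial, hsub _ hz.2.1.2⟩
    · have hB1 : ContinuousOn (fun z : (Rd d × Rd d) × (ℝ × ℝ) => B z.2.1) (univ ×ˢ D) :=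
        hB.comp (by fun_prop) fun z hz => (hsub _ hz.2.1.1).1
      have hB2 : ContinuousOn (fun z : (Rd d × Rd d) × (ℝ × ℝ) => B z.2.2) (univ ×ˢ D) :=
        hB.comp (by fun_prop) fun z hz => (hsub _ hz.2.1.2).1
      have hpair : ContinuousOn (fun z : (Rd d × Rd d) × (ℝ × ℝ) =>
          (z.1, (B z.2.1 - B t₁, B z.2.2 - B t₁))) (univ ×ˢ D) :=
        continuousOn_fst.prodMk ((hB1.sub continuousOn_const).prodMk (hB2.sub continuousOn_const))
      intro z hz
      exact (contDiffAt_twoTimeSol Z h s hL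
        (w := (z.1, (B z.2.1 - B t₁, B z.2.2 - B t₁)))
        (hdom _ hz.2.1.1 _ hz.2.1.2 hz.2.2).1).continuousAt.comp_continuousWithinAt
          (f := fun z : (Rd d × Rd d) × (ℝ × ℝ) => (z.1, (B z.2.1 - B t₁, B z.2.2 - B t₁))) (hpair z hz)
  have hcoer : ∀ c, ∃ R, ∀ q, ∀ p ∈ D, c ≤ W (q, p) → ‖q‖ ≤ R := fun c => by
    set A := Mu + Mv + C - c with hA
    refine ⟨2 * A / ε + (4 * A / lam + 1), fun q p hp hc => ?_⟩
    have h1 := hbound q p hp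
    have h2 : 0 ≤ ε / 2 * ‖q.1‖ := by positivity
    have h3 : 0 ≤ lam / 4 * ‖q.1 - q.2‖ ^ 2 := by positivity
    have h4 : ‖q.1‖ ≤ 2 * A / ε := by rw [le_div_iff₀ hε]; linarith
    have h5 : ‖q.1 - q.2‖ ^ 2 ≤ 4 * A / lam := by rw [le_div_iff₀ hlam]; linarith
    have h6 : ‖q.1 - q.2‖ ≤ 4 * A / lam + 1 := by nlinarith [sq_nonneg (‖q.1 - q.2‖ - 1)]
    have h7 : ‖q.2‖ ≤ ‖q.1‖ + ‖q.1 - q.2‖ := norm_le_insert _ _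
    have := norm_nonneg (q.1 - q.2)
    exact max_le (by linarith) (by linarith)
  have hM : ∀ q, ∀ p ∈ D, W (q, p) ≤ Mu + Mv + C := fun q p hp => by
    have h1 := hbound q p hp
    have h2 : 0 ≤ ε / 2 * ‖q.1‖ := by positivity
    have h3 : 0 ≤ lam / 4 * ‖q.1 - q.2‖ ^ 2 := by positivity
    linarith
  obtain ⟨ψ, n, ⟨x, y⟩, t, r, hψ, hψ', ht, hr, htr, hlt, hmax⟩ :=
    exists_max_doubled_time hD h01 h12 hρ hWc hM hcoer hm (q₁ := q) (by
      simp only [hW, sub_self]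
      rw [show ((0 : ℝ), (0 : ℝ)) = 0 from rfl, twoTimeSol_zero Z s hL]
      exact hcon)
  have hev : ∀ t ∈ Ioc t₀ t₂, (t₁ < t₂ → t < t₂) → ∀ᶠ r' in 𝓝 t, r' ≤ T → r' ∈ Icc t₀ t₂ := by
    intro t ht hlt
    have h1 : ∀ᶠ r' in 𝓝 t, t₀ < r' := eventually_gt_nhds ht.1
    rcases h2T.lt_or_eq with h2 | h2
    · filter_upwards [h1, eventually_lt_nhds (hlt (hend h2))] with r' h3 h4 _
      exact ⟨h3.le, h4.le⟩
    · filter_upwards [h1] with r' h3 h4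
      exact ⟨h3.le, h2 ▸ h4⟩
  have htI : t ∈ Icc t₀ t₂ := ⟨ht.1.le, ht.2⟩
  have hrI : r ∈ Icc t₀ t₂ := ⟨hr.1.le, hr.2⟩
  have hd := (hdom t htI r hrI htr.le).1
  have hψu : ∀ t', HasDerivAt (fun t' => ψ t' + n * (t' - r) ^ 2)
      (deriv ψ t' + n * (2 * (t' - r))) t' := fun t' => by
    have h1 := (((hasDerivAt_id t').sub_const r).pow 2).const_mul n
    simpa using! ((hψ.differentiable one_ne_zero t').hasDerivAt).add h1
  have hψv : HasDerivAt (fun r' => -(n * (t - r') ^ 2)) (n * (2 * (t - r))) r := by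
    have h1 := ((((hasDerivAt_id r).const_sub t).pow 2).const_mul n).neg
    simpa using! h1
  -- At the maximum, freezing `(y, r)` tests `u` and freezing `(x, t)` tests `v`. The quadratic
  -- penalty contributes `2n(t - r)` to both derivatives, so the two inequalities leave `ψ' ≤ 0`,
  -- contrary to the choice of `ψ`.
  have hsubs := hu.deriv_nonpos hB h s hL (x := x) (y := y) (ψ := fun t' => ψ t' + n * (t' - r) ^ 2)
    ⟨h0.trans_lt ht.1, ht.2.trans h2T⟩ hd (by fun_prop) (by
      have h1 : ∀ᶠ t' in 𝓝 t, |t' - r| < ρ :=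
        (Continuous.tendsto (by fun_prop) t).eventually_lt_const htr
      filter_upwards [hev t ht fun h => (hlt h).1, h1] with t' h2 h3 h4 x'
      have := hmax (x', y) (t', r) ⟨⟨h2 h4, hrI⟩, h3.le⟩
      simp only [hW] at this
      linarith)
  have hsupers := hv.deriv_nonneg hB h s hL (x := x) (y := y) (ψ := fun r' => -(n * (t - r') ^ 2))
    ⟨h0.trans_lt hr.1, hr.2.trans h2T⟩ hd (by fun_prop) (by
      have h1 : ∀ᶠ r' in 𝓝 r, |t - r'| < ρ :=
        (Continuous.tendsto (by fun_prop) r).eventually_lt_const htr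
      filter_upwards [hev r hr fun h => (hlt h).2, h1] with r' h2 h3 h4 y'
      have := hmax (x, y') (t, r') ⟨⟨htI, h2 h4⟩, h3.le⟩
      simp only [hW] at this
      linarith)
  rw [(hψu t).deriv] at hsubs
  rw [hψv.deriv] at hsupers
  linarith [hψ' t]

/-- Propagation of the doubled difference over one time step. -/
theorem sub_sub_sq_le_of_step {B : ℝ → ℝ} {T : ℝ} {u v : Rd d → ℝ → ℝ}
    (hu : IsPathwiseSubsolution (separatedHamiltonian H F) B T u)
    (hv : IsPathwiseSupersolution (separatedHamiltonian H F) B T v) (hB : ContinuousOn B (Ici 0))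
    (h : SeparatedBounds K H F) (Z : C1Flow (hamField H F) δ)
    (hs : ∀ ε, 0 ≤ ε → ε ≤ τ ^ 2 → ShortTime K lam ε τ δ)
    (hτ : τ ^ 2 + lam * τ ^ 3 ≤ (1 / 2 / (52 * K ^ 3)) ^ 2) {t₀ t₁ m : ℝ} (h0 : 0 ≤ t₀)
    (h01 : t₀ < t₁) (h1T : t₁ ≤ T) (hBτ : ∀ r ∈ Icc t₀ t₁, |B r - B t₁| < τ)
    (hm : ∀ x y, u x t₀ - v y t₀ - lam / 2 * ‖x - y‖ ^ 2 + 7 * K * |B t₀ - B t₁| * ‖x - y‖ ≤ m)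
    (x y : Rd d) : u x t₁ - v y t₁ - lam / 2 * ‖x - y‖ ^ 2 ≤ m := by
  have hτ0 := (hs 0 le_rfl (sq_nonneg _)).τ_pos
  -- At `t₀` the tilt has a favourable sign and is discarded; at `t₁` it is evaluated at the fixed
  -- point `x` and vanishes as `ε → 0`.
  have key : ∀ ε, 0 < ε → ε ≤ τ ^ 2 → u x t₁ - v y t₁ - lam / 2 * ‖x - y‖ ^ 2 ≤
      m + (7 * K * |B t₀ - B t₁| + bracket x) * ε := fun ε hε hετ => by
    have s := hs ε hε.le hετ
    obtain ⟨L, hL⟩ := exists_twoTimeClose Z h s one_half_pos (by norm_num) hτ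
    have h1 := sub_sub_initialDatum_le hu hv hB h s hL hε h0 h01 h1T hBτ
      (m := m + 7 * K * |B t₀ - B t₁| * ε) (fun q => by
        have h2 := abs_twoTimeSol_sub_le Z h s hL q (hBτ t₀ ⟨le_rfl, h01.le⟩)
        have h3 := (abs_le.1 h2).1
        have h4 := hm q.1 q.2
        have h5 : 0 ≤ ε * bracket q.1 := mul_nonneg hε.le (bracket_pos _).le
        simp only [initialDatum] at h3
        linarith) (x, y)
    simp only [initialDatum] at h1
    linarith
  have hlim : Tendsto (fun ε : ℝ => m + (7 * K * |B t₀ - B t₁| + bracket x) * ε) (𝓝[>] 0) (𝓝 m) := by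
    refine tendsto_nhdsWithin_of_tendsto_nhds (Continuous.tendsto' (by fun_prop) 0 m (by simp))
  refine ge_of_tendsto hlim ?_
  filter_upwards [Ioc_mem_nhdsGT (sq_pos_of_pos hτ0)] with ε hε
  exact key ε hε.1 hε.2
end

/-! ### Iteration along a Hölder path, and the comparison principle. -/

noncomputable section
open Filter Topology

variable {d : ℕ} {H F : Rd d → ℝ} {K T : ℝ} {B : ℝ → ℝ} {u v : Rd d → ℝ → ℝ}

/-- Uniform continuity handles `|x - y| < r₀`; beyond that the difference is at most `2M`, which `λ
r₀² / 4` dominates for large `λ`. -/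
theorem IsBUC.exists_sub_le_max (hu : IsBUC T u) {η : ℝ} (hη : 0 < η) :
    ∃ Λ, ∀ lam, Λ ≤ lam → ∀ t ∈ Icc 0 T, ∀ x y,
      u x t - u y t ≤ max η (lam / 4 * ‖x - y‖ ^ 2) := by
  obtain ⟨M, hM⟩ := hu.1
  obtain ⟨r₀, hr₀, hunif⟩ := Metric.uniformContinuousOn_iff.1 hu.2 η hη
  refine ⟨max 0 (8 * M / r₀ ^ 2), fun lam hlam t ht x y => ?_⟩
  rcases lt_or_ge ‖x - y‖ r₀ with h | h
  · have h1 := hunif (x, t) ⟨trivial, ht⟩ (y, t) ⟨trivial, ht⟩ (by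
      rw [Prod.dist_eq]; simpa [dist_eq_norm] using h)
    rw [Real.dist_eq] at h1
    exact le_max_of_le_left ((le_abs_self _).trans h1.le)
  · refine le_max_of_le_right ?_
    have h1 := (div_le_iff₀ (by positivity)).1 ((le_max_right _ _).trans hlam)
    have h2 : lam * r₀ ^ 2 ≤ lam * ‖x - y‖ ^ 2 := by
      have := (le_max_left _ _).trans hlam
      gcongr
    linarith [(abs_le.1 (hM x t ht)).2, (abs_le.1 (hM y t ht)).1]

/-- The cost of adding a small multiple of the distance to the penalization. -/
theorem sub_sub_sq_add_le {a b c lam r η m C : ℝ} (hlam : 0 < lam) (hr : 0 ≤ r) (hη : 0 < η)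
    (hab : a - b ≤ max (η ^ 2 / 4) (lam / 4 * r ^ 2)) (hb : b - c ≤ m)
    (ha : a - c - lam / 2 * r ^ 2 ≤ m) (hC : 0 ≤ C) (hC4 : 4 * C ≤ η * √lam) :
    a - c - lam / 2 * r ^ 2 + C * r ≤ m + C * (η / √lam) := by
  have hs : 0 < √lam := Real.sqrt_pos.2 hlam
  have hsq : √lam * √lam = lam := Real.mul_self_sqrt hlam.le
  -- For larger `r`, passing through the diagonal value `b` leaves `-(λ/4) r²` unused, and this
  -- absorbs `C r`.
  rcases le_total r (η / √lam) with h | h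
  · have := mul_le_mul_of_nonneg_left h hC
    linarith
  · have h1 : η ≤ r * √lam := (div_le_iff₀ hs).1 h
    have h2 : η ^ 2 ≤ lam * r ^ 2 := by
      calc η ^ 2 ≤ (r * √lam) ^ 2 := by gcongr
        _ = (√lam * √lam) * r ^ 2 := by ring
        _ = _ := by rw [hsq]
    have h3 : a - b ≤ lam / 4 * r ^ 2 := hab.trans (max_le (by linarith) le_rfl)
    have h4 : 4 * C ≤ r * lam := by
      calc 4 * C ≤ η * √lam := hC4
        _ ≤ (r * √lam) * √lam := by gcongr
        _ = r * lam := by rw [mul_assoc, hsq]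
    have h5 : 4 * C * r ≤ r * lam * r := mul_le_mul_of_nonneg_right h4 hr
    have h6 : 0 ≤ C * (η / √lam) := by positivity
    nlinarith

/-- Parametrizing time steps as `ρ⁵` turns the exponent `2/5` into the integer power `ρ²`. The
factor with `|T|` covers `ρ > 1`. -/
theorem exists_abs_sub_le_of_holderOnWith {β C : ℝ≥0} (hβ : 2 / 5 ≤ β)
    (hB : HolderOnWith C β B (Icc 0 T)) :
    ∃ C' : ℝ, 0 ≤ C' ∧ ∀ ρ, 0 ≤ ρ → ∀ s ∈ Icc 0 T, ∀ r ∈ Icc 0 T, |s - r| ≤ ρ ^ 5 →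
      |B s - B r| ≤ C' * ρ ^ 2 := by
  refine ⟨C * (1 + |T| ^ (β : ℝ)), by positivity, fun ρ hρ s hs r hr hsr => ?_⟩
  have h1 : |B s - B r| ≤ C * |s - r| ^ (β : ℝ) := by
    simpa [Real.dist_eq] using hB.dist_le hs hr
  have hβ' : (2 / 5 : ℝ) ≤ β := by exact_mod_cast hβ
  have hT : 0 ≤ |T| ^ (β : ℝ) := by positivity
  have h2 : |s - r| ^ (β : ℝ) ≤ (1 + |T| ^ (β : ℝ)) * ρ ^ 2 := by
    rcases le_total ρ 1 with h | h
    · have h3 : |s - r| ≤ 1 := hsr.trans (pow_le_one₀ hρ h)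
      calc |s - r| ^ (β : ℝ) ≤ |s - r| ^ (2 / 5 : ℝ) :=
            Real.rpow_le_rpow_of_exponent_ge' (abs_nonneg _) h3 (by norm_num) hβ'
        _ ≤ (ρ ^ 5) ^ (2 / 5 : ℝ) := by gcongr
        _ = ρ ^ 2 := by
            rw [← Real.rpow_natCast, ← Real.rpow_mul hρ, ← Real.rpow_natCast]; norm_num
        _ ≤ _ := by nlinarith [sq_nonneg ρ]
    · have h3 : |s - r| ≤ |T| := by
        rw [abs_of_nonneg (hs.1.trans hs.2), abs_le]
        constructor <;> linarith [hs.1, hs.2, hr.1, hr.2]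
      have h4 : |s - r| ^ (β : ℝ) ≤ |T| ^ (β : ℝ) := by gcongr
      have h5 : 1 ≤ ρ ^ 2 := one_le_pow₀ h
      nlinarith
  calc _ ≤ _ := h1
    _ ≤ C * ((1 + |T| ^ (β : ℝ)) * ρ ^ 2) := by gcongr
    _ = _ := by ring

theorem continuousOn_Ici_of_holderOnWith {β : ℝ≥0} (hβ : 0 < β)
    (hB : ∀ R : ℝ, ∃ C : ℝ≥0, HolderOnWith C β B (Icc 0 R)) : ContinuousOn B (Ici 0) := by
  intro x hx
  obtain ⟨C, hC⟩ := hB (x + 1)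
  refine (hC.continuousOn hβ x ⟨hx, by linarith⟩).mono_of_mem_nhdsWithin ?_
  filter_upwards [self_mem_nhdsWithin, mem_nhdsWithin_of_mem_nhds (Iic_mem_nhds (lt_add_one x))]
    with y h1 h2
  exact ⟨h1, h2⟩

/-- With steps of length `ρ⁵` and `λ = (κ/ρ)⁶`, the lifespan `τ = c λ^(-1/3)` equals `c ρ²/κ²` and
exceeds the oscillation `Cρ²`, by the smallness of `κ`. Each step costs `7KCρ² · η λ^(-1/2)`, of
order `ηρ⁵`, so the sum over `t/ρ⁵` steps is of order `η`, independently of `ρ`. -/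
theorem sub_le_add_of_holder
    (hu : IsPathwiseSubsolution (separatedHamiltonian H F) B T u)
    (hv : IsPathwiseSupersolution (separatedHamiltonian H F) B T v) (hB : ContinuousOn B (Ici 0))
    (h : SeparatedBounds K H F) (hK : 1 ≤ K) {C : ℝ} (hC : 0 ≤ C)
    (hBC : ∀ ρ, 0 ≤ ρ → ∀ s ∈ Icc 0 T, ∀ r ∈ Icc 0 T, |s - r| ≤ ρ ^ 5 → |B s - B r| ≤ C * ρ ^ 2)
    {κ : ℝ} (hκ : 0 < κ) (hκ1 : κ ≤ 1) (hκC : (C + 1) * κ ≤ 1 / 2 / (104 * K ^ 3))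
    {t m : ℝ} (ht : t ∈ Ioc 0 T) (hm : ∀ x, u x 0 - v x 0 ≤ m) {η : ℝ} (hη : 0 < η) (x : Rd d) :
    u x t - v x t ≤ m + η ^ 2 / 4 + 7 * K * C * t / κ ^ 3 * η := by
  obtain ⟨Z⟩ := h.nonempty_C1Flow
  have hK0 : 0 < K := by linarith
  set c := 1 / 2 / (104 * K ^ 3) with hc
  have hc0 : 0 < c := by positivity
  obtain ⟨Λ, hΛ⟩ := hu.1.exists_sub_le_max (η := η ^ 2 / 4) (by positivity)
  -- The three bounds ensure `ρ ≤ 1`, `λ ≥ max 1 Λ`, and that `η√λ` dominates the linear cost as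
  -- `sub_sub_sq_add_le` requires. The actual `ρ ≤ ρ₀` is then chosen so that `ρ⁵` divides `t` into
  -- `N` equal steps.
  set ρ₀ := min 1 (min (κ / max 1 Λ) (η * κ ^ 3 / (28 * K * C + 1))) with hρ₀
  have hρ₀0 : 0 < ρ₀ := by positivity
  obtain ⟨N, hN⟩ := exists_nat_gt (t / ρ₀ ^ 5)
  have ht0 : 0 < t := ht.1
  have hN0 : (0 : ℝ) < N := lt_of_le_of_lt (by positivity) hN
  obtain ⟨ρ, hρ, hρ5⟩ : ∃ ρ : ℝ, 0 < ρ ∧ ρ ^ 5 = t / N := by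
    refine ⟨(t / N) ^ (1 / 5 : ℝ), by positivity, ?_⟩
    rw [← Real.rpow_natCast, ← Real.rpow_mul (by positivity)]; norm_num
  have hρρ₀ : ρ ≤ ρ₀ := by
    refine (pow_le_pow_iff_left₀ hρ.le hρ₀0.le (by norm_num : 5 ≠ 0)).1 ?_
    rw [hρ5, div_le_iff₀ hN0]
    exact ((div_lt_iff₀' (by positivity)).1 hN).le
  have hρ1 : ρ ≤ 1 := hρρ₀.trans (min_le_left _ _)
  have hρΛ : max 1 Λ ≤ κ / ρ := by
    rw [le_div_iff₀ hρ, mul_comm, ← le_div_iff₀ (by positivity)]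
    exact hρρ₀.trans ((min_le_right _ _).trans (min_le_left _ _))
  have hρη : ρ * (28 * K * C + 1) ≤ η * κ ^ 3 := by
    rw [← le_div_iff₀ (by positivity)]
    exact hρρ₀.trans ((min_le_right _ _).trans (min_le_right _ _))
  have hκρ : 1 ≤ κ / ρ := (le_max_left _ _).trans hρΛ
  have hρκ : ρ ≤ κ := (one_le_div hρ).1 hκρ
  set lam := (κ / ρ) ^ 6 with hlam
  have hlam0 : 0 < lam := by positivity
  have hsqrt : √lam = (κ / ρ) ^ 3 := by
    rw [hlam, show (κ / ρ) ^ 6 = ((κ / ρ) ^ 3) ^ 2 by ring, Real.sqrt_sq (by positivity)]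
  have hΛlam : Λ ≤ lam := (le_max_right _ _).trans (hρΛ.trans (le_self_pow₀ hκρ (by norm_num)))
  set τ := c * (ρ / κ) ^ 2 with hτ
  have hτ0 : 0 < τ := by positivity
  have hτc : τ ≤ c := mul_le_of_le_one_right hc0.le
    (pow_le_one₀ (by positivity) ((div_le_one hκ).2 hρκ))
  have hlamτ : lam * τ ^ 3 = c ^ 3 := by rw [hlam, hτ]; field_simp
  have hCτ : C * ρ ^ 2 < τ := by
    have h1 : C * κ ^ 2 < c := by
      have : C * κ ^ 2 ≤ C * κ := by gcongr; exact pow_le_of_le_one hκ.le hκ1 (by norm_num)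
      linarith
    rw [hτ, div_pow, ← mul_div_assoc, lt_div_iff₀ (by positivity)]
    nlinarith [pow_pos hρ 2]
  have hs := fun ε (hε : 0 ≤ ε) (hετ : ε ≤ τ ^ 2) =>
    shortTime_of_le hK one_half_pos le_rfl hτ0 hτc hlam0 hlamτ.le hε hετ
  have hstep := fun {t₀ t₁ m : ℝ} (h0 : 0 ≤ t₀) (h01 : t₀ < t₁) h1T hBτ hm =>
    sub_sub_sq_le_of_step (t₀ := t₀) (t₁ := t₁) (m := m) hu hv hB h Z
      (fun ε hε hετ => (hs ε hε hετ).1) (hs 0 le_rfl (sq_nonneg _)).2 h0 h01 h1T hBτ hm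
  set e := 7 * K * (C * ρ ^ 2) * (η / √lam) with he
  have hee : (N : ℝ) * e = 7 * K * C * t / κ ^ 3 * η := by
    have h1 : (N : ℝ) * ρ ^ 5 = t := by rw [hρ5]; field_simp
    rw [he, hsqrt, ← h1]; field_simp
  have hnum : 4 * (7 * K * (C * ρ ^ 2)) ≤ η * √lam := by
    rw [hsqrt, div_pow, ← mul_div_assoc, le_div_iff₀ (by positivity)]
    have h1 : ρ ^ 5 ≤ ρ := pow_le_of_le_one hρ.le hρ1 (by norm_num)
    have h2 : 28 * K * C * ρ ^ 5 ≤ 28 * K * C * ρ := by gcongr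
    nlinarith
  have htj : ∀ j : ℕ, j ≤ N → (j : ℝ) * ρ ^ 5 ∈ Icc 0 T := fun j hj => by
    refine ⟨by positivity, le_trans ?_ ht.2⟩
    rw [hρ5, ← mul_div_assoc, div_le_iff₀ hN0, mul_comm]
    gcongr
  have claim : ∀ j : ℕ, j ≤ N → ∀ x y, u x (j * ρ ^ 5) - v y (j * ρ ^ 5) -
      lam / 2 * ‖x - y‖ ^ 2 ≤ m + η ^ 2 / 4 + j * e := by
    intro j
    induction j with
    | zero =>
      intro _ x y
      have h1 := hΛ lam hΛlam 0 ⟨le_rfl, ht0.le.trans ht.2⟩ x y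
      have h2 := hm y
      have h3 : max (η ^ 2 / 4) (lam / 4 * ‖x - y‖ ^ 2) ≤ η ^ 2 / 4 + lam / 2 * ‖x - y‖ ^ 2 :=
        max_le (by linarith [show 0 ≤ lam / 2 * ‖x - y‖ ^ 2 by positivity])
          (by linarith [show 0 ≤ lam / 4 * ‖x - y‖ ^ 2 by positivity, sq_nonneg η])
      simp only [Nat.cast_zero, zero_mul, add_zero]
      linarith
    | succ j ih =>
      intro hj x y
      have ih' := ih (by omega)
      have hI := htj j (by omega)
      have hI' := htj (j + 1) hj
      have hlt : (j : ℝ) * ρ ^ 5 < ((j + 1 : ℕ) : ℝ) * ρ ^ 5 := by push_cast; gcongr; linarith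
      have hlen : ((j + 1 : ℕ) : ℝ) * ρ ^ 5 = j * ρ ^ 5 + ρ ^ 5 := by push_cast; ring
      have hosc : ∀ r ∈ Icc ((j : ℝ) * ρ ^ 5) (((j + 1 : ℕ) : ℝ) * ρ ^ 5),
          |B r - B (((j + 1 : ℕ) : ℝ) * ρ ^ 5)| ≤ C * ρ ^ 2 := fun r hr =>
        hBC ρ hρ.le r ⟨hI.1.trans hr.1, hr.2.trans hI'.2⟩ _ hI' (by
          rw [abs_le]; constructor <;> linarith [hr.1, hr.2])
      refine hstep hI.1 hlt hI'.2 (fun r hr => (hosc r hr).trans_lt hCτ) (fun x y => ?_) x y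
      have hb := hosc _ ⟨le_rfl, hlt.le⟩
      -- The induction hypothesis enters twice: off the diagonal at `(x, y)`, and at `(y, y)`, where
      -- the quadratic term vanishes.
      have h1 := sub_sub_sq_add_le (C := 7 * K * (C * ρ ^ 2)) hlam0 (norm_nonneg (x - y)) hη
        (hΛ lam hΛlam _ hI x y) (by simpa using ih' y y) (ih' x y) (by positivity) hnum
      have h2 : 7 * K * |B (j * ρ ^ 5) - B (((j + 1 : ℕ) : ℝ) * ρ ^ 5)| * ‖x - y‖ ≤
          7 * K * (C * ρ ^ 2) * ‖x - y‖ := by gcongr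
      rw [← he] at h1
      push_cast at h2 ⊢
      linarith
  have hfin := claim N le_rfl x x
  have hNt : (N : ℝ) * ρ ^ 5 = t := by rw [hρ5]; field_simp
  rw [hNt, hee] at hfin
  simpa using hfin

/-- The comparison principle for pathwise viscosity solutions driven by Hölder paths. -/
theorem pathwise_comparison (h : SeparatedBounds K H F) {β : ℝ≥0} (hβ : 2 / 5 ≤ β)
    (hB : ∀ R : ℝ, ∃ C : ℝ≥0, HolderOnWith C β B (Icc 0 R))
    (hu : IsPathwiseSubsolution (separatedHamiltonian H F) B T u)
    (hv : IsPathwiseSupersolution (separatedHamiltonian H F) B T v) {t m : ℝ} (ht : t ∈ Icc 0 T)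
    (hm : ∀ x, u x 0 - v x 0 ≤ m) (x : Rd d) : u x t - v x t ≤ m := by
  rcases ht.1.eq_or_lt with rfl | ht0
  · exact hm x
  obtain ⟨C₀, hC₀⟩ := hB T
  obtain ⟨C, hC, hBC⟩ := exists_abs_sub_le_of_holderOnWith hβ hC₀
  have hBc := continuousOn_Ici_of_holderOnWith (lt_of_lt_of_le (by norm_num) hβ) hB
  set K' := max K 1 with hK'
  have hK1 : 1 ≤ K' := le_max_right _ _
  set c := 1 / 2 / (104 * K' ^ 3) with hc
  have hc0 : 0 < c := by positivity
  have hC1 : 0 < C + 1 := by linarith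
  set κ := min 1 (c / (C + 1)) with hκ
  have hκ0 : 0 < κ := by positivity
  have hκC : (C + 1) * κ ≤ c := by
    rw [← le_div_iff₀' hC1]; exact min_le_right _ _
  have key : ∀ η, 0 < η → u x t - v x t ≤ m + η ^ 2 / 4 + 7 * K' * C * t / κ ^ 3 * η := fun η hη =>
    sub_le_add_of_holder hu hv hBc (h.mono (le_max_left K 1)) hK1 hC hBC hκ0 (min_le_left _ _) hκC
      ⟨ht0, ht.2⟩ hm hη x
  have hlim : Tendsto (fun η : ℝ => m + η ^ 2 / 4 + 7 * K' * C * t / κ ^ 3 * η) (𝓝[>] 0) (𝓝 m) :=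
    tendsto_nhdsWithin_of_tendsto_nhds (Continuous.tendsto' (by fun_prop) 0 m (by simp))
  refine ge_of_tendsto hlim ?_
  filter_upwards [self_mem_nhdsWithin] with η hη using key η hη

theorem iSup_sub_le_iSup_sub (h : SeparatedBounds K H F) {β : ℝ≥0} (hβ : 2 / 5 ≤ β)
    (hB : ∀ R : ℝ, ∃ C : ℝ≥0, HolderOnWith C β B (Icc 0 R))
    (hu : IsPathwiseSubsolution (separatedHamiltonian H F) B T u)
    (hv : IsPathwiseSupersolution (separatedHamiltonian H F) B T v) {t : ℝ} (ht : t ∈ Icc 0 T) :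
    (⨆ x : Rd d, (u x t - v x t)) ≤ ⨆ x : Rd d, (u x 0 - v x 0) := by
  obtain ⟨Mu, hMu⟩ := hu.1.1
  obtain ⟨Mv, hMv⟩ := hv.1.1
  have h0 : (0 : ℝ) ∈ Icc 0 T := ⟨le_rfl, ht.1.trans ht.2⟩
  -- Boundedness is needed because the supremum of an unbounded real family is `0` by convention.
  have hbdd : BddAbove (range fun x : Rd d => u x 0 - v x 0) := by
    refine ⟨Mu + Mv, ?_⟩
    rintro _ ⟨x, rfl⟩
    have h1 := (abs_le.1 (hMu x 0 h0)).2
    have h2 := (abs_le.1 (hMv x 0 h0)).1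
    simp only
    linarith
  exact ciSup_le fun x => pathwise_comparison h hβ hB hu hv ht (fun x => le_ciSup hbdd x) x
end

theorem mainTheorem7 (d : ℕ) :
    -- times of existence for the doubled equation
    (∀ K : ℝ, ∃ c : ℝ, 0 < c ∧ ∀ H F : Rd d → ℝ, SeparatedBounds K H F → ∀ lam : ℝ, 0 < lam →
      -- the characteristics exist
      (∃ X Y P Q : Rd d → Rd d → ℝ → Rd d,
        IsDoubledCharacteristicFlow (separatedHamiltonian H F) lam X Y P Q) ∧
      -- and the first time at which their Jacobian is `1 / 2` is bounded from below
      (∀ X Y P Q : Rd d → Rd d → ℝ → Rd d,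
        IsDoubledCharacteristicFlow (separatedHamiltonian H F) lam X Y P Q →
        (∀ t : ℝ, ContDiff ℝ 1 (flowMap X Y t)) ∧
        ∀ (x y : Rd d) (tlam : ℝ),
          IsLeast {t : ℝ | 0 < t ∧ flowJacobian X Y x y t = 1 / 2} tlam →
          c * min 1 (lam ^ (-(1 / 3) : ℝ)) ≤ tlam) ∧
      -- smooth solutions of the doubled equation
      ∃ U : Rd d → Rd d → ℝ → ℝ,
        IsSmoothDoubledSolution (separatedHamiltonian H F) lam
          (c * min 1 (lam ^ (-(1 / 3) : ℝ))) U) ∧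
    -- comparison
    (∀ (K : ℝ) (H F : Rd d → ℝ), SeparatedBounds K H F →
      ∀ (β : ℝ≥0), 2 / 5 ≤ β →
      ∀ B : ℝ → ℝ, (∀ R : ℝ, ∃ C : ℝ≥0, HolderOnWith C β B (Set.Icc 0 R)) →
      ∀ T : ℝ, 0 < T →
      ∀ u v : Rd d → ℝ → ℝ,
        IsPathwiseSubsolution (separatedHamiltonian H F) B T u →
        IsPathwiseSupersolution (separatedHamiltonian H F) B T v →
        ∀ t ∈ Set.Icc 0 T, (⨆ x : Rd d, (u x t - v x t)) ≤ ⨆ x : Rd d, (u x 0 - v x 0)) := by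
  exact ⟨exists_doubled_time d, fun _ _ _ h _ hβ _ hB _ _ _ _ hu hv _ ht =>
    iSup_sub_le_iSup_sub h hβ hB hu hv ht⟩
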